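/- Let $\sigma_0\ge\sigma_1>0$ be real. Let $F$ belong to the class $\mathcal S^{\sharp\flat}(\sigma_0,\sigma_1)$, i.e. $F\not\equiv 0$ is a meromorphic function on $\mathbb C$ such that: (i) $F(s)=\sum_{n\ge1}a_F(n)n^{-s}$, absolutely convergent for $\operatorname{Re}s>\sigma_0$. (ii) There are complex numbers $s_1,\dots,s_N$ and integers $m_1,\dots,m_N\ge0$ (in particular, all poles of $F$ are among the $s_i$) such that $\prod_{i=1}^N(s-s_i)^{m_i}F(s)$ is an entire function of finite order. (iii) There are $Q_F>0$, $|\omega|=1$, $r\ge 0$, $\lambda_j>0$, $\mu_j\in\mathbb C$ ($1\le j\le r$) and $M\ge0$ such that the completed function $$\xi_F(s)=F(s)\,Q_F^s\prod_{j=1}^r\Gamma(\lambda_js+\mu_j)\prod_{i=1}^{2M+\delta}(s-s_i)^{m_i}\prod_{i=2M+\delta+1}^N(s-s_i)^{m_i}(\sigma_1-s-\overline{s_i})^{m_i}$$ is entire (after removal of its removable singularities) and satisfies $\xi_F(s)=\omega\,\overline{\xi_F(\sigma_1-\overline s)}$. Here $\delta=1$ if $\sigma_1/2$ is a pole of $F$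 and $\delta=0$ otherwise, and the $s_i$ are arranged so that $2M+\delta\le N$, $s_{2j-1}+\overline{s_{2j}}=\sigma_1$ for $1\le j\le M$, and $s_{2M+\delta}=\sigma_1/2$ if $\delta=1$. (iv) $\dfrac{F'}{F}(s)=-\sum_{n\ge2}c_F(n)n^{-s}$, absolutely convergent for $\operatorname{Re}s>\sigma_0$. Let $Z(F)$ be the set of zeros of $\xi_F$. Let $\tau\in[\sigma_1,2\sigma_0]$ be such that $0,\tau\notin Z(F)$, and let $n\ge1$ be an integer. Then for every $T$ only finitely many $\rho\in Z(F)$ satisfy $|\operatorname{Im}\rho|\le T$, the limit $$\lambda_F(n,\tau)=\lim_{T\to\infty}\sum_{\rho\in Z(F),\ |\operatorname{Im}\rho|\le T}\Bigl(1-\Bigl(\frac{\rho}{\rho-\tau}\Bigr)^n\Bigr)$$ (zeros counted with multiplicity) exists, and $$\lambda_F(n,\tau)=\frac{\tau}{(n-1)!}\left[\frac{d^n}{ds^n}\bigl(s^{n-1}\log\xi_F(s)\bigr)\right]_{s=\tau}=\frac1{\tau^n}\,d_F\Bigl(n-1,1-\frac1\tau\Bigr).$$ Here $\log\xi_F$ is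 any analytic branch of the logarithm of $\xi_F$ near $\tau$ (such a branch exists), and $d_F(k,z_0)$ are the Taylor coefficients of the logarithmic derivative of $\xi_F\bigl(\tfrac1{1-s}\bigr)$: $$\frac{d}{ds}\log\xi_F\Bigl(\frac1{1-s}\Bigr)=\sum_{k=0}^\infty d_F(k,z_0)(s-z_0)^k\qquad\text{for } s \text{ near } z_0=1-\frac1\tau.$$ -/

import Mathlib

noncomputable section

namespace TauLi

open Filter Topology

/-- An entire function of finite order: `‖G z‖ ≤ C exp(‖z‖ ^ κ)` for some real `C`, `κ ≥ 0`. -/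
def IsEntireOfFiniteOrder (G : ℂ → ℂ) : Prop :=
  Differentiable ℂ G ∧
    ∃ C κ : ℝ, 0 ≤ κ ∧ ∀ z : ℂ, ‖G z‖ ≤ C * Real.exp (‖z‖ ^ κ)

/-- The parameters of a completed function. Only `s i`, `m i` with `1 ≤ i ≤ N` are used. -/
structure CompletionData where
  Q : ℝ
  ω : ℂ
  r : ℕ
  lam : Fin r → ℝ
  mu : Fin r → ℂ
  N : ℕ
  s : ℕ → ℂ
  m : ℕ → ℕ
  M : ℕ

open Classical in
/-- `δ(σ₁)`: equal to `1` if `σ₁ / 2` is a pole of `F`, and to `0` otherwise. -/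
def poleAtCentre (F : ℂ → ℂ) (σ₁ : ℝ) : ℕ :=
  if meromorphicOrderAt F ((σ₁ : ℂ) / 2) < 0 then 1 else 0

/-- The product of `F(s)`, `Q ^ s`, the gamma factors and the polynomial factors, evaluated
pointwise; meaningful away from the poles of the individual factors. -/
def rawXi (σ₁ : ℝ) (F : ℂ → ℂ) (D : CompletionData) (z : ℂ) : ℂ :=
  F z * (D.Q : ℂ) ^ z * (∏ j, Complex.Gamma ((D.lam j : ℂ) * z + D.mu j)) *
    (∏ i ∈ Finset.Icc 1 (2 * D.M + poleAtCentre F σ₁), (z - D.s i) ^ D.m i) *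
    ∏ i ∈ Finset.Icc (2 * D.M + poleAtCentre F σ₁ + 1) D.N,
      ((z - D.s i) ^ D.m i * ((σ₁ : ℂ) - z - (starRingEnd ℂ) (D.s i)) ^ D.m i)

/-- The completed function `ξ_F`: the product above as a meromorphic function on `ℂ`, with
all removable singularities removed (so it is the continuous extension at each of them). -/
def xi (σ₁ : ℝ) (F : ℂ → ℂ) (D : CompletionData) : ℂ → ℂ :=
  toMeromorphicNFOn (rawXi σ₁ F D) Set.univ

/-- `F` belongs to the class `S^{♯♭}(σ₀, σ₁)`, and `D` are parameters of its completed function. -/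
structure InClass (σ₀ σ₁ : ℝ) (F : ℂ → ℂ) (D : CompletionData) : Prop where
  sigma_pos : 0 < σ₁
  sigma_le : σ₁ ≤ σ₀
  /-- Dirichlet series, absolutely convergent for `Re z > σ₀`. -/
  dirichlet : ∃ a : ℕ → ℂ, ∀ z : ℂ, σ₀ < z.re → LSeriesSummable a z ∧ F z = LSeries a z
  /-- Analytic continuation: `∏ (z - s_i) ^ m_i * F z` is entire of finite order. -/
  continuation : ∃ G : ℂ → ℂ, IsEntireOfFiniteOrder G ∧
    ∀ z : ℂ, (∀ i ∈ Finset.Icc 1 D.N, z ≠ D.s i) →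
      G z = (∏ i ∈ Finset.Icc 1 D.N, (z - D.s i) ^ D.m i) * F z
  Q_pos : 0 < D.Q
  norm_omega : ‖D.ω‖ = 1
  lam_pos : ∀ j, 0 < D.lam j
  /-- Arrangement of the `s_i`: first `M` pairs, then `σ₁ / 2` if it is a pole, then the rest. -/
  count_le : 2 * D.M + poleAtCentre F σ₁ ≤ D.N
  pairs : ∀ j ∈ Finset.Icc 1 D.M,
    D.s (2 * j - 1) + (starRingEnd ℂ) (D.s (2 * j)) = (σ₁ : ℂ)
  centre : poleAtCentre F σ₁ = 1 → D.s (2 * D.M + poleAtCentre F σ₁) = (σ₁ : ℂ) / 2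
  /-- The completed function is entire. -/
  xi_entire : Differentiable ℂ (xi σ₁ F D)
  /-- Functional equation. -/
  functional_equation : ∀ z : ℂ,
    xi σ₁ F D z = D.ω * (starRingEnd ℂ) (xi σ₁ F D ((σ₁ : ℂ) - (starRingEnd ℂ) z))
  /-- `F` is not identically zero, so that `F' / F` is defined as a meromorphic function. -/
  ne_zero : ∃ z : ℂ, σ₀ < z.re ∧ F z ≠ 0
  /-- Euler sum: `F' / F` is minus a Dirichlet series over `n ≥ 2`, absolutely convergent
  for `Re z > σ₀`. -/
  euler_sum : ∃ c : ℕ → ℂ, c 1 = 0 ∧ ∀ z : ℂ, σ₀ < z.re →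
    LSeriesSummable c z ∧ (F z ≠ 0 → deriv F z / F z = -LSeries c z)

/-- The non-trivial zeros `ρ` (the zeros of the completed function) with `|Im ρ| ≤ T`. -/
def zerosUpTo (ξ : ℂ → ℂ) (T : ℝ) : Set ℂ := {ρ | ξ ρ = 0 ∧ |ρ.im| ≤ T}

/-- The sum of `1 - (ρ / (ρ - τ)) ^ n` over the zeros with `|Im ρ| ≤ T`, with multiplicity. -/
def tauLiPartial (ξ : ℂ → ℂ) (n : ℕ) (τ : ℝ) (T : ℝ) : ℂ :=
  ∑ᶠ ρ ∈ zerosUpTo ξ T, (analyticOrderNatAt ξ ρ : ℂ) * (1 - (ρ / (ρ - (τ : ℂ))) ^ n)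

/-- The `τ`-Li coefficient, the limit of the partial sums as `T → ∞`. -/
def tauLi (ξ : ℂ → ℂ) (n : ℕ) (τ : ℝ) : ℂ := limUnder atTop (tauLiPartial ξ n τ)

/-- `ℓ` is an analytic branch of `log f` near `z`. -/
def IsLogBranchAt (f ℓ : ℂ → ℂ) (z : ℂ) : Prop :=
  AnalyticAt ℂ ℓ z ∧ ∀ᶠ w in 𝓝 z, Complex.exp (ℓ w) = f w

/-- The logarithmic derivative of `w ↦ ξ(1 / (1 - w))`. -/
def logDerivTransform (ξ : ℂ → ℂ) : ℂ → ℂ := logDeriv fun w => ξ (1 / (1 - w))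

/-- The Taylor coefficients `d(n, z₀)` of the logarithmic derivative of `w ↦ ξ(1 / (1 - w))`. -/
def dCoeff (ξ : ℂ → ℂ) (n : ℕ) (z₀ : ℂ) : ℂ :=
  iteratedDeriv n (logDerivTransform ξ) z₀ / (n.factorial : ℂ)

end TauLi

end

/-!
The completed function `ξ` is entire, and by its functional equation its zeros are symmetric under
`ρ ↦ σ₁ - conj ρ`. The theorem rests on the symmetric expansion
`ξ'/ξ(s) = lim_{T → ∞} ∑_{|Im ρ| ≤ T} 1 / (s - ρ)`, `IsStripFunction.tendsto_sum_one_div`. Given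
this, `1 - (ρ / (ρ - τ)) ^ n` is expanded by the binomial theorem in powers of `1 / (τ - ρ)`. The sum
of the first powers is `ξ'/ξ(τ)`, the sums of the higher powers converge absolutely to Taylor
coefficients of `ξ'/ξ` at `τ` (`IsStripFunction.hasSum_pow`), and the resulting combination is what
the Leibniz rule gives for the `n`-th derivative of `s ^ (n - 1) log ξ(s)`
(`IsLogBranchAt.mul_iteratedDeriv`). The last formula is the change of variable `s = 1 / (1 - w)`
(`IsLogBranchAt.dCoeff_eq`).

*Absolutely convergent expansions.* Far to the right, and by the functional equation far to the left,
`ξ` grows slower than every Gaussian `exp (A |z| ^ 2)`. In vertical strips it has finite order times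
bounded gamma factors, so the Phragmén–Lindelöf principle extends the bound to the whole plane
(`growth_of_strip`). After the zeros in a large disc have been divided out, the Borel–Carathéodory
inequality shows that `ξ'/ξ(s) - ξ'/ξ(s')` is the limit of the sums of `1 / (s - ρ) - 1 / (s' - ρ)`
over the zeros in discs (`exists_radius_norm_logDeriv_sub_sub_sum_le`); the Hadamard product is not
needed. For `s' = σ₁ - conj s` with `Re s` large all these terms have positive real parts. This bounds
the number of zeros near a given height by `ξ'/ξ` (`IsStripFunction.tsum_poisson_le`) and makes the
expansion absolutely convergent (`IsStripFunction.hasSum_kernel`).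

*The symmetric sum.* It is therefore enough to know the symmetric sum at one real point `x`. Its real
part is obtained by averaging over the symmetry `ρ ↦ σ₁ - conj ρ`
(`IsStripFunction.tendsto_sum_re`). The imaginary part requires that the zeros above and below the
real axis almost balance. Far to the right `F'/F` decays and the digamma function varies slowly, so
`ξ'/ξ(s)` and `conj (ξ'/ξ(conj s))` differ by `O(1 / Re s)`. The real part of this difference is a
sum of Poisson kernels at the ordinates of the zeros, odd in the ordinate. Integrated along a vertical
segment it counts, up to smoothing, the zeros with `0 < Im ρ ≤ T` minus those with `-T ≤ Im ρ < 0`, and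
this difference turns out to be `O(T ^ (7 / 8))` (`IsStripFunction.exists_abs_signedCount_le`). By
partial summation the imaginary parts of the symmetric sums converge uniformly in `x`
(`IsStripFunction.exists_uniform_tail`), and letting `x → ∞` determines the remaining constant
(`IsStripFunction.tendsto_sum_im`).
-/

namespace TauLi

open Filter Topology

/-! ### Digamma differences -/

theorem norm_add_natCast_ge (z : ℂ) (k : ℕ) : z.re + k ≤ ‖z + k‖ := by
  have := Complex.re_le_norm (z + k)
  simpa using this

theorem add_natCast_ne_zero {z : ℂ} (hz : 0 < z.re) (k : ℕ) : z + k ≠ 0 := by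
  intro h
  have := congrArg Complex.re h
  simp at this
  have : (0 : ℝ) ≤ k := Nat.cast_nonneg k
  linarith

theorem ne_neg_natCast {z : ℂ} (hz : 0 < z.re) (m : ℕ) : z ≠ -m := fun h =>
  add_natCast_ne_zero hz m (by rw [h]; ring)

theorem digamma_add_natCast {z : ℂ} (hz : 0 < z.re) (n : ℕ) :
    Complex.digamma (z + n) = Complex.digamma z + ∑ k ∈ Finset.range n, 1 / (z + k) := by
  induction n with
  | zero => simp
  | succ n ih =>
    have h : 0 < (z + n).re := by simp; positivity
    rw [Finset.sum_range_succ, ← add_assoc, ← ih, one_div,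
      ← Complex.digamma_apply_add_one _ (ne_neg_natCast h)]
    push_cast; ring_nf

theorem hasDerivAt_log_Gamma_real {x : ℝ} (hx : 0 < x) :
    HasDerivAt (Real.log ∘ Real.Gamma) (Complex.digamma x).re x := by
  have h1 : DifferentiableAt ℂ Complex.Gamma x :=
    Complex.differentiableAt_Gamma _ (ne_neg_natCast (by simpa using hx))
  have h2 := h1.hasDerivAt.real_of_complex
  have h3 : HasDerivAt Real.Gamma (deriv Complex.Gamma x).re x := by
    simpa [Complex.Gamma_ofReal] using h2
  have h4 := h3.log (Real.Gamma_pos_of_pos hx).ne'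
  have h5 : (Complex.digamma x).re = (deriv Complex.Gamma x).re / Real.Gamma x := by
    rw [Complex.digamma_def, logDeriv_apply, Complex.Gamma_ofReal, Complex.div_ofReal_re]
  rw [h5]
  exact h4

theorem conj_digamma {z : ℂ} (hz : 0 < z.re) :
    Complex.digamma ((starRingEnd ℂ) z) = (starRingEnd ℂ) (Complex.digamma z) := by
  have h1 : DifferentiableAt ℂ Complex.Gamma z :=
    Complex.differentiableAt_Gamma _ (ne_neg_natCast hz)
  have h2 := h1.hasDerivAt.conj_conj
  have h3 : (⇑(starRingEnd ℂ) ∘ Complex.Gamma ∘ ⇑(starRingEnd ℂ)) = Complex.Gamma := by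
    funext w; simp [Complex.Gamma_conj]
  rw [h3] at h2
  rw [Complex.digamma_def, logDeriv_apply, logDeriv_apply, h2.deriv, Complex.Gamma_conj, map_div₀]

theorem ofReal_re_digamma {x : ℝ} (hx : 0 < x) :
    ((Complex.digamma x).re : ℂ) = Complex.digamma x := by
  rw [← Complex.conj_eq_iff_re, ← conj_digamma (by simpa using hx), Complex.conj_ofReal]

/-- The digamma function increases on the positive reals, since `log Γ` is convex there. -/
theorem re_digamma_mono {x y : ℝ} (hx : 0 < x) (hxy : x ≤ y) :
    (Complex.digamma x).re ≤ (Complex.digamma y).re := by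
  have h := Real.convexOn_log_Gamma.monotoneOn_deriv
    (fun x hx => (hasDerivAt_log_Gamma_real hx).differentiableAt)
  have := h (a := x) (b := y) hx (lt_of_lt_of_le hx hxy) hxy
  rwa [(hasDerivAt_log_Gamma_real hx).deriv,
    (hasDerivAt_log_Gamma_real (lt_of_lt_of_le hx hxy)).deriv] at this

/-- By monotonicity the difference lies between `0` and finitely many terms `1 / (x + n + k)` of the
recurrence for the digamma function. -/
theorem tendsto_digamma_natCast_sub {x y : ℝ} (hx : 0 < x) (hxy : x ≤ y) :
    Tendsto (fun n : ℕ => Complex.digamma (y + n) - Complex.digamma (x + n)) atTop (𝓝 0) := by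
  obtain ⟨m, hm⟩ := exists_nat_ge (y - x)
  have key : ∀ n : ℕ, ‖Complex.digamma (y + n) - Complex.digamma (x + n)‖ ≤
      ∑ k ∈ Finset.range m, 1 / (x + n + k) := by
    intro n
    have hn : (0 : ℝ) ≤ n := Nat.cast_nonneg n
    have h1 : (Complex.digamma ((x + n : ℝ))).re ≤ (Complex.digamma ((y + n : ℝ))).re :=
      re_digamma_mono (by positivity) (by linarith)
    have hy : 0 < y + n := by linarith
    have h2 : (Complex.digamma ((y + n : ℝ))).re ≤ (Complex.digamma ((x + n + m : ℝ))).re :=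
      re_digamma_mono hy (by linarith)
    have h3 := digamma_add_natCast (z := ((x + n : ℝ) : ℂ)) (by simp; positivity) m
    have h4 : (Complex.digamma ((x + n + m : ℝ))).re = (Complex.digamma ((x + n : ℝ))).re +
        ∑ k ∈ Finset.range m, 1 / (x + n + k) := by
      have : (((x + n + m : ℝ)) : ℂ) = ((x + n : ℝ) : ℂ) + m := by push_cast; ring
      rw [this, h3, Complex.add_re]
      congr 1
      rw [← Complex.ofReal_re (∑ k ∈ Finset.range m, 1 / (x + n + k))]
      congr 1
      push_cast
      rfl
    have e1 := ofReal_re_digamma (x := x + n) (by positivity)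
    have e2 := ofReal_re_digamma (x := y + n) (by linarith)
    have e3 : ((x + n : ℝ) : ℂ) = x + n := by push_cast; rfl
    have e4 : ((y + n : ℝ) : ℂ) = y + n := by push_cast; rfl
    rw [← e3, ← e4, ← e1, ← e2, ← Complex.ofReal_sub, Complex.norm_real, Real.norm_eq_abs, abs_le]
    constructor <;> linarith
  refine squeeze_zero_norm key ?_
  rw [show (0 : ℝ) = ∑ k ∈ Finset.range m, (0 : ℝ) by simp]
  refine tendsto_finsetSum _ fun k _ => ?_
  have : Tendsto (fun n : ℕ => x + n + k) atTop atTop :=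
    tendsto_atTop_add_const_right _ _ (tendsto_atTop_add_const_left _ _ tendsto_natCast_atTop_atTop)
  simpa [Pi.inv_def] using this.inv_tendsto_atTop

theorem norm_one_div_sub_le {z w : ℂ} {δ : ℝ} (hδ : 0 < δ) (hz : δ ≤ z.re) (hw : δ ≤ w.re) (k : ℕ) :
    ‖1 / (w + k) - 1 / (z + k)‖ ≤ ‖z - w‖ * (1 / (δ + k) ^ 2) := by
  have h1 := norm_add_natCast_ge z k
  have h2 := norm_add_natCast_ge w k
  have hk : (0 : ℝ) ≤ k := Nat.cast_nonneg k
  rw [div_sub_div _ _ (add_natCast_ne_zero (by linarith) k) (add_natCast_ne_zero (by linarith) k),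
    norm_div, norm_mul, div_eq_mul_one_div]
  have : (1 * (z + k) - (w + k) * 1) = z - w := by ring
  rw [this]
  gcongr
  rw [sq]
  gcongr <;> linarith

theorem summable_one_div_add_sq {δ : ℝ} (hδ : 0 < δ) :
    Summable fun k : ℕ => 1 / (δ + k) ^ 2 := by
  have h1 : Summable fun k : ℕ => 1 / ((k : ℝ) + 1) ^ 2 := by
    have := (summable_nat_add_iff 1).2 (Real.summable_one_div_nat_pow.2 (by norm_num : 1 < 2))
    simpa using this
  have hc : 0 < min δ 1 := lt_min hδ one_pos
  refine Summable.of_nonneg_of_le (fun k => by positivity) (fun k => ?_)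
    (h1.mul_left (1 / (min δ 1) ^ 2))
  have hk : (0 : ℝ) ≤ k := Nat.cast_nonneg k
  rw [one_div_mul_one_div, ← mul_pow]
  have : min δ 1 * ((k : ℝ) + 1) ≤ δ + k := by
    have a1 := min_le_left δ 1
    have a2 := min_le_right δ 1
    nlinarith
  gcongr

theorem summable_digamma_series {z w : ℂ} (hz : 0 < z.re) (hw : 0 < w.re) :
    Summable fun k : ℕ => 1 / (w + k) - 1 / (z + k) := by
  refine Summable.of_norm_bounded ((summable_one_div_add_sq (lt_min hz hw)).mul_left ‖z - w‖)
    fun k => norm_one_div_sub_le (lt_min hz hw) (min_le_left _ _) (min_le_right _ _) k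

theorem differentiableOn_digamma_series :
    DifferentiableOn ℂ (fun z : ℂ => ∑' k : ℕ, (1 / (1 + (k : ℂ)) - 1 / (z + k)))
      {z | 0 < z.re} := by
  intro z hz
  set δ := min (z.re / 2) 1 with hδ
  have hδ0 : 0 < δ := lt_min (half_pos hz) one_pos
  set U : Set ℂ := {w | δ < w.re} ∩ Metric.ball 0 (‖z‖ + 1) with hU
  have hUo : IsOpen U := (isOpen_lt continuous_const Complex.continuous_re).inter Metric.isOpen_ball
  have hzU : z ∈ U := by
    refine ⟨?_, by simp⟩
    exact lt_of_le_of_lt (min_le_left _ _) (half_lt_self (show 0 < z.re from hz))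
  have := Complex.differentiableOn_tsum_of_summable_norm (U := U)
    (F := fun (k : ℕ) (z : ℂ) => 1 / (1 + (k : ℂ)) - 1 / (z + k))
    (u := fun k => (‖z‖ + 2) * (1 / (δ + k) ^ 2))
    ((summable_one_div_add_sq hδ0).mul_left _) ?_ hUo ?_
  · exact (this.differentiableAt (hUo.mem_nhds hzU)).differentiableWithinAt
  · intro k
    refine DifferentiableOn.sub (by fun_prop) (DifferentiableOn.div (by fun_prop) (by fun_prop) ?_)
    intro w hw
    exact add_natCast_ne_zero (lt_trans hδ0 hw.1) k
  · intro k w hw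
    refine (norm_one_div_sub_le hδ0 hw.1.le (by simp [hδ]) k).trans ?_
    gcongr
    have : ‖w‖ < ‖z‖ + 1 := by simpa using hw.2
    calc ‖w - 1‖ ≤ ‖w‖ + ‖(1 : ℂ)‖ := norm_sub_le _ _
      _ ≤ ‖z‖ + 2 := by simp; linarith

theorem digamma_ofReal_sub_digamma_one {x : ℝ} (hx : 0 < x) :
    Complex.digamma x - Complex.digamma 1 = ∑' k : ℕ, (1 / (1 + (k : ℂ)) - 1 / ((x : ℂ) + k)) := by
  have hs := summable_digamma_series (z := x) (w := 1) (by simpa using hx) (by simp)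
  have h1 := hs.hasSum.tendsto_sum_nat
  have h2 : Tendsto (fun n : ℕ => Complex.digamma (x + n) - Complex.digamma (1 + n)) atTop
      (𝓝 0) := by
    rcases le_total 1 x with h | h
    · simpa using tendsto_digamma_natCast_sub one_pos h
    · have := (tendsto_digamma_natCast_sub hx h).neg
      simpa using this
  have h3 : ∀ n : ℕ, ∑ k ∈ Finset.range n, (1 / (1 + (k : ℂ)) - 1 / ((x : ℂ) + k)) =
      Complex.digamma x - Complex.digamma 1 -
        (Complex.digamma (x + n) - Complex.digamma (1 + n)) := by
    intro n
    rw [digamma_add_natCast (by simpa using hx), digamma_add_natCast (by simp),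
      Finset.sum_sub_distrib]
    ring
  simp_rw [h3] at h1
  have h4 := (tendsto_const_nhds (x := Complex.digamma x - Complex.digamma 1)).sub h2
  rw [sub_zero] at h4
  exact tendsto_nhds_unique h4 h1

/-- The two sides agree on the positive reals, hence on the right half-plane by the identity
theorem. -/
theorem digamma_sub_digamma_one {z : ℂ} (hz : 0 < z.re) :
    Complex.digamma z - Complex.digamma 1 = ∑' k : ℕ, (1 / (1 + (k : ℂ)) - 1 / (z + k)) := by
  have hopen : IsOpen {z : ℂ | 0 < z.re} := isOpen_lt continuous_const Complex.continuous_re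
  have hΓ : DifferentiableOn ℂ Complex.Gamma {z | 0 < z.re} := fun w hw =>
    (Complex.differentiableAt_Gamma _ (ne_neg_natCast hw)).differentiableWithinAt
  have hψ : DifferentiableOn ℂ (fun z => Complex.digamma z - Complex.digamma 1) {z | 0 < z.re} := by
    refine DifferentiableOn.sub_const ?_ _
    rw [Complex.digamma_def]
    exact (hΓ.deriv hopen).div hΓ fun w hw => Complex.Gamma_ne_zero (ne_neg_natCast hw)
  refine AnalyticOnNhd.eqOn_of_preconnected_of_frequently_eq (hψ.analyticOnNhd hopen)
    (differentiableOn_digamma_series.analyticOnNhd hopen)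
    (convex_halfSpace_re_gt 0).isPreconnected (z₀ := 1) (by simp) ?_ hz
  have hseq : Tendsto (fun n : ℕ => ((1 + 1 / ((n : ℝ) + 1) : ℝ) : ℂ)) atTop (𝓝[≠] 1) := by
    refine tendsto_nhdsWithin_iff.2 ⟨?_, .of_forall fun n => ?_⟩
    · have : Tendsto (fun n : ℕ => 1 + 1 / ((n : ℝ) + 1)) atTop (𝓝 (1 + 0)) :=
        tendsto_one_div_add_atTop_nhds_zero_nat.const_add 1
      rw [add_zero] at this
      exact (Complex.continuous_ofReal.tendsto 1).comp this
    · simp only [Set.mem_compl_iff, Set.mem_singleton_iff]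
      rw [← Complex.ofReal_one, Complex.ofReal_inj]
      have : 0 < 1 / ((n : ℝ) + 1) := by positivity
      linarith
  exact hseq.frequently (Filter.Eventually.frequently (.of_forall fun n =>
    digamma_ofReal_sub_digamma_one (by positivity)))

/-- The partial fraction expansion of the digamma function, as a difference of two values. -/
theorem hasSum_digamma_sub {z w : ℂ} (hz : 0 < z.re) (hw : 0 < w.re) :
    HasSum (fun k : ℕ => 1 / (w + k) - 1 / (z + k)) (Complex.digamma z - Complex.digamma w) := by
  have h1 := (summable_digamma_series (z := z) (w := 1) hz (by simp)).hasSum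
  have h2 := (summable_digamma_series (z := w) (w := 1) hw (by simp)).hasSum
  rw [← digamma_sub_digamma_one hz] at h1
  rw [← digamma_sub_digamma_one hw] at h2
  have h3 := h1.sub h2
  simp only [sub_sub_sub_cancel_left, sub_sub_sub_cancel_right] at h3
  exact h3

theorem tsum_one_div_add_sq_le {x : ℝ} (hx : 1 < x) :
    ∑' k : ℕ, 1 / (x + k) ^ 2 ≤ 1 / (x - 1) := by
  refine Real.tsum_le_of_sum_range_le (fun k => by positivity) fun n => ?_
  have : ∀ n : ℕ, ∑ k ∈ Finset.range n, 1 / (x + k) ^ 2 ≤ 1 / (x - 1) - 1 / (x - 1 + n) := by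
    intro n
    induction n with
    | zero => simp
    | succ n ih =>
      rw [Finset.sum_range_succ]
      have hn : (0 : ℝ) ≤ n := Nat.cast_nonneg n
      have : 1 / (x + n) ^ 2 ≤ 1 / (x - 1 + n) - 1 / (x - 1 + (n + 1 : ℕ)) := by
        have e : x - 1 + ((n + 1 : ℕ) : ℝ) = x + n := by push_cast; ring
        rw [e, div_sub_div _ _ (by linarith) (by linarith)]
        rw [div_le_div_iff₀ (by positivity) (mul_pos (by linarith) (by linarith))]
        nlinarith
      linarith
  have h2 := this n
  have hn : (0 : ℝ) ≤ n := Nat.cast_nonneg n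
  have : 0 ≤ 1 / (x - 1 + n) := by
    apply div_nonneg <;> linarith
  linarith

/-- On a fixed vertical line far to the right the digamma function varies slowly. -/
theorem norm_digamma_sub_le {z w : ℂ} {x : ℝ} (hx : 1 < x) (hz : x ≤ z.re) (hw : x ≤ w.re) :
    ‖Complex.digamma z - Complex.digamma w‖ ≤ ‖z - w‖ / (x - 1) := by
  have h := hasSum_digamma_sub (z := z) (w := w) (by linarith) (by linarith)
  rw [← h.tsum_eq]
  have hs := (summable_one_div_add_sq (show 0 < x by linarith)).mul_left ‖z - w‖
  refine (tsum_of_norm_bounded hs.hasSum fun k =>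
    norm_one_div_sub_le (by linarith) hz hw k).trans ?_
  rw [tsum_mul_left, div_eq_mul_one_div]
  gcongr
  exact tsum_one_div_add_sq_le hx

/-- A crude growth bound for the digamma function in a right half-plane. The true order is
logarithmic; the exponent only has to be small compared to the powers used in counting zeros. -/
theorem exists_norm_digamma_le : ∃ C : ℝ, 0 ≤ C ∧ ∀ z : ℂ, 1 ≤ z.re →
    ‖Complex.digamma z‖ ≤ C * ‖z‖ ^ (1 / 8 : ℝ) := by
  have hsum : Summable fun k : ℕ => 1 / ((k : ℝ) + 1) ^ (9 / 8 : ℝ) := by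
    have := (summable_nat_add_iff 1).2
      (Real.summable_one_div_nat_rpow.2 (by norm_num : (1 : ℝ) < 9 / 8))
    simpa using this
  set S := ∑' k : ℕ, 1 / ((k : ℝ) + 1) ^ (9 / 8 : ℝ) with hS
  have hS0 : 0 ≤ S := tsum_nonneg fun k => by positivity
  refine ⟨‖Complex.digamma 1‖ + 4 * S, by positivity, fun z hz => ?_⟩
  have hr : 1 ≤ ‖z‖ := hz.trans (Complex.re_le_norm z)
  set r := ‖z‖ with hr'
  have hr1 : 1 ≤ r ^ (1 / 8 : ℝ) := Real.one_le_rpow hr (by norm_num)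
  have hterm : ∀ k : ℕ, ‖1 / ((1 : ℂ) + k) - 1 / (z + k)‖ ≤
      (4 * r ^ (1 / 8 : ℝ)) * (1 / ((k : ℝ) + 1) ^ (9 / 8 : ℝ)) := by
    intro k
    have hk : (0 : ℝ) ≤ k := Nat.cast_nonneg k
    have hne := add_natCast_ne_zero (z := z) (by linarith) k
    have hne1 := add_natCast_ne_zero (z := 1) (by simp) k
    rw [div_sub_div _ _ hne1 hne, norm_div, norm_mul]
    have e1 : ‖(1 : ℂ) + k‖ = k + 1 := by
      rw [add_comm]; exact_mod_cast Complex.norm_natCast (k + 1)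
    have e2 : ‖1 * (z + k) - (1 + (k : ℂ)) * 1‖ ≤ 2 * r := by
      rw [show 1 * (z + k) - (1 + (k : ℂ)) * 1 = z - 1 by ring]
      refine (norm_sub_le _ _).trans ?_
      simp only [norm_one]; linarith
    have e3 : (r + (k + 1)) / 2 ≤ 2 * ‖z + k‖ / 2 := by
      have a1 := norm_add_natCast_ge z k
      have a2 : r ≤ ‖z + k‖ := by
        rw [hr']
        refine abs_le_of_sq_le_sq' ?_ (norm_nonneg _) |>.2
        rw [Complex.sq_norm, Complex.sq_norm, Complex.normSq_apply, Complex.normSq_apply]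
        simp only [Complex.add_re, Complex.natCast_re, Complex.add_im, Complex.natCast_im, add_zero]
        nlinarith
      linarith
    -- weighted means split the denominator so that the sum over `k` converges
    have e4 : r ^ (7 / 8 : ℝ) * ((k : ℝ) + 1) ^ (1 / 8 : ℝ) ≤ 2 * ‖z + k‖ := by
      have := Real.geom_mean_le_arith_mean2_weighted (w₁ := 7 / 8) (w₂ := 1 / 8) (p₁ := r)
        (p₂ := k + 1) (by norm_num) (by norm_num) (by linarith) (by linarith) (by norm_num)
      linarith
    have e5 : r = r ^ (7 / 8 : ℝ) * r ^ (1 / 8 : ℝ) := by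
      rw [← Real.rpow_add (by linarith)]; norm_num
    have e6 : ((k : ℝ) + 1) ^ (9 / 8 : ℝ) = (k + 1) * ((k : ℝ) + 1) ^ (1 / 8 : ℝ) := by
      rw [← Real.rpow_one_add' (by linarith) (by norm_num)]; norm_num
    rw [e1, e6, mul_one_div, div_le_div_iff₀ (mul_pos (by linarith) (norm_pos_iff.2 hne))
      (by positivity)]
    calc ‖1 * (z + k) - (1 + (k : ℂ)) * 1‖ * ((k + 1) * ((k : ℝ) + 1) ^ (1 / 8 : ℝ))
        ≤ (2 * r) * ((k + 1) * ((k : ℝ) + 1) ^ (1 / 8 : ℝ)) := by gcongr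
      _ = 2 * r ^ (1 / 8 : ℝ) * (k + 1) * (r ^ (7 / 8 : ℝ) * ((k : ℝ) + 1) ^ (1 / 8 : ℝ)) := by
        conv_lhs => rw [e5]
        ring
      _ ≤ 2 * r ^ (1 / 8 : ℝ) * (k + 1) * (2 * ‖z + k‖) := by gcongr
      _ = _ := by ring
  have h := hasSum_digamma_sub (z := z) (w := 1) (by linarith) (by simp)
  have h1 : ‖Complex.digamma z - Complex.digamma 1‖ ≤ (4 * r ^ (1 / 8 : ℝ)) * S := by
    rw [← h.tsum_eq, hS, ← tsum_mul_left]
    exact tsum_of_norm_bounded (hsum.mul_left _).hasSum hterm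
  calc ‖Complex.digamma z‖ ≤ ‖Complex.digamma 1‖ + ‖Complex.digamma z - Complex.digamma 1‖ := by
        simpa using norm_add_le (Complex.digamma 1) (Complex.digamma z - Complex.digamma 1)
    _ ≤ ‖Complex.digamma 1‖ * r ^ (1 / 8 : ℝ) + (4 * r ^ (1 / 8 : ℝ)) * S := by
        gcongr
        exact le_mul_of_one_le_right (norm_nonneg _) hr1
    _ = _ := by ring

/-! ### Logarithmic derivatives of entire functions of small growth -/

theorem finite_zeros_inter_compact {ξ : ℂ → ℂ} (hξ : Differentiable ℂ ξ) {z₀ : ℂ} (h0 : ξ z₀ ≠ 0)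
    {K : Set ℂ} (hK : IsCompact K) : {ρ | ξ ρ = 0 ∧ ρ ∈ K}.Finite := by
  have h1 := AnalyticOnNhd.preimage_zero_mem_codiscrete
    (fun z _ => hξ.analyticAt z : AnalyticOnNhd ℂ ξ Set.univ) h0
  have h2 := hK.finite_sdiff_of_mem_codiscreteWithin
    (codiscreteWithin_mono (Set.subset_univ K) h1)
  refine h2.subset fun ρ hρ => ⟨hρ.2, ?_⟩
  simpa using hρ.1

theorem analyticOrderAt_ne_top_of_entire {ξ : ℂ → ℂ} (hξ : Differentiable ℂ ξ) {z₀ : ℂ}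
    (h0 : ξ z₀ ≠ 0) (z : ℂ) : analyticOrderAt ξ z ≠ ⊤ := by
  rw [Ne, AnalyticOnNhd.analyticOrderAt_eq_top_iff_eq_zero z fun w => hξ.analyticAt w]
  rintro rfl
  exact h0 rfl

/-- A single zero `ρ ≠ 0` of an entire function can be divided out. -/
theorem exists_eq_one_sub_div_pow_mul {g : ℂ → ℂ} (hg : Differentiable ℂ g) {ρ : ℂ} (hρ : ρ ≠ 0)
    (htop : analyticOrderAt g ρ ≠ ⊤) :
    ∃ h : ℂ → ℂ, Differentiable ℂ h ∧ h ρ ≠ 0 ∧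
      ∀ z, g z = (1 - z / ρ) ^ analyticOrderNatAt g ρ * h z := by
  obtain ⟨g₁, hg₁, hne, heq⟩ := (hg.analyticAt ρ).analyticOrderAt_ne_top.1 htop
  set n := analyticOrderNatAt g ρ
  set c : ℂ → ℂ := fun z => (-ρ) ^ n * g₁ z with hc
  have hfac : ∀ z, (z - ρ) ^ n = (-ρ) ^ n * (1 - z / ρ) ^ n := by
    intro z
    rw [← mul_pow]
    congr 1
    field_simp
    ring
  have hne1 : ∀ z, z ≠ ρ → (1 - z / ρ) ^ n ≠ 0 := by
    intro z hz
    refine pow_ne_zero _ fun h => hz ?_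
    rw [sub_eq_zero, eq_div_iff hρ, one_mul] at h
    exact h.symm
  refine ⟨Function.update (fun z => g z / (1 - z / ρ) ^ n) ρ (c ρ), fun z => ?_, ?_, fun z => ?_⟩
  · by_cases hz : z = ρ
    · subst hz
      have : c =ᶠ[𝓝 z] Function.update (fun w => g w / (1 - w / z) ^ n) z (c z) := by
        filter_upwards [heq] with w hw
        by_cases hwz : w = z
        · subst hwz; simp
        · rw [Function.update_of_ne hwz, eq_div_iff (hne1 w hwz), hw, smul_eq_mul, hfac]
          simp only [hc]; ring
      exact (this.differentiableAt_iff).1 (hg₁.differentiableAt.const_mul _)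
    · have : (fun w => g w / (1 - w / ρ) ^ n) =ᶠ[𝓝 z]
          Function.update (fun w => g w / (1 - w / ρ) ^ n) ρ (c ρ) := by
        filter_upwards [isOpen_ne.mem_nhds hz] with w hw
        rw [Function.update_of_ne hw]
      refine this.differentiableAt_iff.1 (DifferentiableAt.div (hg z) (by fun_prop) (hne1 z hz))
  · simp only [Function.update_self, hc]
    exact mul_ne_zero (pow_ne_zero _ (neg_ne_zero.2 hρ)) hne
  · by_cases hz : z = ρ
    · subst hz
      simp only [Function.update_self, hc]
      rw [← mul_assoc, mul_comm _ ((-z) ^ n), ← hfac]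
      exact heq.self_of_nhds
    · rw [Function.update_of_ne hz, mul_div_cancel₀ _ (hne1 z hz)]

/-- Finitely many zeros of an entire function can be divided out, with their multiplicities. -/
theorem exists_eq_prod_mul {ξ : ℂ → ℂ} (hξ : Differentiable ℂ ξ) (h0 : ξ 0 ≠ 0) (S : Finset ℂ)
    (hS : ∀ ρ ∈ S, ρ ≠ 0) :
    ∃ g : ℂ → ℂ, Differentiable ℂ g ∧ (∀ ρ ∈ S, g ρ ≠ 0) ∧
      ∀ z, ξ z = (∏ ρ ∈ S, (1 - z / ρ) ^ analyticOrderNatAt ξ ρ) * g z := by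
  induction S using Finset.induction_on with
  | empty => exact ⟨ξ, hξ, by simp, by simp⟩
  | insert ρ S hρS ih =>
    obtain ⟨g, hg, hgS, hgeq⟩ := ih fun ρ' h => hS ρ' (Finset.mem_insert_of_mem h)
    have hρ0 := hS ρ (Finset.mem_insert_self _ _)
    set P : ℂ → ℂ := fun z => ∏ ρ' ∈ S, (1 - z / ρ') ^ analyticOrderNatAt ξ ρ' with hP
    have hPd : Differentiable ℂ P := by
      rw [hP]; fun_prop
    have hPρ : P ρ ≠ 0 := by
      refine Finset.prod_ne_zero_iff.2 fun ρ' h => pow_ne_zero _ fun h' => ?_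
      rw [sub_eq_zero, eq_div_iff (hS ρ' (Finset.mem_insert_of_mem h)), one_mul] at h'
      exact hρS (h' ▸ h)
    have hξP : ξ = P * g := by funext z; exact hgeq z
    have hord : analyticOrderAt ξ ρ = analyticOrderAt g ρ := by
      rw [hξP, analyticOrderAt_mul (hPd.analyticAt ρ) (hg.analyticAt ρ),
        (hPd.analyticAt ρ).analyticOrderAt_eq_zero.2 hPρ, zero_add]
    have htop : analyticOrderAt g ρ ≠ ⊤ := hord ▸ analyticOrderAt_ne_top_of_entire hξ h0 ρ
    obtain ⟨h, hh, hhρ, hheq⟩ := exists_eq_one_sub_div_pow_mul hg hρ0 htop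
    have hnat : analyticOrderNatAt g ρ = analyticOrderNatAt ξ ρ := by
      simp [analyticOrderNatAt, hord]
    refine ⟨h, hh, fun ρ' h' => ?_, fun z => ?_⟩
    · rcases Finset.mem_insert.1 h' with rfl | h'
      · exact hhρ
      · intro h0
        exact hgS ρ' h' (by rw [hheq, h0, mul_zero])
    · rw [Finset.prod_insert hρS, hgeq z, hheq z, hnat]
      ring

/-- A zero-free holomorphic function on a disc has a logarithm there. -/
theorem exists_log_on_ball {g : ℂ → ℂ} (hg : Differentiable ℂ g) {R : ℝ} (hR : 0 < R)
    (hne : ∀ z ∈ Metric.ball (0 : ℂ) R, g z ≠ 0) :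
    ∃ h : ℂ → ℂ, h 0 = 0 ∧ (∀ z ∈ Metric.ball (0 : ℂ) R, HasDerivAt h (logDeriv g z) z) ∧
      ∀ z ∈ Metric.ball (0 : ℂ) R, g z = g 0 * Complex.exp (h z) := by
  have hd : DifferentiableOn ℂ (logDeriv g) (Metric.ball 0 R) := by
    have : Differentiable ℂ (deriv g) := (hg.contDiff (n := 2)).differentiable_deriv_two
    exact this.differentiableOn.div hg.differentiableOn hne
  obtain ⟨h, h0, hh⟩ := hd.isExactOn_ball.with_val_at 0 0
  refine ⟨h, h0, hh, fun z hz => ?_⟩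
  have hder : ∀ w ∈ Metric.ball (0 : ℂ) R, HasDerivAt (fun w => g w * Complex.exp (-h w)) 0 w := by
    intro w hw
    refine ((hg w).hasDerivAt.mul ((hh w hw).fun_neg.cexp)).congr_deriv ?_
    rw [logDeriv_apply]
    have := hne w hw
    field_simp
    ring
  have hconst := (convex_ball (0 : ℂ) R).is_const_of_fderivWithin_eq_zero (𝕜 := ℂ)
    (f := fun w => g w * Complex.exp (-h w))
    (fun w hw => (hder w hw).differentiableAt.differentiableWithinAt)
    (fun w hw => by
      rw [fderivWithin_of_isOpen Metric.isOpen_ball hw]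
      ext; simp [(hder w hw).deriv])
    hz (Metric.mem_ball_self hR)
  simp only [h0, neg_zero, Complex.exp_zero, mul_one] at hconst
  rw [← hconst, mul_assoc, ← Complex.exp_add]
  simp

/-- On a disc free of zeros, the oscillation of the logarithmic derivative is controlled by the
growth of the function (Borel–Carathéodory). -/
theorem norm_logDeriv_sub_le {g : ℂ → ℂ} (hg : Differentiable ℂ g) {R M : ℝ} (hR : 0 < R)
    (hM : 0 < M) (hne : ∀ z ∈ Metric.ball (0 : ℂ) R, g z ≠ 0)
    (hbd : ∀ z ∈ Metric.ball (0 : ℂ) R, ‖g z‖ ≤ ‖g 0‖ * Real.exp M) {s s' : ℂ}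
    (hs : ‖s‖ ≤ R / 4) (hs' : ‖s'‖ ≤ R / 4) :
    ‖logDeriv g s - logDeriv g s'‖ ≤ 64 * M / R ^ 2 * ‖s - s'‖ := by
  obtain ⟨h, h0, hh, hexp⟩ := exists_log_on_ball hg hR hne
  have hg0 : 0 < ‖g 0‖ := norm_pos_iff.2 (hne 0 (Metric.mem_ball_self hR))
  have hdiff : DifferentiableOn ℂ h (Metric.ball 0 R) := fun z hz =>
    (hh z hz).differentiableAt.differentiableWithinAt
  have hre : Set.MapsTo h (Metric.ball 0 R) {z | z.re ≤ M} := by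
    intro z hz
    have h1 := hbd z hz
    rw [hexp z hz, norm_mul, Complex.norm_exp, mul_le_mul_iff_right₀ hg0, Real.exp_le_exp] at h1
    exact h1
  have hbound : ∀ z, ‖z‖ ≤ R / 2 → ‖h z‖ ≤ 2 * M := by
    intro z hz
    have hz' : z ∈ Metric.ball (0 : ℂ) R := by rw [mem_ball_zero_iff]; linarith
    refine (Complex.borelCaratheodory_zero hM hdiff hre hR hz' h0).trans ?_
    rw [div_le_iff₀ (by linarith)]
    nlinarith
  have hlog : ∀ z ∈ Metric.ball (0 : ℂ) R, deriv h z = logDeriv g z := fun z hz => (hh z hz).deriv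
  have hder2 : ∀ c ∈ Metric.closedBall (0 : ℂ) (R / 4),
      ‖deriv (logDeriv g) c‖ ≤ 64 * M / R ^ 2 := by
    intro c hc
    rw [mem_closedBall_zero_iff] at hc
    have hsub : ∀ z ∈ Metric.closedBall c (R / 4), ‖z‖ ≤ R / 2 := by
      intro z hz
      have : ‖z - c‖ ≤ R / 4 := by simpa [dist_eq_norm] using hz
      calc ‖z‖ = ‖c + (z - c)‖ := by ring_nf
        _ ≤ ‖c‖ + ‖z - c‖ := norm_add_le _ _
        _ ≤ R / 2 := by linarith
    have hcl : DiffContOnCl ℂ h (Metric.ball c (R / 4)) := by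
      refine DifferentiableOn.diffContOnCl (hdiff.mono ?_)
      rw [closure_ball _ (by positivity)]
      intro z hz
      have := hsub z hz
      rw [mem_ball_zero_iff]; linarith
    have h1 := Complex.norm_iteratedDeriv_le_of_forall_mem_sphere_norm_le 2 (by positivity) hcl
      fun z hz => hbound z (hsub z (Metric.sphere_subset_closedBall hz))
    have h2 : iteratedDeriv 2 h c = deriv (logDeriv g) c := by
      rw [iteratedDeriv_succ, iteratedDeriv_one]
      refine Filter.EventuallyEq.deriv_eq ?_
      filter_upwards [Metric.isOpen_ball.mem_nhds
        (show c ∈ Metric.ball (0 : ℂ) R by rw [mem_ball_zero_iff]; linarith)] with z hz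
      exact hlog z hz
    rw [h2] at h1
    refine h1.trans (le_of_eq ?_)
    simp [Nat.factorial]
    field_simp
    ring
  refine Convex.norm_image_sub_le_of_norm_deriv_le (s := Metric.closedBall (0 : ℂ) (R / 4))
    (fun z hz => ?_) hder2 (convex_closedBall _ _) (by simpa using hs') (by simpa using hs)
  have hz' : z ∈ Metric.ball (0 : ℂ) R := by
    rw [mem_closedBall_zero_iff] at hz
    rw [mem_ball_zero_iff]; linarith
  have : DifferentiableOn ℂ (deriv h) (Metric.ball 0 R) := hdiff.deriv Metric.isOpen_ball
  exact ((this.congr fun z hz => (hlog z hz).symm).differentiableAt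
    (Metric.isOpen_ball.mem_nhds hz'))

theorem logDeriv_eq_sum_add {ξ g : ℂ → ℂ} {S : Finset ℂ} {m : ℂ → ℕ} (hS : ∀ ρ ∈ S, ρ ≠ 0)
    (hg : Differentiable ℂ g) (heq : ∀ z, ξ z = (∏ ρ ∈ S, (1 - z / ρ) ^ m ρ) * g z) {s : ℂ}
    (hs : ξ s ≠ 0) (hsS : s ∉ S) :
    logDeriv ξ s = ∑ ρ ∈ S, (m ρ : ℂ) * (1 / (s - ρ)) + logDeriv g s := by
  have hfun : ξ = fun z => (∏ ρ ∈ S, (1 - z / ρ) ^ m ρ) * g z := funext heq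
  have h1 : ∀ ρ ∈ S, (1 - s / ρ) ≠ 0 := by
    intro ρ hρ h
    rw [sub_eq_zero, eq_div_iff (hS ρ hρ), one_mul] at h
    exact hsS (h ▸ hρ)
  rw [heq s] at hs
  rw [hfun, logDeriv_mul s (left_ne_zero_of_mul hs) (right_ne_zero_of_mul hs) (by fun_prop) (hg s),
    logDeriv_prod (s := S) (f := fun ρ z => (1 - z / ρ) ^ m ρ)
      (fun ρ hρ => pow_ne_zero _ (h1 ρ hρ)) (fun ρ _ => by fun_prop)]
  congr 1
  refine Finset.sum_congr rfl fun ρ hρ => ?_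
  rw [logDeriv_fun_pow (by fun_prop), logDeriv_apply]
  congr 1
  have hd : HasDerivAt (fun z : ℂ => 1 - z / ρ) (-(1 / ρ)) s :=
    ((hasDerivAt_id s).div_const ρ).const_sub 1
  rw [hd.deriv]
  have hsρ : s - ρ ≠ 0 := sub_ne_zero.2 fun h => hsS (h ▸ hρ)
  have hρ0 := hS ρ hρ
  have := h1 ρ hρ
  have h2 : 1 - s / ρ = -(s - ρ) / ρ := by field_simp; ring
  rw [h2]
  field_simp

/-- For an entire function that grows slower than every `exp (A ‖z‖ ^ 2)`, differences of the
logarithmic derivative are limits of the corresponding sums over the zeros in large discs. -/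
theorem exists_radius_norm_logDeriv_sub_sub_sum_le {ξ : ℂ → ℂ} (hξ : Differentiable ℂ ξ)
    (h0 : ξ 0 ≠ 0) (hgrowth : ∀ A > 0, ∃ C : ℝ, ∀ z, ‖ξ z‖ ≤ C * Real.exp (A * ‖z‖ ^ 2))
    {s s' : ℂ} (hs : ξ s ≠ 0) (hs' : ξ s' ≠ 0) {ε : ℝ} (hε : 0 < ε) :
    ∃ R₀ : ℝ, ∀ R ≥ R₀, ∀ S : Finset ℂ, (∀ ρ, ρ ∈ S ↔ ξ ρ = 0 ∧ ‖ρ‖ ≤ R) →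
      ‖(logDeriv ξ s - logDeriv ξ s') -
        ∑ ρ ∈ S, (analyticOrderNatAt ξ ρ : ℂ) * (1 / (s - ρ) - 1 / (s' - ρ))‖ ≤ ε := by
  set d := ‖s - s'‖ with hd
  have hd0 : 0 ≤ d := norm_nonneg _
  -- growth of Gaussian rate `A` costs at most `256 * A * d ≤ ε / 2` in the final estimate
  set A := ε / (512 * (d + 1)) with hA
  have hA0 : 0 < A := by positivity
  obtain ⟨C, hC⟩ := hgrowth A hA0
  have hn0 : 0 < ‖ξ 0‖ := norm_pos_iff.2 h0
  have hC0 : ‖ξ 0‖ ≤ C := by simpa using hC 0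
  have hCpos : 0 < C := hn0.trans_le hC0
  set K := Real.log (C / ‖ξ 0‖) + 1 with hK
  have hK0 : 0 < K := by
    have : 0 ≤ Real.log (C / ‖ξ 0‖) := Real.log_nonneg ((one_le_div hn0).2 hC0)
    linarith
  refine ⟨max (max (4 * ‖s‖) (4 * ‖s'‖)) (max 1 (128 * K * d / ε)), fun R hR S hS => ?_⟩
  have hR1 : 1 ≤ R := le_trans (le_trans (le_max_left _ _) (le_max_right _ _)) hR
  have hRs : ‖s‖ ≤ R / 4 := by
    have := le_trans (le_trans (le_max_left _ _) (le_max_left _ _)) hR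
    linarith
  have hRs' : ‖s'‖ ≤ R / 4 := by
    have := le_trans (le_trans (le_max_right _ _) (le_max_left _ _)) hR
    linarith
  have hRK : 128 * K * d / ε ≤ R := le_trans (le_trans (le_max_right _ _) (le_max_right _ _)) hR
  have hR0 : 0 < R := by linarith
  have hSne : ∀ ρ ∈ S, ρ ≠ 0 := by
    rintro ρ hρ rfl
    exact h0 ((hS 0).1 hρ).1
  obtain ⟨g, hg, hgS, heq⟩ := exists_eq_prod_mul hξ h0 S hSne
  have hg0 : g 0 = ξ 0 := by rw [heq 0]; simp
  have hgne : ∀ z ∈ Metric.ball (0 : ℂ) R, g z ≠ 0 := by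
    intro z hz h
    by_cases hzS : z ∈ S
    · exact hgS z hzS h
    · refine hzS ((hS z).2 ⟨by rw [heq z, h, mul_zero], ?_⟩)
      exact (mem_ball_zero_iff.1 hz).le
  set M := K + 4 * A * R ^ 2 with hM
  have hM0 : 0 < M := by positivity
  -- on the circle of radius `2 R` every factor `1 - z / ρ` has modulus at least `1`
  have hsphere : ∀ z ∈ frontier (Metric.ball (0 : ℂ) (2 * R)), ‖g z‖ ≤ ‖g 0‖ * Real.exp M := by
    intro z hz
    rw [frontier_ball _ (by positivity)] at hz
    have hz' : ‖z‖ = 2 * R := by simpa using hz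
    have hprod : 1 ≤ ‖∏ ρ ∈ S, (1 - z / ρ) ^ analyticOrderNatAt ξ ρ‖ := by
      rw [norm_prod]
      refine Finset.prod_induction _ (fun t => 1 ≤ t)
        (fun a b ha hb => one_le_mul_of_one_le_of_one_le ha hb) le_rfl fun ρ hρ => ?_
      rw [norm_pow]
      refine one_le_pow₀ ?_
      have hρR := ((hS ρ).1 hρ).2
      have hρ0 : 0 < ‖ρ‖ := norm_pos_iff.2 (hSne ρ hρ)
      have h2 : 2 ≤ ‖z / ρ‖ := by
        rw [norm_div, hz', le_div_iff₀ hρ0]; linarith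
      have h3 := norm_sub_norm_le (z / ρ) 1
      rw [norm_one, norm_sub_rev] at h3
      linarith
    have h1 : ‖g z‖ ≤ ‖ξ z‖ := by
      rw [heq z, norm_mul]
      exact le_mul_of_one_le_left (norm_nonneg _) hprod
    refine h1.trans ((hC z).trans ?_)
    rw [hg0, hz']
    have h4 : C ≤ ‖ξ 0‖ * Real.exp K := by
      rw [hK, Real.exp_add, Real.exp_log (by positivity), ← mul_assoc, mul_div_cancel₀ _ hn0.ne']
      exact le_mul_of_one_le_right hCpos.le (Real.one_le_exp zero_le_one)
    calc C * Real.exp (A * (2 * R) ^ 2) ≤ ‖ξ 0‖ * Real.exp K * Real.exp (A * (2 * R) ^ 2) := by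
          gcongr
      _ = ‖ξ 0‖ * Real.exp M := by
          rw [mul_assoc, ← Real.exp_add, hM]
          ring_nf
  have hbd : ∀ z ∈ Metric.ball (0 : ℂ) R, ‖g z‖ ≤ ‖g 0‖ * Real.exp M := by
    intro z hz
    refine Complex.norm_le_of_forall_mem_frontier_norm_le (U := Metric.ball (0 : ℂ) (2 * R))
      Metric.isBounded_ball hg.diffContOnCl hsphere (subset_closure ?_)
    rw [mem_ball_zero_iff] at hz ⊢
    linarith
  have key := norm_logDeriv_sub_le hg hR0 hM0 hgne hbd hRs hRs'
  have hns : ∀ {w : ℂ}, ξ w ≠ 0 → w ∉ S := fun hw h => hw ((hS _).1 h).1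
  have e : (logDeriv ξ s - logDeriv ξ s') -
        ∑ ρ ∈ S, (analyticOrderNatAt ξ ρ : ℂ) * (1 / (s - ρ) - 1 / (s' - ρ)) =
      logDeriv g s - logDeriv g s' := by
    rw [logDeriv_eq_sum_add hSne hg heq hs (hns hs), logDeriv_eq_sum_add hSne hg heq hs' (hns hs')]
    simp only [mul_sub, Finset.sum_sub_distrib]
    ring
  rw [e]
  refine key.trans ?_
  have h5 : 64 * M / R ^ 2 * d = 64 * K * d / R ^ 2 + 256 * A * d := by
    rw [hM]; field_simp; ring
  have h6 : 256 * A * d ≤ ε / 2 := by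
    rw [hA]
    have : 256 * (ε / (512 * (d + 1))) * d = ε / 2 * (d / (d + 1)) := by field_simp; ring
    rw [this]
    refine mul_le_of_le_one_right (by positivity) ?_
    rw [div_le_one (by positivity)]; linarith
  have h7 : 64 * K * d / R ^ 2 ≤ ε / 2 := by
    rw [div_le_iff₀ (by positivity)]
    rw [div_le_iff₀ hε] at hRK
    have : R ≤ R ^ 2 := by nlinarith
    nlinarith
  rw [h5]
  linarith

/-! ### Functions with a functional equation and zeros in a strip -/

/-- An entire function `ξ` that grows slower than every `exp (A ‖z‖ ^ 2)`, does not vanish at `0`,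
satisfies the functional equation relating `z` and `σ - conj z`, and has all its zeros in the strip
`|Re z| ≤ B`.

Sums over the zeros of `ξ` are written as sums over all `ρ : ℂ` with the weight
`analyticOrderNatAt ξ ρ`, which is the multiplicity of a zero and vanishes at every other point. -/
structure IsStripFunction (σ B : ℝ) (ω : ℂ) (ξ : ℂ → ℂ) : Prop where
  differentiable : Differentiable ℂ ξ
  map_zero_ne : ξ 0 ≠ 0
  growth : ∀ A > 0, ∃ C : ℝ, ∀ z, ‖ξ z‖ ≤ C * Real.exp (A * ‖z‖ ^ 2)
  omega_ne : ω ≠ 0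
  functional_equation : ∀ z, ξ z = ω * (starRingEnd ℂ) (ξ (σ - (starRingEnd ℂ) z))
  strip : ∀ ρ, ξ ρ = 0 → |ρ.re| ≤ B
  sigma_pos : 0 < σ
  sigma_le : σ ≤ B

namespace IsStripFunction

variable {σ B : ℝ} {ω : ℂ} {ξ : ℂ → ℂ}

theorem map_reflect_eq_zero_iff (h : IsStripFunction σ B ω ξ) (z : ℂ) :
    ξ (σ - (starRingEnd ℂ) z) = 0 ↔ ξ z = 0 := by
  rw [h.functional_equation z]
  simp [h.omega_ne]

/-- The reflection `z ↦ σ - conj z` reverses the real part of the logarithmic derivative. -/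
theorem logDeriv_reflect (h : IsStripFunction σ B ω ξ) (z : ℂ) :
    logDeriv ξ (σ - (starRingEnd ℂ) z) = -(starRingEnd ℂ) (logDeriv ξ z) := by
  set w : ℂ := σ - (starRingEnd ℂ) z with hw
  have hcw : (starRingEnd ℂ) w = σ - z := by simp [hw]
  have hz : z = σ - (starRingEnd ℂ) w := by rw [hcw]; ring
  have h1 : ξ = fun u => ω * (⇑(starRingEnd ℂ) ∘ ξ ∘ ⇑(starRingEnd ℂ)) (σ - u) := by
    funext u
    rw [h.functional_equation u]
    simp
  have h2 : HasDerivAt (⇑(starRingEnd ℂ) ∘ ξ ∘ ⇑(starRingEnd ℂ)) ((starRingEnd ℂ) (deriv ξ z))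
      (σ - w) := by
    have := (h.differentiable z).hasDerivAt.conj_conj
    rwa [show (starRingEnd ℂ) z = σ - w by rw [hw]; ring] at this
  have h3 : HasDerivAt ξ (ω * ((starRingEnd ℂ) (deriv ξ z) * (-1))) w := by
    generalize deriv ξ z = d at h2 ⊢
    rw [h1]
    refine HasDerivAt.const_mul ω ?_
    exact HasDerivAt.comp w (h₂ := ⇑(starRingEnd ℂ) ∘ ξ ∘ ⇑(starRingEnd ℂ)) h2
      ((hasDerivAt_id w).const_sub (σ : ℂ))
  rw [logDeriv_apply, logDeriv_apply, h3.deriv, h.functional_equation w, ← hz, map_div₀,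
    mul_div_mul_left _ _ h.omega_ne]
  ring

theorem analyticOrderNatAt_reflect (h : IsStripFunction σ B ω ξ) (z : ℂ) :
    analyticOrderNatAt ξ (σ - (starRingEnd ℂ) z) = analyticOrderNatAt ξ z := by
  set w : ℂ := σ - (starRingEnd ℂ) z with hw
  have htop := analyticOrderAt_ne_top_of_entire h.differentiable h.map_zero_ne
  obtain ⟨g, hg, hgz, heq⟩ := (h.differentiable.analyticAt z).analyticOrderAt_ne_top.1 (htop z)
  set n := analyticOrderNatAt ξ z
  refine ((h.differentiable.analyticAt w).analyticOrderNatAt_eq_iff (htop w)).2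
    ⟨fun u => (-1) ^ n * ω * (⇑(starRingEnd ℂ) ∘ g ∘ ⇑(starRingEnd ℂ)) (σ - u), ?_, ?_, ?_⟩
  · have hc : Tendsto (fun u : ℂ => (starRingEnd ℂ) (σ - u)) (𝓝 w) (𝓝 z) := by
      have : Continuous fun u : ℂ => (starRingEnd ℂ) (σ - u) :=
        Complex.continuous_conj.comp (continuous_const.sub continuous_id)
      have h1 := this.tendsto w
      simpa [hw] using h1
    rw [Complex.analyticAt_iff_eventually_differentiableAt] at hg ⊢
    filter_upwards [hc.eventually hg] with u hu
    have h1 := hu.conj_conj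
    rw [Complex.conj_conj] at h1
    refine DifferentiableAt.const_mul ?_ _
    exact DifferentiableAt.comp u (g := ⇑(starRingEnd ℂ) ∘ g ∘ ⇑(starRingEnd ℂ)) h1
      ((differentiableAt_const _).sub differentiableAt_id)
  · have : (starRingEnd ℂ) (σ - w) = z := by simp [hw]
    simp [this, hgz, h.omega_ne]
  · have hc : Tendsto (fun u : ℂ => (σ : ℂ) - (starRingEnd ℂ) u) (𝓝 w) (𝓝 z) := by
      have : Continuous fun u : ℂ => (σ : ℂ) - (starRingEnd ℂ) u :=
        continuous_const.sub Complex.continuous_conj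
      have h1 := this.tendsto w
      simpa [hw] using h1
    filter_upwards [hc.eventually heq] with u hu
    rw [h.functional_equation u, hu]
    have e1 : (starRingEnd ℂ) ((σ : ℂ) - (starRingEnd ℂ) u - z) = -1 * (u - w) := by
      simp [hw]; ring
    simp only [smul_eq_mul, map_mul, map_pow, e1, mul_pow, Function.comp_apply]
    simp
    ring

theorem ne_zero_of_lt_re (h : IsStripFunction σ B ω ξ) {s : ℂ} (hs : B < s.re) : ξ s ≠ 0 :=
  fun h0 => absurd (h.strip s h0) (not_le.2 (lt_of_lt_of_le hs (le_abs_self _)))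

theorem B_pos (h : IsStripFunction σ B ω ξ) : 0 < B := h.sigma_pos.trans_le h.sigma_le

theorem order_eq_zero {ρ : ℂ} (hρ : ξ ρ ≠ 0) : analyticOrderNatAt ξ ρ = 0 := by
  by_contra h
  exact hρ (apply_eq_zero_of_analyticOrderNatAt_ne_zero h)

theorem re_one_div (p v : ℝ) : (1 / ((p : ℂ) + v * Complex.I)).re = p / (p ^ 2 + v ^ 2) := by
  simp [Complex.normSq_apply, sq]

/-- The pair `s`, `σ - conj s` sees each zero with a positive real part. -/
theorem re_kernel_ge (h : IsStripFunction σ B ω ξ) {s ρ : ℂ} (hs : 4 * B ≤ s.re)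
    (hρ : ξ ρ = 0) :
    s.re / (s.re ^ 2 + (s.im - ρ.im) ^ 2) / 3 ≤
      (1 / (s - ρ) - 1 / ((σ - (starRingEnd ℂ) s) - ρ)).re := by
  have hB := h.B_pos
  have hβ := abs_le.1 (h.strip ρ hρ)
  have hσ := h.sigma_pos
  have hσ' := h.sigma_le
  set x := s.re with hx
  set v := s.im - ρ.im with hv
  have e1 : s - ρ = ((x - ρ.re : ℝ) : ℂ) + v * Complex.I := by
    apply Complex.ext <;> simp [hx, hv]
  have e2 : (σ - (starRingEnd ℂ) s) - ρ = ((σ - x - ρ.re : ℝ) : ℂ) + v * Complex.I := by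
    apply Complex.ext <;> simp [hx, hv]
  rw [Complex.sub_re, e1, e2, re_one_div, re_one_div]
  have hx0 : 0 < x := by linarith
  have h2 : (σ - x - ρ.re) / ((σ - x - ρ.re) ^ 2 + v ^ 2) ≤ 0 :=
    div_nonpos_of_nonpos_of_nonneg (by linarith) (by positivity)
  have hp : 3 * x / 4 ≤ x - ρ.re := by linarith
  have hp' : x - ρ.re ≤ 5 * x / 4 := by linarith
  have hp0 : 0 < x - ρ.re := by linarith
  have h1 : x / (x ^ 2 + v ^ 2) / 3 ≤ (x - ρ.re) / ((x - ρ.re) ^ 2 + v ^ 2) := by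
    rw [div_div, div_le_div_iff₀ (by positivity) (by positivity)]
    have a1 : (x - ρ.re) ^ 2 ≤ 25 / 16 * x ^ 2 := by nlinarith
    calc x * ((x - ρ.re) ^ 2 + v ^ 2) ≤ x * (25 / 16 * x ^ 2 + 25 / 16 * v ^ 2) := by
          gcongr
          nlinarith [sq_nonneg v]
      _ ≤ (3 * x / 4) * ((x ^ 2 + v ^ 2) * 3) := by
          nlinarith [mul_pos hx0 (show 0 < x ^ 2 by positivity), mul_nonneg hx0.le (sq_nonneg v)]
      _ ≤ (x - ρ.re) * ((x ^ 2 + v ^ 2) * 3) := by gcongr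
  linarith

/-- The finite set of zeros in a closed disc around the origin. -/
noncomputable def zerosInDisc (h : IsStripFunction σ B ω ξ) (R : ℝ) : Finset ℂ :=
  (finite_zeros_inter_compact h.differentiable h.map_zero_ne
    (isCompact_closedBall (0 : ℂ) R)).toFinset

theorem mem_zerosInDisc (h : IsStripFunction σ B ω ξ) (R : ℝ) (ρ : ℂ) :
    ρ ∈ h.zerosInDisc R ↔ ξ ρ = 0 ∧ ‖ρ‖ ≤ R := by
  simp [zerosInDisc]

theorem tendsto_sum_zerosInDisc (h : IsStripFunction σ B ω ξ) {s s' : ℂ} (hs : ξ s ≠ 0)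
    (hs' : ξ s' ≠ 0) :
    Tendsto (fun R => ∑ ρ ∈ h.zerosInDisc R,
      (analyticOrderNatAt ξ ρ : ℂ) * (1 / (s - ρ) - 1 / (s' - ρ))) atTop
      (𝓝 (logDeriv ξ s - logDeriv ξ s')) := by
  rw [Metric.tendsto_atTop]
  intro ε hε
  obtain ⟨R₀, hR₀⟩ := exists_radius_norm_logDeriv_sub_sub_sum_le h.differentiable h.map_zero_ne
    h.growth hs hs' (half_pos hε)
  refine ⟨R₀, fun R hR => ?_⟩
  rw [dist_comm, dist_eq_norm]
  exact (hR₀ R hR _ (h.mem_zerosInDisc R)).trans_lt (half_lt_self hε)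

/-- Points that are not zeros carry no weight, so a finite sum of nonnegative terms is dominated by
the sum over the zeros in a large disc. -/
theorem eventually_sum_le_sum_zerosInDisc (h : IsStripFunction σ B ω ξ) {a : ℂ → ℝ}
    (ha : ∀ ρ, ξ ρ = 0 → 0 ≤ a ρ) (U : Finset ℂ) :
    ∀ᶠ R in atTop, ∑ ρ ∈ U, (analyticOrderNatAt ξ ρ : ℝ) * a ρ ≤
      ∑ ρ ∈ h.zerosInDisc R, (analyticOrderNatAt ξ ρ : ℝ) * a ρ := by
  classical
  obtain ⟨R₀, hR₀⟩ : ∃ R₀ : ℝ, ∀ ρ ∈ U, ‖ρ‖ ≤ R₀ :=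
    ⟨∑ ρ ∈ U, ‖ρ‖, fun ρ hρ => Finset.single_le_sum (f := fun ρ => ‖ρ‖)
      (fun _ _ => norm_nonneg _) hρ⟩
  filter_upwards [eventually_ge_atTop R₀] with R hR
  have h1 : ∑ ρ ∈ U, (analyticOrderNatAt ξ ρ : ℝ) * a ρ =
      ∑ ρ ∈ U with ξ ρ = 0, (analyticOrderNatAt ξ ρ : ℝ) * a ρ := by
    rw [Finset.sum_filter]
    refine Finset.sum_congr rfl fun ρ _ => ?_
    split_ifs with h0
    · rfl
    · simp [order_eq_zero h0]
  rw [h1]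
  refine Finset.sum_le_sum_of_subset_of_nonneg (fun ρ hρ => ?_) fun ρ hρ _ => ?_
  · rw [Finset.mem_filter] at hρ
    exact (h.mem_zerosInDisc R ρ).2 ⟨hρ.2, (hR₀ ρ hρ.1).trans hR⟩
  · exact mul_nonneg (Nat.cast_nonneg _) (ha ρ ((h.mem_zerosInDisc R ρ).1 hρ).1)

/-- Every finite part of the Poisson sum is bounded, because the terms of the expansion of
`ξ'/ξ(s) - ξ'/ξ(σ - conj s)` have positive real parts. No convergence is presupposed. -/
theorem sum_poisson_le (h : IsStripFunction σ B ω ξ) {s : ℂ} (hs : 4 * B ≤ s.re) (U : Finset ℂ) :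
    ∑ ρ ∈ U, (analyticOrderNatAt ξ ρ : ℝ) * (s.re / (s.re ^ 2 + (s.im - ρ.im) ^ 2)) ≤
      6 * ‖logDeriv ξ s‖ := by
  have hB := h.B_pos
  have hx0 : 0 < s.re := by linarith
  have hs0 : ξ s ≠ 0 := h.ne_zero_of_lt_re (by linarith)
  have hs0' : ξ (σ - (starRingEnd ℂ) s) ≠ 0 := fun h0 => hs0 ((h.map_reflect_eq_zero_iff s).1 h0)
  have ht := (Complex.continuous_re.tendsto _).comp (h.tendsto_sum_zerosInDisc hs0 hs0')
  have hlim : (logDeriv ξ s - logDeriv ξ (σ - (starRingEnd ℂ) s)).re ≤ 2 * ‖logDeriv ξ s‖ := by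
    rw [h.logDeriv_reflect, sub_neg_eq_add, Complex.add_re, Complex.conj_re]
    linarith [Complex.re_le_norm (logDeriv ξ s)]
  have hle := h.eventually_sum_le_sum_zerosInDisc
    (a := fun ρ => s.re / (s.re ^ 2 + (s.im - ρ.im) ^ 2)) (fun ρ _ => by positivity) U
  have : ∑ ρ ∈ U, (analyticOrderNatAt ξ ρ : ℝ) * (s.re / (s.re ^ 2 + (s.im - ρ.im) ^ 2)) / 3 ≤
      (logDeriv ξ s - logDeriv ξ (σ - (starRingEnd ℂ) s)).re := by
    refine ge_of_tendsto ht ?_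
    filter_upwards [hle] with R hR
    rw [← Finset.sum_div]
    have h3 : (∑ ρ ∈ h.zerosInDisc R,
        (analyticOrderNatAt ξ ρ : ℝ) * (s.re / (s.re ^ 2 + (s.im - ρ.im) ^ 2))) / 3 ≤
        (∑ ρ ∈ h.zerosInDisc R, (analyticOrderNatAt ξ ρ : ℂ) *
          (1 / (s - ρ) - 1 / ((σ - (starRingEnd ℂ) s) - ρ))).re := by
      rw [Finset.sum_div, Complex.re_sum]
      refine Finset.sum_le_sum fun ρ hρ => ?_
      have h4 := h.re_kernel_ge hs ((h.mem_zerosInDisc R ρ).1 hρ).1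
      rw [← Complex.ofReal_natCast, Complex.re_ofReal_mul, mul_div_assoc]
      gcongr
    refine le_trans ?_ h3
    gcongr
  rw [← Finset.sum_div] at this
  linarith

theorem summable_poisson (h : IsStripFunction σ B ω ξ) {s : ℂ} (hs : 4 * B ≤ s.re) :
    Summable fun ρ : ℂ =>
      (analyticOrderNatAt ξ ρ : ℝ) * (s.re / (s.re ^ 2 + (s.im - ρ.im) ^ 2)) := by
  have hB := h.B_pos
  have hx0 : 0 < s.re := by linarith
  exact summable_of_sum_le (fun ρ => by positivity) (h.sum_poisson_le hs)

/-- The density of the zeros near height `s.im`, at scale `s.re`, is controlled by the logarithmic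
derivative at `s`. -/
theorem tsum_poisson_le (h : IsStripFunction σ B ω ξ) {s : ℂ} (hs : 4 * B ≤ s.re) :
    ∑' ρ : ℂ, (analyticOrderNatAt ξ ρ : ℝ) * (s.re / (s.re ^ 2 + (s.im - ρ.im) ^ 2)) ≤
      6 * ‖logDeriv ξ s‖ :=
  (h.summable_poisson hs).tsum_le_of_sum_le (h.sum_poisson_le hs)

/-- The series that dominates all the absolutely convergent sums over the zeros. -/
theorem summable_order_div (h : IsStripFunction σ B ω ξ) :
    Summable fun ρ : ℂ => (analyticOrderNatAt ξ ρ : ℝ) * (1 / (1 + ρ.im ^ 2)) := by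
  have hB := h.B_pos
  set x := 4 * B + 1 with hx
  have hs := h.summable_poisson (s := (x : ℂ)) (by simp [hx])
  refine Summable.of_nonneg_of_le (fun ρ => by positivity) (fun ρ => ?_) (hs.mul_left x)
  simp only [Complex.ofReal_re, Complex.ofReal_im, zero_sub, neg_sq]
  rw [← mul_assoc, mul_comm x, mul_assoc]
  gcongr
  rw [mul_div_assoc', div_le_div_iff₀ (by positivity) (by positivity)]
  have hx1 : 1 ≤ x := by linarith
  nlinarith [sq_nonneg ρ.im, mul_self_le_mul_self (by norm_num) hx1]

/-- Away from the zeros, the distance to a zero `ρ` is at least of the order of `|Im ρ|`. -/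
theorem exists_one_add_im_sq_le (h : IsStripFunction σ B ω ξ) {s : ℂ} (hs : ξ s ≠ 0) :
    ∃ c : ℝ, 0 < c ∧ ∀ ρ, ξ ρ = 0 → 1 + ρ.im ^ 2 ≤ c * ‖s - ρ‖ ^ 2 := by
  obtain ⟨δ, hδ, hball⟩ := Metric.eventually_nhds_iff.1
    (h.differentiable.continuous.continuousAt.eventually_ne hs)
  refine ⟨(1 + 2 * s.im ^ 2) / δ ^ 2 + 2, by positivity, fun ρ hρ => ?_⟩
  have h1 : δ ≤ ‖s - ρ‖ := by
    by_contra hlt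
    exact hball (by rw [dist_comm, dist_eq_norm]; exact not_le.1 hlt) hρ
  have h2 : |s.im - ρ.im| ≤ ‖s - ρ‖ := by simpa using Complex.abs_im_le_norm (s - ρ)
  have h3 : (s.im - ρ.im) ^ 2 ≤ ‖s - ρ‖ ^ 2 := sq_le_sq' (by linarith [neg_abs_le (s.im - ρ.im)])
    ((le_abs_self _).trans h2)
  have h4 : 1 + 2 * s.im ^ 2 ≤ (1 + 2 * s.im ^ 2) / δ ^ 2 * ‖s - ρ‖ ^ 2 := by
    rw [div_mul_eq_mul_div, le_div_iff₀ (by positivity)]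
    gcongr
  nlinarith [sq_nonneg (2 * s.im - ρ.im)]

theorem ne_of_zero {s ρ : ℂ} (hs : ξ s ≠ 0) (hρ : ξ ρ = 0) : s - ρ ≠ 0 :=
  sub_ne_zero.2 fun h => hs (h ▸ hρ)

theorem summable_kernel (h : IsStripFunction σ B ω ξ) {s s' : ℂ} (hs : ξ s ≠ 0) (hs' : ξ s' ≠ 0) :
    Summable fun ρ : ℂ => (analyticOrderNatAt ξ ρ : ℂ) * (1 / (s - ρ) - 1 / (s' - ρ)) := by
  obtain ⟨c, hc, hcρ⟩ := h.exists_one_add_im_sq_le hs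
  obtain ⟨c', hc', hcρ'⟩ := h.exists_one_add_im_sq_le hs'
  refine Summable.of_norm_bounded (h.summable_order_div.mul_left (‖s' - s‖ * (c + c'))) fun ρ => ?_
  by_cases hρ : ξ ρ = 0
  · have h1 := ne_of_zero hs hρ
    have h2 := ne_of_zero hs' hρ
    have n1 := norm_pos_iff.2 h1
    have n2 := norm_pos_iff.2 h2
    rw [norm_mul, Complex.norm_natCast, div_sub_div _ _ h1 h2, norm_div, norm_mul]
    rw [show 1 * (s' - ρ) - (s - ρ) * 1 = s' - s by ring, mul_left_comm]
    gcongr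
    rw [mul_assoc, div_eq_mul_one_div]
    gcongr
    rw [mul_one_div, div_le_div_iff₀ (by positivity) (by positivity)]
    have a1 := hcρ ρ hρ
    have a2 := hcρ' ρ hρ
    have a3 : 0 ≤ 1 + ρ.im ^ 2 := by positivity
    -- `(1 + γ²)² ≤ c c' ‖s - ρ‖² ‖s' - ρ‖²`, and `√(c c') ≤ c + c'`
    have a4 : (1 + ρ.im ^ 2) ^ 2 ≤ ((c + c') * (‖s - ρ‖ * ‖s' - ρ‖)) ^ 2 := by
      calc (1 + ρ.im ^ 2) ^ 2 ≤ (c * ‖s - ρ‖ ^ 2) * (c' * ‖s' - ρ‖ ^ 2) := by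
            rw [sq]; gcongr
        _ = (c * c') * (‖s - ρ‖ * ‖s' - ρ‖) ^ 2 := by ring
        _ ≤ (c + c') ^ 2 * (‖s - ρ‖ * ‖s' - ρ‖) ^ 2 := by
            gcongr
            nlinarith
        _ = _ := by ring
    rw [one_mul]
    exact (sq_le_sq₀ a3 (by positivity)).1 a4
  · simp [order_eq_zero hρ]

/-- Differences of the logarithmic derivative as absolutely convergent sums over the zeros. -/
theorem hasSum_kernel (h : IsStripFunction σ B ω ξ) {s s' : ℂ} (hs : ξ s ≠ 0) (hs' : ξ s' ≠ 0) :
    HasSum (fun ρ : ℂ => (analyticOrderNatAt ξ ρ : ℂ) * (1 / (s - ρ) - 1 / (s' - ρ)))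
      (logDeriv ξ s - logDeriv ξ s') := by
  classical
  have hsum := (h.summable_kernel hs hs').hasSum
  set L := ∑' ρ : ℂ, (analyticOrderNatAt ξ ρ : ℂ) * (1 / (s - ρ) - 1 / (s' - ρ))
  suffices L = logDeriv ξ s - logDeriv ξ s' by rwa [this] at hsum
  refine tendsto_nhds_unique ?_ (h.tendsto_sum_zerosInDisc hs hs')
  -- the sums over discs are a subnet of the unordered sum
  rw [Metric.tendsto_atTop]
  intro ε hε
  obtain ⟨U, hU⟩ := (Metric.tendsto_atTop.1 hsum) ε hε
  obtain ⟨R₀, hR₀⟩ : ∃ R₀ : ℝ, ∀ ρ ∈ U, ‖ρ‖ ≤ R₀ :=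
    ⟨∑ ρ ∈ U, ‖ρ‖, fun ρ hρ => Finset.single_le_sum (f := fun ρ => ‖ρ‖)
      (fun _ _ => norm_nonneg _) hρ⟩
  refine ⟨R₀, fun R hR => ?_⟩
  have h1 := hU (U ∪ h.zerosInDisc R) Finset.subset_union_left
  rwa [← Finset.sum_subset (s₁ := h.zerosInDisc R) Finset.subset_union_right] at h1
  intro ρ hρ hρ'
  suffices hz : ξ ρ ≠ 0 by simp [order_eq_zero hz]
  refine fun h0 => hρ' ((h.mem_zerosInDisc R ρ).2 ⟨h0, ?_⟩)
  rcases Finset.mem_union.1 hρ with h2 | h2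
  · exact (hR₀ ρ h2).trans hR
  · exact absurd h2 hρ'

end IsStripFunction

/-! ### Counting zeros above and below the real axis -/

theorem arctan_sub_le {a b K : ℝ} (hab : a ≤ b) (hK : ∀ x, a ≤ x → 1 / (1 + x ^ 2) ≤ K) :
    Real.arctan b - Real.arctan a ≤ K * (b - a) := by
  refine (convex_Ici a).image_sub_le_mul_sub_of_deriv_le Real.continuous_arctan.continuousOn
    Real.differentiable_arctan.differentiableOn (fun x hx => ?_) a Set.self_mem_Ici b hab hab
  rw [interior_Ici] at hx
  rw [Real.deriv_arctan]
  exact hK x (le_of_lt hx)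

theorem arctan_le_of_nonneg {x : ℝ} (hx : 0 ≤ x) : Real.arctan x ≤ x := by
  simpa using arctan_sub_le hx (K := 1) fun y _ => by
    rw [div_le_one (by positivity)]; nlinarith [sq_nonneg y]

theorem pi_div_two_sub_arctan_nonneg (x : ℝ) : 0 ≤ Real.pi / 2 - Real.arctan x := by
  linarith [Real.arctan_lt_pi_div_two x]

/-- A step smoothed at scale `X` differs from the sharp step by `X / Y` at distance more than `Y`
from the jump, and by a bounded amount nearer to it. -/
theorem pi_div_two_sub_arctan_le {X Y u : ℝ} (hX : 0 < X) (hY : 0 < Y) (hu : 0 ≤ u) :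
    Real.pi / 2 - Real.arctan (u / X) ≤ 4 * (Y ^ 2 / (Y ^ 2 + u ^ 2)) + X / Y := by
  rcases le_total u Y with h | h
  · have h1 : 0 ≤ Real.arctan (u / X) := Real.arctan_nonneg.2 (by positivity)
    have h2 : 2 ≤ 4 * (Y ^ 2 / (Y ^ 2 + u ^ 2)) := by
      rw [mul_div_assoc', le_div_iff₀ (by positivity)]
      nlinarith
    have h3 : 0 ≤ X / Y := by positivity
    linarith [Real.pi_le_four]
  · have hu0 : 0 < u := hY.trans_le h
    have h1 : Real.pi / 2 - Real.arctan (u / X) = Real.arctan (X / u) := by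
      rw [← Real.arctan_inv_of_pos (by positivity), inv_div]
    have h2 : X / u ≤ X / Y := by gcongr
    have h3 : 0 ≤ 4 * (Y ^ 2 / (Y ^ 2 + u ^ 2)) := by positivity
    linarith [arctan_le_of_nonneg (show 0 ≤ X / u by positivity)]

/-- The mass that the Poisson kernel centred at height `γ` gives to `[0, T]`, minus the mass it
gives to `[-T, 0]` (up to the factor `π`). -/
noncomputable def arctanKernel (X γ T : ℝ) : ℝ :=
  Real.arctan ((T - γ) / X) - Real.arctan ((T + γ) / X) + 2 * Real.arctan (γ / X)

theorem arctanKernel_neg (X γ T : ℝ) : arctanKernel X (-γ) T = -arctanKernel X γ T := by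
  simp only [arctanKernel, neg_div, Real.arctan_neg, sub_neg_eq_add, ← sub_eq_add_neg]
  ring

/-- An upper bound for the difference between `arctanKernel` and the sharp cut-off: it is of order
`1` within distance `Y` of the jumps at `T`, `-T` and `0`, and of order `X / Y` for the other
`|γ| ≤ T`, with quadratic decay beyond. -/
noncomputable def cutoffError (X Y γ T : ℝ) : ℝ :=
  64 * (Y ^ 2 / (Y ^ 2 + (T - γ) ^ 2) + Y ^ 2 / (Y ^ 2 + (T + γ) ^ 2) + Y ^ 2 / (Y ^ 2 + γ ^ 2) +
    X / Y * (T ^ 2 / (T ^ 2 + γ ^ 2)))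

theorem abs_arctanKernel_sub_le_of_pos {X X' Y T γ : ℝ} (hX' : 0 < X') (hXX : X' ≤ 2 * X)
    (hY : 0 < Y) (hYT : Y ≤ T) (hγ : 0 < γ) :
    |arctanKernel X' γ T - Real.pi * (if γ ≤ T then 1 else 0)| ≤ cutoffError X Y γ T := by
  have hT : 0 < T := hY.trans_le hYT
  have hX : 0 < X := by linarith
  have hXY : X' / Y ≤ 2 * (X / Y) := by rw [mul_div_assoc']; gcongr
  have eγ := pi_div_two_sub_arctan_le hX' hY hγ.le
  have nγ := pi_div_two_sub_arctan_nonneg (γ / X')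
  have nT := pi_div_two_sub_arctan_nonneg ((T + γ) / X')
  have p1 : 0 ≤ Y ^ 2 / (Y ^ 2 + (T - γ) ^ 2) := by positivity
  have p2 : 0 ≤ Y ^ 2 / (Y ^ 2 + (T + γ) ^ 2) := by positivity
  have p3 : 0 ≤ Y ^ 2 / (Y ^ 2 + γ ^ 2) := by positivity
  have p4 : 0 ≤ X / Y := by positivity
  unfold arctanKernel cutoffError
  by_cases h1 : γ ≤ T
  -- below the cut-off and away from the jumps all three arctangents are close to `π / 2`
  · rw [if_pos h1]
    have eT := pi_div_two_sub_arctan_le hX' hY (show 0 ≤ T - γ by linarith)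
    have nT' := pi_div_two_sub_arctan_nonneg ((T - γ) / X')
    have mono : Real.arctan ((T - γ) / X') ≤ Real.arctan ((T + γ) / X') :=
      Real.arctan_mono (by gcongr; linarith)
    have q : X / Y ≤ 2 * (X / Y * (T ^ 2 / (T ^ 2 + γ ^ 2))) := by
      have : 1 / 2 ≤ T ^ 2 / (T ^ 2 + γ ^ 2) := by
        rw [div_le_div_iff₀ (by positivity) (by positivity)]; nlinarith
      nlinarith
    rw [abs_le]
    constructor <;> linarith
  · rw [if_neg h1]
    push Not at h1
    have eT : Real.arctan ((T - γ) / X') = -Real.arctan ((γ - T) / X') := by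
      rw [← Real.arctan_neg, ← neg_div, neg_sub]
    rw [eT]
    rcases le_total γ (2 * T) with h2 | h2
    -- just above the cut-off the error near the jump is allowed to be large
    · have eT' := pi_div_two_sub_arctan_le hX' hY (show 0 ≤ γ - T by linarith)
      have nT' := pi_div_two_sub_arctan_nonneg ((γ - T) / X')
      have mono : Real.arctan ((γ - T) / X') ≤ Real.arctan ((T + γ) / X') :=
        Real.arctan_mono (by gcongr; linarith)
      have q : X / Y ≤ 5 * (X / Y * (T ^ 2 / (T ^ 2 + γ ^ 2))) := by
        have : 1 / 5 ≤ T ^ 2 / (T ^ 2 + γ ^ 2) := by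
          rw [div_le_div_iff₀ (by positivity) (by positivity)]; nlinarith
        nlinarith
      have e : (γ - T) ^ 2 = (T - γ) ^ 2 := by ring
      rw [e] at eT'
      rw [abs_le]
      constructor <;> linarith
    -- far above the cut-off the kernel is a second difference of arctangents, which the derivative
    -- bound makes as small as `X T / γ ^ 2`
    · have hK : ∀ x, γ / 2 / X' ≤ x → 1 / (1 + x ^ 2) ≤ 4 * X' ^ 2 / γ ^ 2 := by
        intro x hx
        have hx' : γ / 2 ≤ x * X' := (div_le_iff₀ hX').1 hx
        rw [div_le_div_iff₀ (by positivity) (by positivity)]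
        nlinarith [mul_self_le_mul_self (by positivity) hx', sq_nonneg X']
      have d1 := arctan_sub_le (a := (γ - T) / X') (b := γ / X') (by gcongr; linarith)
        (K := 4 * X' ^ 2 / γ ^ 2) fun x hx => hK x (le_trans (by gcongr; linarith) hx)
      have d2 := arctan_sub_le (a := γ / X') (b := (T + γ) / X') (by gcongr; linarith)
        (K := 4 * X' ^ 2 / γ ^ 2) fun x hx => hK x (le_trans (by gcongr; linarith) hx)
      have m1 : Real.arctan ((γ - T) / X') ≤ Real.arctan (γ / X') :=
        Real.arctan_mono (by gcongr; linarith)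
      have m2 : Real.arctan (γ / X') ≤ Real.arctan ((T + γ) / X') :=
        Real.arctan_mono (by gcongr; linarith)
      have e1 : 4 * X' ^ 2 / γ ^ 2 * (γ / X' - (γ - T) / X') = 4 * X' * T / γ ^ 2 := by
        field_simp; ring
      have e2 : 4 * X' ^ 2 / γ ^ 2 * ((T + γ) / X' - γ / X') = 4 * X' * T / γ ^ 2 := by
        field_simp; ring
      rw [e1] at d1
      rw [e2] at d2
      have q : 4 * X' * T / γ ^ 2 ≤ 16 * (X / Y * (T ^ 2 / (T ^ 2 + γ ^ 2))) := by
        calc 4 * X' * T / γ ^ 2 ≤ 4 * (2 * X) * T / γ ^ 2 := by gcongr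
          _ = 16 * (X / T * (T ^ 2 / (2 * γ ^ 2))) := by field_simp; ring
          _ ≤ 16 * (X / Y * (T ^ 2 / (T ^ 2 + γ ^ 2))) := by
              gcongr
              nlinarith
      have q0 : 0 ≤ X / Y * (T ^ 2 / (T ^ 2 + γ ^ 2)) := by positivity
      rw [abs_le]
      constructor <;> linarith

theorem abs_arctanKernel_sub_le {X X' Y T : ℝ} (γ : ℝ) (hX' : 0 < X') (hXX : X' ≤ 2 * X)
    (hY : 0 < Y) (hYT : Y ≤ T) :
    |arctanKernel X' γ T - Real.pi * (if |γ| ≤ T then Real.sign γ else 0)| ≤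
      cutoffError X Y γ T := by
  rcases lt_trichotomy γ 0 with h | h | h
  · have h1 := abs_arctanKernel_sub_le_of_pos hX' hXX hY hYT (neg_pos.2 h)
    have e1 : cutoffError X Y (-γ) T = cutoffError X Y γ T := by
      simp only [cutoffError, sub_neg_eq_add, ← sub_eq_add_neg, neg_sq]
      ring
    rw [e1, arctanKernel_neg, ← abs_neg] at h1
    rw [abs_of_neg h, Real.sign_of_neg h]
    convert h1 using 2
    split_ifs <;> ring
  · subst h
    have : 0 ≤ cutoffError X Y 0 T := by
      have hT : 0 < T := hY.trans_le hYT
      have hX : 0 < X := by linarith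
      unfold cutoffError; positivity
    simpa [arctanKernel] using this
  · have h1 := abs_arctanKernel_sub_le_of_pos hX' hXX hY hYT h
    rwa [abs_of_pos h, Real.sign_of_pos h]

/-- Bounds for the logarithmic derivative in a right half-plane: it grows slowly, and at a point and
its complex conjugate it takes almost conjugate values. -/
structure HasTameLogDeriv (ξ : ℂ → ℂ) (a C : ℝ) : Prop where
  growth : ∀ s : ℂ, a ≤ s.re → ‖logDeriv ξ s‖ ≤ C * ‖s‖ ^ (1 / 8 : ℝ)
  asymmetry : ∀ s : ℂ, a ≤ s.re →
    ‖logDeriv ξ s - (starRingEnd ℂ) (logDeriv ξ ((starRingEnd ℂ) s))‖ ≤ C / s.re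

namespace IsStripFunction

variable {σ B : ℝ} {ω : ℂ} {ξ : ℂ → ℂ}

theorem finite_zerosUpTo (h : IsStripFunction σ B ω ξ) (T : ℝ) : (zerosUpTo ξ T).Finite := by
  refine (finite_zeros_inter_compact h.differentiable h.map_zero_ne
    (isCompact_closedBall (0 : ℂ) (B + T))).subset fun ρ hρ => ⟨hρ.1, ?_⟩
  rw [mem_closedBall_zero_iff]
  exact (Complex.norm_le_abs_re_add_abs_im ρ).trans (add_le_add (h.strip ρ hρ.1) hρ.2)

/-- The finite set of zeros `ρ` with `|Im ρ| ≤ T`. -/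
noncomputable def zerosTo (h : IsStripFunction σ B ω ξ) (T : ℝ) : Finset ℂ :=
  (h.finite_zerosUpTo T).toFinset

theorem mem_zerosTo (h : IsStripFunction σ B ω ξ) {T : ℝ} {ρ : ℂ} :
    ρ ∈ h.zerosTo T ↔ ξ ρ = 0 ∧ |ρ.im| ≤ T := by
  simp [zerosTo, zerosUpTo]

/-- The number of zeros with `0 < Im ρ ≤ T` minus the number of zeros with `-T ≤ Im ρ < 0`. -/
noncomputable def signedCount (h : IsStripFunction σ B ω ξ) (T : ℝ) : ℝ :=
  ∑ ρ ∈ h.zerosTo T, (analyticOrderNatAt ξ ρ : ℝ) * Real.sign ρ.im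

theorem hasSum_signedCount (h : IsStripFunction σ B ω ξ) (T : ℝ) :
    HasSum (fun ρ : ℂ => (analyticOrderNatAt ξ ρ : ℝ) *
      (if |ρ.im| ≤ T then Real.sign ρ.im else 0)) (h.signedCount T) := by
  have h1 : h.signedCount T = ∑ ρ ∈ h.zerosTo T, (analyticOrderNatAt ξ ρ : ℝ) *
      (if |ρ.im| ≤ T then Real.sign ρ.im else 0) :=
    Finset.sum_congr rfl fun ρ hρ => by rw [if_pos (h.mem_zerosTo.1 hρ).2]
  rw [h1]
  refine hasSum_sum_of_ne_finset_zero fun ρ hρ => ?_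
  by_cases h0 : ξ ρ = 0
  · rw [if_neg fun hT => hρ (h.mem_zerosTo.2 ⟨h0, hT⟩), mul_zero]
  · rw [order_eq_zero h0, Nat.cast_zero, zero_mul]

theorem half_le_sub_re_and_sub_re_le (h : IsStripFunction σ B ω ξ) {ρ : ℂ} {X : ℝ} (hX : 4 * B ≤ X)
    (hρ : ξ ρ = 0) : X / 2 ≤ X - ρ.re ∧ X - ρ.re ≤ 2 * X := by
  have h1 := abs_le.1 (h.strip ρ hρ)
  have := h.B_pos
  constructor <;> linarith

theorem hasDerivAt_arctanKernel {X : ℝ} (hX : 0 < X) (γ t : ℝ) :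
    HasDerivAt (arctanKernel X γ)
      (X / (X ^ 2 + (t - γ) ^ 2) - X / (X ^ 2 + (t + γ) ^ 2)) t := by
  have h1 : HasDerivAt (fun t => (t - γ) / X) (1 / X) t :=
    ((hasDerivAt_id t).sub_const γ).div_const X
  have h2 : HasDerivAt (fun t => (t + γ) / X) (1 / X) t :=
    ((hasDerivAt_id t).add_const γ).div_const X
  refine ((h1.arctan.sub h2.arctan).add_const (2 * Real.arctan (γ / X))).congr_deriv ?_
  field_simp

/-- The sum of the arctangent kernels over the zeros grows slowly, since its derivative in `T` is
the real part of `ξ'/ξ(s) - conj (ξ'/ξ(conj s))` at `s = X + i T`. A zero `β + iγ` is seen from that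
line at distance `X - β`, which is why the smoothing scale depends on the zero. -/
theorem abs_tsum_arctanKernel_le (h : IsStripFunction σ B ω ξ) {a C : ℝ}
    (ht : HasTameLogDeriv ξ a C) {X T : ℝ} (hX : 4 * B ≤ X) (hX2 : 2 ≤ X) (hXa : a ≤ X)
    (hT : 0 ≤ T) :
    (Summable fun ρ : ℂ => (analyticOrderNatAt ξ ρ : ℝ) * arctanKernel (X - ρ.re) ρ.im T) ∧
    |∑' ρ : ℂ, (analyticOrderNatAt ξ ρ : ℝ) * arctanKernel (X - ρ.re) ρ.im T| ≤ C / X * T := by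
  have hX0 : 0 < X := by linarith
  set g : ℂ → ℝ → ℝ := fun ρ t => (analyticOrderNatAt ξ ρ : ℝ) * arctanKernel (X - ρ.re) ρ.im t
    with hg
  set g' : ℂ → ℝ → ℝ := fun ρ t => (analyticOrderNatAt ξ ρ : ℝ) *
    ((X - ρ.re) / ((X - ρ.re) ^ 2 + (t - ρ.im) ^ 2) -
      (X - ρ.re) / ((X - ρ.re) ^ 2 + (t + ρ.im) ^ 2)) with hg'
  set K : ℝ := 2 * (T + 1) ^ 2 + 3 with hK
  have hK0 : 0 < K := by positivity
  set u : ℂ → ℝ := fun ρ => (4 * X * K) * ((analyticOrderNatAt ξ ρ : ℝ) * (1 / (1 + ρ.im ^ 2)))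
    with hu
  have hsu : Summable u := h.summable_order_div.mul_left _
  set I : Set ℝ := Set.Ioo (-(T + 1)) (T + 1) with hI
  have hder : ∀ ρ : ℂ, ∀ t ∈ I, HasDerivAt (g ρ) (g' ρ t) t := by
    intro ρ t _
    by_cases hρ : ξ ρ = 0
    · exact (hasDerivAt_arctanKernel (by linarith [(h.half_le_sub_re_and_sub_re_le hX hρ).1]) _ _).const_mul
        _
    · simp only [hg, hg', order_eq_zero hρ, Nat.cast_zero, zero_mul]
      exact hasDerivAt_const _ _
  have hbd : ∀ ρ : ℂ, ∀ t ∈ I, ‖g' ρ t‖ ≤ u ρ := by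
    intro ρ t ht
    by_cases hρ : ξ ρ = 0
    · obtain ⟨h1, h2⟩ := h.half_le_sub_re_and_sub_re_le hX hρ
      have hp1 : 1 ≤ X - ρ.re := by linarith
      have hp : 0 < X - ρ.re := by linarith
      have key : ∀ c : ℝ, c ^ 2 = ρ.im ^ 2 → (X - ρ.re) / ((X - ρ.re) ^ 2 + (t - c) ^ 2) ≤
          2 * X * K * (1 / (1 + ρ.im ^ 2)) := by
        intro c hc
        rw [mul_one_div]
        have ht2 : t ^ 2 ≤ (T + 1) ^ 2 := sq_le_sq' ht.1.le ht.2.le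
        have : 1 + ρ.im ^ 2 ≤ K * ((X - ρ.re) ^ 2 + (t - c) ^ 2) := by
          have a1 : ρ.im ^ 2 ≤ 2 * (t - c) ^ 2 + 2 * t ^ 2 := by
            rw [← hc]; nlinarith [sq_nonneg (c - 2 * t)]
          have a2 : 1 ≤ (X - ρ.re) ^ 2 := by nlinarith
          have a3 : K * 1 ≤ K * (X - ρ.re) ^ 2 := by gcongr
          have a4 : 2 * (t - c) ^ 2 ≤ K * (t - c) ^ 2 := by
            gcongr; nlinarith [sq_nonneg (T + 1)]
          nlinarith
        rw [div_le_div_iff₀ (by positivity) (by positivity)]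
        calc (X - ρ.re) * (1 + ρ.im ^ 2) ≤ (2 * X) * (K * ((X - ρ.re) ^ 2 + (t - c) ^ 2)) := by
              gcongr
          _ = _ := by ring
      have k1 := key ρ.im rfl
      have k2 := key (-ρ.im) (by ring)
      rw [sub_neg_eq_add] at k2
      have n1 : 0 ≤ (X - ρ.re) / ((X - ρ.re) ^ 2 + (t - ρ.im) ^ 2) := by positivity
      have n2 : 0 ≤ (X - ρ.re) / ((X - ρ.re) ^ 2 + (t + ρ.im) ^ 2) := by positivity
      have n3 : 0 ≤ 2 * X * K * (1 / (1 + ρ.im ^ 2)) := by positivity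
      simp only [hg', hu]
      rw [norm_mul, Real.norm_natCast, Real.norm_eq_abs, mul_left_comm]
      gcongr
      rw [abs_le]
      constructor <;> linarith
    · simp [hg', hu, order_eq_zero hρ]
  have hg0 : ∀ ρ, g ρ 0 = 0 := by
    intro ρ
    simp only [hg, arctanKernel, zero_sub, zero_add, neg_div, Real.arctan_neg]
    ring
  have hs0 : Summable fun ρ => g ρ 0 := by simp only [hg0]; exact summable_zero
  have h0I : (0 : ℝ) ∈ I := ⟨by linarith, by linarith⟩
  have hTI : ∀ t ∈ Set.Icc 0 T, t ∈ I := fun t ht => ⟨by linarith [ht.1], by linarith [ht.2]⟩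
  have hsumm := fun t (ht : t ∈ I) => summable_of_summable_hasDerivAt_of_isPreconnected hsu
    isOpen_Ioo isPreconnected_Ioo hder hbd h0I hs0 ht
  have hD := fun t (ht : t ∈ I) => hasDerivAt_tsum_of_isPreconnected hsu isOpen_Ioo
    isPreconnected_Ioo hder hbd h0I hs0 ht
  have hval : ∀ t ∈ I, ‖∑' ρ, g' ρ t‖ ≤ C / X := by
    intro t _
    set s : ℂ := X + t * Complex.I with hs
    have hsre : s.re = X := by simp [hs]
    have hsim : s.im = t := by simp [hs]
    have hcs : ((starRingEnd ℂ) s).re = X := by simp [hs]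
    have n1 : ξ s ≠ 0 := h.ne_zero_of_lt_re (by rw [hsre]; linarith [h.B_pos])
    have n2 : ξ ((starRingEnd ℂ) s) ≠ 0 := h.ne_zero_of_lt_re (by rw [hcs]; linarith [h.B_pos])
    have hsum := Complex.hasSum_re (h.hasSum_kernel n1 n2)
    have e : ∀ ρ : ℂ, ((analyticOrderNatAt ξ ρ : ℂ) *
        (1 / (s - ρ) - 1 / ((starRingEnd ℂ) s - ρ))).re = g' ρ t := by
      intro ρ
      have e1 : s - ρ = ((X - ρ.re : ℝ) : ℂ) + ((t - ρ.im : ℝ) : ℂ) * Complex.I := by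
        apply Complex.ext <;> simp [hs]
      have e2 : (starRingEnd ℂ) s - ρ =
          ((X - ρ.re : ℝ) : ℂ) + ((-(t + ρ.im) : ℝ) : ℂ) * Complex.I := by
        apply Complex.ext <;> simp [hs]
        ring
      rw [← Complex.ofReal_natCast, Complex.re_ofReal_mul, Complex.sub_re, e1, e2, re_one_div,
        re_one_div, neg_sq]
    simp_rw [e] at hsum
    rw [hsum.tsum_eq]
    have h3 := ht.asymmetry s (by rw [hsre]; exact hXa)
    rw [hsre] at h3
    refine le_trans ?_ h3
    have h4 := Complex.abs_re_le_norm
      (logDeriv ξ s - (starRingEnd ℂ) (logDeriv ξ ((starRingEnd ℂ) s)))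
    rwa [Complex.sub_re, Complex.conj_re, ← Complex.sub_re] at h4
  have hmv := (convex_Icc (0 : ℝ) T).norm_image_sub_le_of_norm_hasDerivWithin_le
    (fun t ht => (hD t (hTI t ht)).hasDerivWithinAt) (fun t ht => hval t (hTI t ht))
    (Set.left_mem_Icc.2 hT) (Set.right_mem_Icc.2 hT)
  refine ⟨hsumm T (hTI T (Set.right_mem_Icc.2 hT)), ?_⟩
  simp only [hg0, tsum_zero, sub_zero, Real.norm_eq_abs, abs_of_nonneg hT] at hmv
  exact hmv

/-- The density bound at scale `Y`, for the kernel normalised to have maximum `1`: about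
`Y * ‖ξ'/ξ‖` zeros lie within distance `Y` of height `t`. -/
theorem summable_poisson_sq_and_tsum_le (h : IsStripFunction σ B ω ξ) {Y t : ℝ} (hY : 4 * B ≤ Y) :
    (Summable fun ρ : ℂ => (analyticOrderNatAt ξ ρ : ℝ) * (Y ^ 2 / (Y ^ 2 + (t - ρ.im) ^ 2))) ∧
    ∑' ρ : ℂ, (analyticOrderNatAt ξ ρ : ℝ) * (Y ^ 2 / (Y ^ 2 + (t - ρ.im) ^ 2)) ≤
      6 * Y * ‖logDeriv ξ (Y + t * Complex.I)‖ := by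
  have hre : ((Y : ℂ) + t * Complex.I).re = Y := by simp
  have him : ((Y : ℂ) + t * Complex.I).im = t := by simp
  have h1 := h.summable_poisson (s := Y + t * Complex.I) (by rw [hre]; exact hY)
  have h2 := h.tsum_poisson_le (s := Y + t * Complex.I) (by rw [hre]; exact hY)
  rw [hre, him] at h1 h2
  have e : (fun ρ : ℂ => (analyticOrderNatAt ξ ρ : ℝ) * (Y ^ 2 / (Y ^ 2 + (t - ρ.im) ^ 2))) =
      fun ρ : ℂ => Y * ((analyticOrderNatAt ξ ρ : ℝ) * (Y / (Y ^ 2 + (t - ρ.im) ^ 2))) := by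
    funext ρ; ring
  have hY0 : 0 < Y := by linarith [h.B_pos]
  refine ⟨by rw [e]; exact h1.mul_left Y, ?_⟩
  rw [e, tsum_mul_left]
  calc _ ≤ Y * (6 * ‖logDeriv ξ (Y + t * Complex.I)‖) := by gcongr
    _ = _ := by ring

theorem norm_logDeriv_le_of_pow {a C : ℝ} (ht : HasTameLogDeriv ξ a C) (hC : 0 ≤ C) {Y t q : ℝ}
    (hq : 1 ≤ q) (hYa : a ≤ Y) (hY0 : 0 ≤ Y) (hY : Y ≤ q ^ 8) (htq : |t| ≤ q ^ 8) :
    ‖logDeriv ξ (Y + t * Complex.I)‖ ≤ 2 * C * q := by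
  refine (ht.growth _ (by simpa using hYa)).trans ?_
  have h1 : ‖(Y : ℂ) + t * Complex.I‖ ≤ (2 * q) ^ 8 := by
    refine (norm_add_le _ _).trans ?_
    simp only [norm_mul, Complex.norm_real, Complex.norm_I, mul_one, Real.norm_eq_abs,
      abs_of_nonneg hY0]
    have : 0 ≤ q ^ 8 := by positivity
    calc Y + |t| ≤ 2 * q ^ 8 := by linarith
      _ ≤ 256 * q ^ 8 := by linarith
      _ = (2 * q) ^ 8 := by ring
  have h2 : ‖(Y : ℂ) + t * Complex.I‖ ^ (1 / 8 : ℝ) ≤ 2 * q := by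
    calc _ ≤ ((2 * q) ^ 8) ^ (1 / 8 : ℝ) := Real.rpow_le_rpow (norm_nonneg _) h1 (by norm_num)
      _ = 2 * q := by
        rw [← Real.rpow_natCast, ← Real.rpow_mul (by positivity)]
        norm_num
  calc _ ≤ C * (2 * q) := by gcongr
    _ = _ := by ring

/-- The bound of `exists_abs_signedCount_le` at `T = q ^ 8`, which keeps all exponents integral.
The line of integration is `Re s = X = q ^ 4` and the cut-off is smoothed at scale `Y = q ^ 6`. The
main term is `X⁻¹ T = q ^ 4`; with `ξ'/ξ = O(q)`, the zeros near the jumps contribute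
`Y q = q ^ 7` and the remaining ones `(X / Y) T q = q ^ 7`. -/
theorem exists_abs_signedCount_pow_le (h : IsStripFunction σ B ω ξ) {a C : ℝ}
    (ht : HasTameLogDeriv ξ a C) :
    ∃ K q₀ : ℝ, 1 ≤ q₀ ∧ 0 ≤ K ∧ ∀ q ≥ q₀, |h.signedCount (q ^ 8)| ≤ K * q ^ 7 := by
  have hB := h.B_pos
  -- the asymmetry bound at a real point with positive abscissa forces `C` to be nonnegative
  have hC : 0 ≤ C := by
    have h1 := (norm_nonneg _).trans (ht.asymmetry ((max a 1 : ℝ) : ℂ) (by simp))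
    rw [Complex.ofReal_re] at h1
    by_contra hneg
    exact absurd h1 (not_le.2 (div_neg_of_neg_of_pos (not_le.1 hneg) (by positivity)))
  refine ⟨C + 64 * 48 * C, max (max (4 * B) a) 2, by simp, by positivity, fun q hq => ?_⟩
  have hqB : 4 * B ≤ q := (le_max_left _ _).trans ((le_max_left _ _).trans hq)
  have hqa : a ≤ q := (le_max_right _ _).trans ((le_max_left _ _).trans hq)
  have hq2 : 2 ≤ q := (le_max_right _ _).trans hq
  have hq1 : 1 ≤ q := by linarith
  have hq0 : 0 < q := by linarith
  have hpow : ∀ n : ℕ, n ≠ 0 → q ≤ q ^ n := fun n hn => le_self_pow₀ hq1 hn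
  have hY8 : q ^ 6 ≤ q ^ 8 := pow_le_pow_right₀ hq1 (by norm_num)
  have q4 := hpow 4 (by norm_num)
  have q6 := hpow 6 (by norm_num)
  have q8 := hpow 8 (by norm_num)
  set T := q ^ 8 with hT
  have hT0 : 0 < T := by positivity
  obtain ⟨s1, b1⟩ := h.abs_tsum_arctanKernel_le ht (X := q ^ 4) (T := T) (by linarith)
    (by linarith) (by linarith) hT0.le
  obtain ⟨s2, b2⟩ := h.summable_poisson_sq_and_tsum_le (Y := q ^ 6) (t := T) (by linarith)
  obtain ⟨s3, b3⟩ := h.summable_poisson_sq_and_tsum_le (Y := q ^ 6) (t := -T) (by linarith)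
  obtain ⟨s4, b4⟩ := h.summable_poisson_sq_and_tsum_le (Y := q ^ 6) (t := 0) (by linarith)
  obtain ⟨s5, b5⟩ := h.summable_poisson_sq_and_tsum_le (Y := T) (t := 0) (by linarith)
  have f2 := norm_logDeriv_le_of_pow ht hC (Y := q ^ 6) (t := T) hq1 (by linarith) (by positivity)
    hY8 (abs_of_pos hT0).le
  have f3 := norm_logDeriv_le_of_pow ht hC (Y := q ^ 6) (t := -T) hq1 (by linarith) (by positivity)
    hY8 (by rw [abs_neg]; exact (abs_of_pos hT0).le)
  have f4 := norm_logDeriv_le_of_pow ht hC (Y := q ^ 6) (t := 0) hq1 (by linarith) (by positivity)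
    hY8 (by rw [abs_zero]; exact hT0.le)
  have f5 := norm_logDeriv_le_of_pow ht hC (Y := T) (t := 0) hq1 (by linarith) (by positivity)
    le_rfl (by rw [abs_zero]; exact hT0.le)
  have q6' : 0 ≤ 6 * q ^ 6 := by positivity
  have c2 := b2.trans (mul_le_mul_of_nonneg_left f2 q6')
  have c3 := b3.trans (mul_le_mul_of_nonneg_left f3 q6')
  have c4 := b4.trans (mul_le_mul_of_nonneg_left f4 q6')
  have c5 := b5.trans (mul_le_mul_of_nonneg_left f5 (show 0 ≤ 6 * T by positivity))
  set err : ℂ → ℝ := fun ρ => (analyticOrderNatAt ξ ρ : ℝ) * cutoffError (q ^ 4) (q ^ 6) ρ.im T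
    with herr
  have eerr : err = fun ρ : ℂ => 64 *
      (((analyticOrderNatAt ξ ρ : ℝ) * ((q ^ 6) ^ 2 / ((q ^ 6) ^ 2 + (T - ρ.im) ^ 2)) +
        (analyticOrderNatAt ξ ρ : ℝ) * ((q ^ 6) ^ 2 / ((q ^ 6) ^ 2 + (-T - ρ.im) ^ 2)) +
        (analyticOrderNatAt ξ ρ : ℝ) * ((q ^ 6) ^ 2 / ((q ^ 6) ^ 2 + (0 - ρ.im) ^ 2))) +
        q ^ 4 / q ^ 6 * ((analyticOrderNatAt ξ ρ : ℝ) * (T ^ 2 / (T ^ 2 + (0 - ρ.im) ^ 2)))) := by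
    funext ρ
    have e1 : (-T - ρ.im) ^ 2 = (T + ρ.im) ^ 2 := by ring
    have e2 : (0 - ρ.im) ^ 2 = ρ.im ^ 2 := by ring
    simp only [herr, cutoffError, e1, e2]
    ring
  have serr := (((s2.hasSum.add s3.hasSum).add s4.hasSum).add
    (s5.hasSum.mul_left (q ^ 4 / q ^ 6))).mul_left 64
  rw [← eerr] at serr
  have hcount := (h.hasSum_signedCount T).mul_left Real.pi
  have hdiff := s1.hasSum.sub hcount
  have hle : |(∑' ρ : ℂ, (analyticOrderNatAt ξ ρ : ℝ) * arctanKernel (q ^ 4 - ρ.re) ρ.im T) -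
      Real.pi * h.signedCount T| ≤ ∑' ρ, err ρ := by
    rw [← hdiff.tsum_eq, ← Real.norm_eq_abs]
    refine tsum_of_norm_bounded serr.summable.hasSum fun ρ => ?_
    by_cases hρ : ξ ρ = 0
    · obtain ⟨h1, h2⟩ := h.half_le_sub_re_and_sub_re_le (X := q ^ 4) (by linarith) hρ
      have := abs_arctanKernel_sub_le (X := q ^ 4) (X' := q ^ 4 - ρ.re) (Y := q ^ 6) (T := T)
        ρ.im (by linarith) h2 (by linarith) hY8
      rw [Real.norm_eq_abs, mul_left_comm, ← mul_sub, abs_mul, Nat.abs_cast]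
      exact mul_le_mul_of_nonneg_left this (Nat.cast_nonneg _)
    · simp [herr, order_eq_zero hρ]
  rw [serr.tsum_eq] at hle
  have e1 : C / q ^ 4 * T = C * q ^ 4 := by rw [hT]; field_simp
  have e2 : C * q ^ 4 ≤ C * q ^ 7 :=
    mul_le_mul_of_nonneg_left (pow_le_pow_right₀ hq1 (by norm_num)) hC
  have e3 : q ^ 4 / q ^ 6 * (6 * T * (2 * C * q)) = 12 * C * q ^ 7 := by rw [hT]; field_simp; ring
  have c5' := mul_le_mul_of_nonneg_left c5 (show 0 ≤ q ^ 4 / q ^ 6 by positivity)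
  rw [e3] at c5'
  rw [e1] at b1
  have hpi : |h.signedCount T| ≤ |Real.pi * h.signedCount T| := by
    rw [abs_mul, abs_of_pos Real.pi_pos]
    exact le_mul_of_one_le_left (abs_nonneg _) (by linarith [Real.pi_gt_three])
  have e4 : 6 * q ^ 6 * (2 * C * q) = 12 * C * q ^ 7 := by ring
  rw [e4] at c2 c3 c4
  set D := ∑' ρ : ℂ, (analyticOrderNatAt ξ ρ : ℝ) * arctanKernel (q ^ 4 - ρ.re) ρ.im T
  have h6 : |Real.pi * h.signedCount T| ≤ |D| + |D - Real.pi * h.signedCount T| := by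
    have := abs_sub D (D - Real.pi * h.signedCount T)
    rwa [sub_sub_cancel] at this
  linarith

/-- The zeros are almost equally distributed between the upper and the lower half-plane. Any
exponent below `1` suffices for the convergence of the symmetric sum of `1 / (s - ρ)`. -/
theorem exists_abs_signedCount_le (h : IsStripFunction σ B ω ξ) {a C : ℝ}
    (ht : HasTameLogDeriv ξ a C) :
    ∃ K T₀ : ℝ, 1 ≤ T₀ ∧ 0 ≤ K ∧ ∀ T ≥ T₀, |h.signedCount T| ≤ K * T ^ (7 / 8 : ℝ) := by
  obtain ⟨K, q₀, hq₀, hK, hle⟩ := h.exists_abs_signedCount_pow_le ht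
  refine ⟨K, q₀ ^ 8, one_le_pow₀ hq₀, hK, fun T hT => ?_⟩
  have hT0 : 0 ≤ T := le_trans (by positivity) hT
  have e1 : (T ^ (1 / 8 : ℝ)) ^ 8 = T := by
    rw [← Real.rpow_natCast, ← Real.rpow_mul hT0]; norm_num
  have e2 : (T ^ (1 / 8 : ℝ)) ^ 7 = T ^ (7 / 8 : ℝ) := by
    rw [← Real.rpow_natCast, ← Real.rpow_mul hT0]; norm_num
  have h1 : q₀ ≤ T ^ (1 / 8 : ℝ) := by
    refine le_of_pow_le_pow_left₀ (n := 8) (by norm_num) (by positivity) ?_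
    rwa [e1]
  have := hle _ h1
  rwa [e1, e2] at this

end IsStripFunction

/-! ### The symmetric sum of `1 / (s - ρ)` -/

open MeasureTheory in
/-- Partial summation against the kernels `t / (c + t ^ 2)`. The bound does not depend on `c`, since
the derivatives of all these kernels are at most `1 / t ^ 2`. -/
theorem abs_sum_mul_le_of_count {ι : Type*} (S : Finset ι) (w y : ι → ℝ) {T U K c : ℝ} (hT : 1 ≤ T)
    (hTU : T ≤ U) (hc : 0 ≤ c) (hy : ∀ i ∈ S, T < y i ∧ y i ≤ U)
    (hcount : ∀ t ∈ Set.Icc T U, |∑ i ∈ S, if y i ≤ t then w i else 0| ≤ K * t ^ (7 / 8 : ℝ)) :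
    |∑ i ∈ S, w i * (y i / (c + y i ^ 2))| ≤ 9 * K * T ^ (-(1 / 8) : ℝ) := by
  have hT0 : 0 < T := by linarith
  have hU0 : 0 < U := by linarith
  have hK : 0 ≤ K := by
    have h1 := (abs_nonneg _).trans (hcount T ⟨le_rfl, hTU⟩)
    have h2 : 0 < T ^ (7 / 8 : ℝ) := by positivity
    exact nonneg_of_mul_nonneg_left h1 h2
  set φ : ℝ → ℝ := fun t => t / (c + t ^ 2) with hφ
  set φ' : ℝ → ℝ := fun t => (1 * (c + t ^ 2) - t * (2 * t)) / (c + t ^ 2) ^ 2 with hφ'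
  have hpos : ∀ t, 0 < t → 0 < c + t ^ 2 := fun t ht => by positivity
  have hder : ∀ t, 0 < t → HasDerivAt φ (φ' t) t := fun t ht => by
    have h1 : HasDerivAt (fun t : ℝ => c + t ^ 2) (2 * t) t := by
      simpa using (hasDerivAt_pow 2 t).const_add c
    exact (hasDerivAt_id t).div h1 (hpos t ht).ne'
  have hφ'le : ∀ t, 0 < t → |φ' t| ≤ 1 / t ^ 2 := fun t ht => by
    have h0 := hpos t ht
    have h2 : 0 < t ^ 2 := by positivity
    have : |1 * (c + t ^ 2) - t * (2 * t)| ≤ c + t ^ 2 := by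
      rw [abs_le]; constructor <;> nlinarith
    rw [hφ', abs_div, abs_of_pos (pow_pos h0 2), div_le_div_iff₀ (by positivity) h2]
    nlinarith
  have hφle : |φ U| ≤ 1 / U := by
    have h0 := hpos U hU0
    rw [hφ, abs_of_nonneg (by positivity), div_le_div_iff₀ h0 hU0]
    nlinarith
  have hcont : ContinuousOn φ' (Set.Icc T U) := by
    refine ContinuousOn.div (by fun_prop) (by fun_prop) fun t ht => ?_
    exact (pow_pos (hpos t (hT0.trans_le ht.1)) 2).ne'
  have hint : IntegrableOn φ' (Set.Ioc T U) :=
    (hcont.integrableOn_Icc).mono_set Set.Ioc_subset_Icc_self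
  have hterm : ∀ i ∈ S, φ (y i) =
      φ U - ∫ t in Set.Ioc T U, (Set.Ici (y i)).indicator φ' t := fun i hi => by
    obtain ⟨h1, h2⟩ := hy i hi
    have e1 : Set.Ioc T U ∩ Set.Ici (y i) = Set.Icc (y i) U := by
      ext t; simp only [Set.mem_inter_iff, Set.mem_Ioc, Set.mem_Ici, Set.mem_Icc]
      constructor
      · rintro ⟨⟨_, h⟩, h'⟩; exact ⟨h', h⟩
      · rintro ⟨h, h'⟩; exact ⟨⟨h1.trans_le h, h'⟩, h⟩
    rw [setIntegral_indicator measurableSet_Ici, e1, integral_Icc_eq_integral_Ioc,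
      ← intervalIntegral.integral_of_le h2, intervalIntegral.integral_eq_sub_of_hasDerivAt]
    · exact (sub_sub_cancel _ _).symm
    · intro t ht
      rw [Set.uIcc_of_le h2] at ht
      exact hder t (hT0.trans (h1.trans_le ht.1))
    · refine ContinuousOn.intervalIntegrable ?_
      rw [Set.uIcc_of_le h2]
      exact hcont.mono (Set.Icc_subset_Icc_left h1.le)
  have hsum : ∑ i ∈ S, w i * φ (y i) = φ U * (∑ i ∈ S, if y i ≤ U then w i else 0) -
      ∫ t in Set.Ioc T U, φ' t * (∑ i ∈ S, if y i ≤ t then w i else 0) := by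
    have e1 : ∀ t, φ' t * (∑ i ∈ S, if y i ≤ t then w i else 0) =
        ∑ i ∈ S, w i * (Set.Ici (y i)).indicator φ' t := fun t => by
      rw [Finset.mul_sum]
      refine Finset.sum_congr rfl fun i _ => ?_
      by_cases h : y i ≤ t
      · rw [if_pos h, Set.indicator_of_mem (Set.mem_Ici.2 h), mul_comm]
      · rw [if_neg h, Set.indicator_of_notMem (fun h' => h (Set.mem_Ici.1 h'))]; ring
    simp_rw [e1]
    rw [integral_finsetSum _ fun i _ => (hint.indicator measurableSet_Ici).const_mul _,
      Finset.mul_sum, ← Finset.sum_sub_distrib]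
    refine Finset.sum_congr rfl fun i hi => ?_
    rw [if_pos (hy i hi).2, integral_const_mul, hterm i hi]
    ring
  have hbd : ∀ t, 0 < t → ∀ a b : ℝ, |a| ≤ 1 / t ^ 2 → |b| ≤ K * t ^ (7 / 8 : ℝ) →
      |a * b| ≤ K * t ^ (-(9 / 8) : ℝ) := fun t ht a b ha hb => by
    rw [abs_mul]
    calc |a| * |b| ≤ 1 / t ^ 2 * (K * t ^ (7 / 8 : ℝ)) := by gcongr
      _ = K * (t ^ (-2 : ℝ) * t ^ (7 / 8 : ℝ)) := by
          rw [Real.rpow_neg ht.le, Real.rpow_two]; ring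
      _ = _ := by rw [← Real.rpow_add ht]; norm_num
  have hrint : ∫ t in T..U, K * t ^ (-(9 / 8) : ℝ) =
      K * (8 * (T ^ (-(1 / 8) : ℝ) - U ^ (-(1 / 8) : ℝ))) := by
    rw [intervalIntegral.integral_const_mul, integral_rpow]
    · rw [show (-(9 / 8) + 1 : ℝ) = -(1 / 8) by norm_num]
      generalize T ^ (-(1 / 8) : ℝ) = p
      generalize U ^ (-(1 / 8) : ℝ) = q
      ring_nf
    · right
      refine ⟨by norm_num, fun h => ?_⟩
      rw [Set.uIcc_of_le hTU] at h
      linarith [h.1]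
  have hI : |∫ t in Set.Ioc T U, φ' t * (∑ i ∈ S, if y i ≤ t then w i else 0)| ≤
      K * (8 * (T ^ (-(1 / 8) : ℝ) - U ^ (-(1 / 8) : ℝ))) := by
    rw [← hrint, intervalIntegral.integral_of_le hTU, ← Real.norm_eq_abs]
    refine norm_integral_le_of_norm_le ?_ ?_
    · rw [← IntegrableOn, ← intervalIntegrable_iff_integrableOn_Ioc_of_le hTU]
      refine (intervalIntegral.intervalIntegrable_rpow ?_).const_mul _
      right
      rw [Set.uIcc_of_le hTU]
      exact fun h => by linarith [h.1]
    · filter_upwards [ae_restrict_mem measurableSet_Ioc] with t ht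
      have ht0 := hT0.trans ht.1
      exact hbd t ht0 _ _ (hφ'le t ht0) (hcount t ⟨ht.1.le, ht.2⟩)
  have hUT : U ^ (-(1 / 8) : ℝ) ≤ T ^ (-(1 / 8) : ℝ) :=
    Real.rpow_le_rpow_of_nonpos hT0 hTU (by norm_num)
  have hUb : |φ U * (∑ i ∈ S, if y i ≤ U then w i else 0)| ≤ K * U ^ (-(1 / 8) : ℝ) := by
    rw [abs_mul]
    calc _ ≤ 1 / U * (K * U ^ (7 / 8 : ℝ)) := by
          gcongr
          exact hcount U ⟨hTU, le_rfl⟩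
      _ = K * (U ^ (-1 : ℝ) * U ^ (7 / 8 : ℝ)) := by
          rw [Real.rpow_neg hU0.le, Real.rpow_one]; ring
      _ = _ := by rw [← Real.rpow_add hU0]; norm_num
  have hpT : 0 ≤ U ^ (-(1 / 8) : ℝ) := by positivity
  rw [hsum]
  refine (abs_sub _ _).trans ((add_le_add hUb hI).trans ?_)
  nlinarith [mul_nonneg hK hpT, mul_le_mul_of_nonneg_left hUT hK]

namespace IsStripFunction

variable {σ B : ℝ} {ω : ℂ} {ξ : ℂ → ℂ}

/-- An absolutely convergent sum over the zeros may be summed by increasing height. -/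
theorem tendsto_sum_zerosTo {E : Type*} [NormedAddCommGroup E] (h : IsStripFunction σ B ω ξ)
    {a : ℂ → E} {S : E} (ha : HasSum a S) (h0 : ∀ ρ, ξ ρ ≠ 0 → a ρ = 0) :
    Tendsto (fun T => ∑ ρ ∈ h.zerosTo T, a ρ) atTop (𝓝 S) := by
  classical
  rw [Metric.tendsto_atTop]
  intro ε hε
  obtain ⟨V, hV⟩ := (Metric.tendsto_atTop.1 ha) ε hε
  refine ⟨∑ ρ ∈ V, ‖ρ‖, fun T hT => ?_⟩
  have h1 := hV (V ∪ h.zerosTo T) Finset.subset_union_left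
  rwa [← Finset.sum_subset (s₁ := h.zerosTo T) Finset.subset_union_right] at h1
  intro ρ hρ hρ'
  refine h0 ρ fun hz => hρ' (h.mem_zerosTo.2 ⟨hz, ?_⟩)
  rcases Finset.mem_union.1 hρ with h2 | h2
  · exact (Complex.abs_im_le_norm ρ).trans ((Finset.single_le_sum (f := fun ρ : ℂ => ‖ρ‖)
      (fun _ _ => norm_nonneg _) h2).trans hT)
  · exact absurd h2 hρ'

theorem zerosTo_mono (h : IsStripFunction σ B ω ξ) {T U : ℝ} (hTU : T ≤ U) :
    h.zerosTo T ⊆ h.zerosTo U := fun ρ hρ => by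
  rw [mem_zerosTo] at hρ ⊢
  exact ⟨hρ.1, hρ.2.trans hTU⟩

/-- The contribution to the sum of `γ / (c + γ ^ 2)` of the ordinates `γ` above height `T` is small,
uniformly in `c`. -/
theorem exists_abs_sum_sub_le (h : IsStripFunction σ B ω ξ) {a C : ℝ}
    (ht : HasTameLogDeriv ξ a C) :
    ∃ K T₀ : ℝ, ∀ T U c : ℝ, T₀ ≤ T → T ≤ U → 0 ≤ c →
      |∑ ρ ∈ h.zerosTo U \ h.zerosTo T, (analyticOrderNatAt ξ ρ : ℝ) * (ρ.im / (c + ρ.im ^ 2))| ≤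
        K * T ^ (-(1 / 8) : ℝ) := by
  obtain ⟨K, T₀, hT₀, hK, hle⟩ := h.exists_abs_signedCount_le ht
  refine ⟨9 * (2 * K), T₀, fun T U c hT hTU hc => ?_⟩
  have hT1 : 1 ≤ T := hT₀.trans hT
  have key := abs_sum_mul_le_of_count (h.zerosTo U \ h.zerosTo T)
    (fun ρ => (analyticOrderNatAt ξ ρ : ℝ) * Real.sign ρ.im) (fun ρ => |ρ.im|) (K := 2 * K) hT1 hTU
    hc ?_ ?_
  · refine le_trans (le_of_eq ?_) key
    congr 1
    refine Finset.sum_congr rfl fun ρ _ => ?_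
    rw [sq_abs, mul_assoc, mul_div_assoc']
    rcases lt_trichotomy ρ.im 0 with h0 | h0 | h0
    · rw [Real.sign_of_neg h0, abs_of_neg h0]; ring
    · rw [h0]; simp
    · rw [Real.sign_of_pos h0, abs_of_pos h0]; ring
  · intro ρ hρ
    rw [Finset.mem_sdiff, mem_zerosTo, mem_zerosTo] at hρ
    exact ⟨not_le.1 fun hh => hρ.2 ⟨hρ.1.1, hh⟩, hρ.1.2⟩
  · intro t htt
    have e1 : ∑ ρ ∈ h.zerosTo U \ h.zerosTo T,
        (if |ρ.im| ≤ t then (analyticOrderNatAt ξ ρ : ℝ) * Real.sign ρ.im else 0) =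
        h.signedCount t - h.signedCount T := by
      rw [← Finset.sum_filter, signedCount, signedCount,
        ← Finset.sum_sdiff (h.zerosTo_mono htt.1), add_sub_cancel_right]
      refine Finset.sum_congr ?_ fun _ _ => rfl
      ext ρ
      simp only [Finset.mem_filter, Finset.mem_sdiff, mem_zerosTo]
      constructor
      · rintro ⟨⟨⟨a1, a2⟩, a3⟩, a4⟩; exact ⟨⟨a1, a4⟩, a3⟩
      · rintro ⟨⟨a1, a4⟩, a3⟩; exact ⟨⟨⟨a1, a4.trans htt.2⟩, a3⟩, a4⟩
    rw [e1]
    refine (abs_sub _ _).trans ((add_le_add (hle t (hT.trans htt.1)) (hle T hT)).trans ?_)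
    have : T ^ (7 / 8 : ℝ) ≤ t ^ (7 / 8 : ℝ) :=
      Real.rpow_le_rpow (by linarith) htt.1 (by norm_num)
    nlinarith [mul_le_mul_of_nonneg_left this hK]

/-- Replacing `ρ` by its projection to the imaginary axis costs an absolutely summable amount,
uniformly in `x`. -/
theorem abs_im_one_div_sub_le (h : IsStripFunction σ B ω ξ) {ρ : ℂ} {x : ℝ} (hx : 4 * B ≤ x)
    (hx1 : 1 ≤ x) (hρ : ξ ρ = 0) :
    |(1 / ((x : ℂ) - ρ)).im - ρ.im / (x ^ 2 + ρ.im ^ 2)| ≤ 12 * B * (1 / (1 + ρ.im ^ 2)) := by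
  obtain ⟨h1, h2⟩ := h.half_le_sub_re_and_sub_re_le hx hρ
  have hβ := h.strip ρ hρ
  have hB := h.B_pos
  set p := x - ρ.re with hp
  set γ := ρ.im
  have hx0 : 0 < x := by linarith
  have hp0 : 0 < p := by linarith
  have e1 : (1 / ((x : ℂ) - ρ)).im = γ / (p ^ 2 + γ ^ 2) := by
    simp [Complex.normSq_apply, hp, sq, γ]
  have hd1 : 0 < p ^ 2 + γ ^ 2 := by positivity
  have hd2 : 0 < x ^ 2 + γ ^ 2 := by positivity
  have e2 : γ / (p ^ 2 + γ ^ 2) - γ / (x ^ 2 + γ ^ 2) =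
      γ * (ρ.re * (x + p)) / ((p ^ 2 + γ ^ 2) * (x ^ 2 + γ ^ 2)) := by
    rw [div_sub_div _ _ hd1.ne' hd2.ne']
    congr 1
    rw [hp]; ring
  have h3 : |γ * (ρ.re * (x + p))| ≤ B * (3 * (x * |γ|)) := by
    rw [abs_mul, abs_mul, abs_of_pos (show 0 < x + p by linarith)]
    calc |γ| * (|ρ.re| * (x + p)) ≤ |γ| * (B * (3 * x)) := by gcongr; linarith
      _ = _ := by ring
  have h4 : x * |γ| ≤ 2 * (p ^ 2 + γ ^ 2) := by
    nlinarith [sq_nonneg (p - |γ|), sq_abs γ,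
      mul_le_mul_of_nonneg_right (show x ≤ 2 * p by linarith) (abs_nonneg γ)]
  have h5 : 1 + γ ^ 2 ≤ x ^ 2 + γ ^ 2 := by nlinarith
  rw [e1, e2, abs_div, abs_of_pos (mul_pos hd1 hd2), mul_one_div,
    div_le_div_iff₀ (mul_pos hd1 hd2) (by positivity)]
  calc |γ * (ρ.re * (x + p))| * (1 + γ ^ 2)
      ≤ B * (3 * (2 * (p ^ 2 + γ ^ 2))) * (x ^ 2 + γ ^ 2) := by
        gcongr
        exact h3.trans (by gcongr)
    _ ≤ 12 * B * ((p ^ 2 + γ ^ 2) * (x ^ 2 + γ ^ 2)) := by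
        nlinarith [mul_pos hB (mul_pos hd1 hd2)]

/-- The symmetric sums of `Im (1 / (x - ρ))` converge uniformly in large real `x`. -/
theorem exists_uniform_tail (h : IsStripFunction σ B ω ξ) {a C : ℝ} (ht : HasTameLogDeriv ξ a C)
    {ε : ℝ} (hε : 0 < ε) :
    ∃ T : ℝ, ∀ U ≥ T, ∀ x : ℝ, 4 * B ≤ x → 1 ≤ x →
      |∑ ρ ∈ h.zerosTo U, (analyticOrderNatAt ξ ρ : ℝ) * (1 / ((x : ℂ) - ρ)).im -
        ∑ ρ ∈ h.zerosTo T, (analyticOrderNatAt ξ ρ : ℝ) * (1 / ((x : ℂ) - ρ)).im| ≤ ε := by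
  obtain ⟨K, T₀, hK⟩ := h.exists_abs_sum_sub_le ht
  have hB := h.B_pos
  have hs := h.summable_order_div
  have l1 := h.tendsto_sum_zerosTo hs.hasSum fun ρ hρ => by simp [order_eq_zero hρ]
  set S := ∑' ρ : ℂ, (analyticOrderNatAt ξ ρ : ℝ) * (1 / (1 + ρ.im ^ 2))
  have l2 : Tendsto (fun T : ℝ => K * T ^ (-(1 / 8) : ℝ) +
      12 * B * (S - ∑ ρ ∈ h.zerosTo T, (analyticOrderNatAt ξ ρ : ℝ) * (1 / (1 + ρ.im ^ 2))))
      atTop (𝓝 (K * 0 + 12 * B * (S - S))) :=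
    ((tendsto_rpow_neg_atTop (by norm_num)).const_mul K).add ((l1.const_sub S).const_mul _)
  rw [sub_self, mul_zero, mul_zero, add_zero] at l2
  obtain ⟨T, hT, hTT⟩ := ((l2.eventually (gt_mem_nhds hε)).and (eventually_ge_atTop T₀)).exists
  refine ⟨T, fun U hU x hx hx1 => ?_⟩
  rw [← Finset.sum_sdiff (h.zerosTo_mono hU), add_sub_cancel_right]
  have k1 := hK T U (x ^ 2) hTT hU (sq_nonneg x)
  have k2 : |∑ ρ ∈ h.zerosTo U \ h.zerosTo T, (analyticOrderNatAt ξ ρ : ℝ) *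
      ((1 / ((x : ℂ) - ρ)).im - ρ.im / (x ^ 2 + ρ.im ^ 2))| ≤
      12 * B * (S - ∑ ρ ∈ h.zerosTo T, (analyticOrderNatAt ξ ρ : ℝ) * (1 / (1 + ρ.im ^ 2))) := by
    have k3 : ∑ ρ ∈ h.zerosTo U, (analyticOrderNatAt ξ ρ : ℝ) * (1 / (1 + ρ.im ^ 2)) ≤ S :=
      hs.sum_le_tsum _ fun ρ _ => by positivity
    rw [← Finset.sum_sdiff (h.zerosTo_mono hU)] at k3
    refine le_trans ?_ (mul_le_mul_of_nonneg_left (le_sub_iff_add_le.2 k3) (by positivity))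
    refine (Finset.abs_sum_le_sum_abs _ _).trans ?_
    rw [Finset.mul_sum]
    refine Finset.sum_le_sum fun ρ hρ => ?_
    have hz : ξ ρ = 0 := (h.mem_zerosTo.1 (Finset.mem_sdiff.1 hρ).1).1
    rw [abs_mul, Nat.abs_cast, mul_left_comm]
    exact mul_le_mul_of_nonneg_left (h.abs_im_one_div_sub_le hx hx1 hz) (Nat.cast_nonneg _)
  have e : ∑ ρ ∈ h.zerosTo U \ h.zerosTo T,
      (analyticOrderNatAt ξ ρ : ℝ) * (1 / ((x : ℂ) - ρ)).im =
      ∑ ρ ∈ h.zerosTo U \ h.zerosTo T, (analyticOrderNatAt ξ ρ : ℝ) *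
        (ρ.im / (x ^ 2 + ρ.im ^ 2)) +
      ∑ ρ ∈ h.zerosTo U \ h.zerosTo T, (analyticOrderNatAt ξ ρ : ℝ) *
      ((1 / ((x : ℂ) - ρ)).im - ρ.im / (x ^ 2 + ρ.im ^ 2)) := by
    rw [← Finset.sum_add_distrib]
    exact Finset.sum_congr rfl fun ρ _ => by ring
  rw [e]
  exact (abs_add_le _ _).trans ((add_le_add k1 k2).trans hT.le)

theorem tendsto_sum_kernel (h : IsStripFunction σ B ω ξ) {s s' : ℂ} (hs : ξ s ≠ 0)
    (hs' : ξ s' ≠ 0) :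
    Tendsto (fun T => ∑ ρ ∈ h.zerosTo T,
      (analyticOrderNatAt ξ ρ : ℂ) * (1 / (s - ρ) - 1 / (s' - ρ))) atTop
      (𝓝 (logDeriv ξ s - logDeriv ξ s')) :=
  h.tendsto_sum_zerosTo (h.hasSum_kernel hs hs') fun ρ hρ => by simp [order_eq_zero hρ]

/-- By `tendsto_sum_kernel` the symmetric sums at `x` and at `x'` differ from each other by the
imaginary part of `ξ'/ξ(x) - ξ'/ξ(x')` in the limit. Both sides at `x'` tend to `0` as `x' → ∞`, the
sums because their tails are uniformly small. -/
theorem tendsto_sum_im (h : IsStripFunction σ B ω ξ) {a C : ℝ} (ht : HasTameLogDeriv ξ a C)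
    {x : ℝ} (hx : 4 * B ≤ x) :
    Tendsto (fun T => ∑ ρ ∈ h.zerosTo T, (analyticOrderNatAt ξ ρ : ℝ) * (1 / ((x : ℂ) - ρ)).im)
      atTop (𝓝 (logDeriv ξ x).im) := by
  have hB := h.B_pos
  rw [Metric.tendsto_atTop']
  intro ε hε
  obtain ⟨T, hT⟩ := h.exists_uniform_tail ht (show 0 < ε / 4 by linarith)
  -- as `x' → ∞` the zeros up to height `T` contribute nothing, and `Im (ξ'/ξ)(x')` tends to `0`
  have l1 : Tendsto (fun x' : ℝ => ∑ ρ ∈ h.zerosTo T,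
      (analyticOrderNatAt ξ ρ : ℝ) * (1 / ((x' : ℂ) - ρ)).im) atTop (𝓝 0) := by
    have : Tendsto (fun x' : ℝ => ∑ ρ ∈ h.zerosTo T,
        (analyticOrderNatAt ξ ρ : ℝ) * (1 / ((x' : ℂ) - ρ)).im) atTop
        (𝓝 (∑ ρ ∈ h.zerosTo T, (analyticOrderNatAt ξ ρ : ℝ) * (0 : ℂ).im)) := by
      refine tendsto_finsetSum _ fun ρ _ => Tendsto.const_mul _ ?_
      refine (Complex.continuous_im.tendsto 0).comp ?_
      simp_rw [one_div]
      refine tendsto_inv₀_cobounded.comp ?_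
      rw [← tendsto_norm_atTop_iff_cobounded]
      refine tendsto_atTop_mono (f := fun x' : ℝ => x' - ‖ρ‖) (fun x' => ?_)
        (tendsto_atTop_add_const_right _ _ tendsto_id)
      refine le_trans ?_ (norm_sub_norm_le _ _)
      rw [Complex.norm_real]
      gcongr
      exact Real.le_norm_self x'
    simpa using this
  have l2 : Tendsto (fun x' : ℝ => C / x') atTop (𝓝 0) := tendsto_const_nhds.div_atTop tendsto_id
  obtain ⟨x', ⟨⟨⟨h1, h2⟩, h3⟩, h4⟩, h5⟩ :=
    ((((l1.eventually (Metric.ball_mem_nhds 0 (show 0 < ε / 4 by linarith))).and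
    (l2.eventually (gt_mem_nhds (show 0 < ε / 4 by linarith)))).and
    (eventually_ge_atTop (4 * B))).and (eventually_ge_atTop 1)).and (eventually_ge_atTop a)
    |>.exists
  rw [dist_zero_right, Real.norm_eq_abs] at h1
  have him : |(logDeriv ξ x').im| < ε / 4 := by
    have k1 := ht.asymmetry (x' : ℂ) (by simpa using h5)
    rw [Complex.conj_ofReal, Complex.ofReal_re] at k1
    have k2 := (Complex.abs_im_le_norm _).trans k1
    have k3 : (logDeriv ξ x' - (starRingEnd ℂ) (logDeriv ξ x')).im = 2 * (logDeriv ξ x').im := by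
      rw [Complex.sub_im, Complex.conj_im]; ring
    rw [k3, abs_mul, abs_two] at k2
    linarith [abs_nonneg (logDeriv ξ x').im]
  have hξx : ξ x ≠ 0 := h.ne_zero_of_lt_re (by rw [Complex.ofReal_re]; linarith)
  have hξx' : ξ x' ≠ 0 := h.ne_zero_of_lt_re (by rw [Complex.ofReal_re]; linarith)
  have l3 := (Complex.continuous_im.tendsto _).comp (h.tendsto_sum_kernel hξx hξx')
  obtain ⟨U₀, hU₀⟩ := (Metric.tendsto_atTop.1 l3) (ε / 4) (by linarith)
  refine ⟨max U₀ T, fun U hU => ?_⟩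
  have k1 := hU₀ U ((le_max_left _ _).trans hU.le)
  have k2 := hT U ((le_max_right _ _).trans hU.le) x' h3 h4
  rw [Function.comp_apply, Complex.im_sum, Real.dist_eq, Complex.sub_im] at k1
  have e : ∀ ρ : ℂ, ((analyticOrderNatAt ξ ρ : ℂ) * (1 / ((x : ℂ) - ρ) - 1 / ((x' : ℂ) - ρ))).im =
      (analyticOrderNatAt ξ ρ : ℝ) * (1 / ((x : ℂ) - ρ)).im -
      (analyticOrderNatAt ξ ρ : ℝ) * (1 / ((x' : ℂ) - ρ)).im := fun ρ => by
    rw [← Complex.ofReal_natCast, Complex.im_ofReal_mul, Complex.sub_im, mul_sub]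
  simp_rw [e] at k1
  rw [Finset.sum_sub_distrib] at k1
  rw [Real.dist_eq]
  have k3 := abs_lt.1 k1
  have k4 := abs_le.1 k2
  have k5 := abs_lt.1 h1
  have k6 := abs_lt.1 him
  rw [abs_lt]
  constructor <;> linarith

/-- The zeros with `|Im ρ| ≤ T` are permuted by `ρ ↦ σ - conj ρ`, so the real part of the sum is
half of the real part of the sum of `1 / (x - ρ) - 1 / (σ - x - ρ)`. -/
theorem tendsto_sum_re (h : IsStripFunction σ B ω ξ) {x : ℝ} (hx : ξ x ≠ 0) :
    Tendsto (fun T => ∑ ρ ∈ h.zerosTo T, (analyticOrderNatAt ξ ρ : ℝ) * (1 / ((x : ℂ) - ρ)).re)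
      atTop (𝓝 (logDeriv ξ x).re) := by
  have hx' : ξ (σ - (starRingEnd ℂ) (x : ℂ)) ≠ 0 := fun h0 =>
    hx ((h.map_reflect_eq_zero_iff _).1 h0)
  have l := ((Complex.continuous_re.tendsto _).comp (h.tendsto_sum_kernel hx hx')).div_const 2
  rw [h.logDeriv_reflect, sub_neg_eq_add, Complex.add_re, Complex.conj_re, ← two_mul,
    mul_div_cancel_left₀ _ two_ne_zero] at l
  refine l.congr fun T => ?_
  rw [Function.comp_apply, Complex.re_sum]
  have e : ∀ ρ : ℂ, ((analyticOrderNatAt ξ ρ : ℂ) *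
      (1 / ((x : ℂ) - ρ) - 1 / ((σ - (starRingEnd ℂ) (x : ℂ)) - ρ))).re =
      (analyticOrderNatAt ξ ρ : ℝ) * (1 / ((x : ℂ) - ρ)).re +
      (analyticOrderNatAt ξ (σ - (starRingEnd ℂ) ρ) : ℝ) *
        (1 / ((x : ℂ) - (σ - (starRingEnd ℂ) ρ))).re := fun ρ => by
    have e2 : (1 / ((x : ℂ) - (σ - (starRingEnd ℂ) ρ))) =
        -(starRingEnd ℂ) (1 / ((σ - (starRingEnd ℂ) (x : ℂ)) - ρ)) := by
      simp only [map_div₀, map_one, map_sub, Complex.conj_ofReal]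
      rw [← div_neg]
      congr 1
      ring
    rw [h.analyticOrderNatAt_reflect, e2, Complex.neg_re, Complex.conj_re,
      ← Complex.ofReal_natCast, Complex.re_ofReal_mul, Complex.sub_re]
    ring
  simp_rw [e]
  rw [Finset.sum_add_distrib]
  have e3 : ∑ ρ ∈ h.zerosTo T, (analyticOrderNatAt ξ (σ - (starRingEnd ℂ) ρ) : ℝ) *
        (1 / ((x : ℂ) - (σ - (starRingEnd ℂ) ρ))).re =
      ∑ ρ ∈ h.zerosTo T, (analyticOrderNatAt ξ ρ : ℝ) * (1 / ((x : ℂ) - ρ)).re := by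
    have hmem : ∀ ρ ∈ h.zerosTo T, (σ : ℂ) - (starRingEnd ℂ) ρ ∈ h.zerosTo T := fun ρ hρ => by
      rw [mem_zerosTo] at hρ ⊢
      refine ⟨(h.map_reflect_eq_zero_iff ρ).2 hρ.1, ?_⟩
      simpa using hρ.2
    have hinv : ∀ ρ ∈ h.zerosTo T,
        (σ : ℂ) - (starRingEnd ℂ) ((σ : ℂ) - (starRingEnd ℂ) ρ) = ρ := fun ρ _ => by simp
    exact Finset.sum_bij' (fun ρ _ => (σ : ℂ) - (starRingEnd ℂ) ρ)
      (fun ρ _ => (σ : ℂ) - (starRingEnd ℂ) ρ) hmem hmem hinv hinv fun _ _ => rfl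
  rw [e3, ← two_mul, mul_div_cancel_left₀ _ two_ne_zero]

/-- The logarithmic derivative is the symmetric sum of `1 / (s - ρ)` over the zeros. -/
theorem tendsto_sum_one_div (h : IsStripFunction σ B ω ξ) {a C : ℝ} (ht : HasTameLogDeriv ξ a C)
    {s : ℂ} (hs : ξ s ≠ 0) :
    Tendsto (fun T => ∑ ρ ∈ h.zerosTo T, (analyticOrderNatAt ξ ρ : ℂ) * (1 / (s - ρ))) atTop
      (𝓝 (logDeriv ξ s)) := by
  have hB := h.B_pos
  set x : ℝ := 4 * B with hxdef
  have hx : ξ x ≠ 0 := h.ne_zero_of_lt_re (by rw [Complex.ofReal_re]; linarith)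
  have l1 : Tendsto (fun T => ∑ ρ ∈ h.zerosTo T,
      (analyticOrderNatAt ξ ρ : ℂ) * (1 / ((x : ℂ) - ρ))) atTop (𝓝 (logDeriv ξ x)) := by
    have l2 := ((Complex.continuous_ofReal.tendsto _).comp (h.tendsto_sum_re hx)).add
      (((Complex.continuous_ofReal.tendsto _).comp (h.tendsto_sum_im ht hxdef.ge)).mul_const
        Complex.I)
    rw [Complex.re_add_im] at l2
    refine l2.congr fun T => ?_
    simp only [Function.comp_apply]
    apply Complex.ext <;> simp [Complex.re_sum, Complex.im_sum]
  have l3 := (h.tendsto_sum_kernel hs hx).add l1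
  rw [sub_add_cancel] at l3
  refine l3.congr fun T => ?_
  rw [← Finset.sum_add_distrib]
  exact Finset.sum_congr rfl fun ρ _ => by ring

end IsStripFunction

/-! ### Power sums over the zeros and the limit defining the coefficients -/

namespace IsStripFunction

variable {σ B : ℝ} {ω : ℂ} {ξ : ℂ → ℂ}

/-- The power sums over the zeros are the Taylor coefficients of the logarithmic derivative. -/
theorem hasSum_pow (h : IsStripFunction σ B ω ξ) (k : ℕ) {s : ℂ} (hs : ξ s ≠ 0) :
    HasSum (fun ρ : ℂ => (analyticOrderNatAt ξ ρ : ℂ) * (1 / (s - ρ)) ^ (k + 2))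
      ((-1) ^ (k + 1) * iteratedDeriv (k + 1) (logDeriv ξ) s / ((k + 1).factorial : ℂ)) := by
  -- every term may be differentiated, being dominated near `s` by `1 / (1 + γ ^ 2)`
  have dom : ∀ s : ℂ, ξ s ≠ 0 → ∃ δ c : ℝ, 0 < δ ∧ 0 < c ∧ ∀ ρ, ξ ρ = 0 →
      ∀ w ∈ Metric.ball s δ, δ ≤ ‖w - ρ‖ ∧ 1 + ρ.im ^ 2 ≤ c * ‖s - ρ‖ ^ 2 ∧
        ‖s - ρ‖ ≤ 2 * ‖w - ρ‖ := by
    intro s hs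
    obtain ⟨c, hc, hcρ⟩ := h.exists_one_add_im_sq_le hs
    obtain ⟨δ, hδ, hball⟩ := Metric.eventually_nhds_iff.1
      (h.differentiable.continuous.continuousAt.eventually_ne hs)
    refine ⟨δ / 2, c, by positivity, hc, fun ρ hρ w hw => ?_⟩
    have h1 : δ ≤ ‖s - ρ‖ := by
      by_contra hlt
      exact hball (by rw [dist_comm, dist_eq_norm]; exact not_le.1 hlt) hρ
    rw [mem_ball_iff_norm'] at hw
    have h2 : ‖s - ρ‖ ≤ ‖s - w‖ + ‖w - ρ‖ := by
      simpa using norm_add_le (s - w) (w - ρ)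
    exact ⟨by linarith, hcρ ρ hρ, by linarith⟩
  have hdiff : ∀ (s ρ : ℂ) (j : ℕ), s - ρ ≠ 0 →
      HasDerivAt (fun w : ℂ => (1 / (w - ρ)) ^ j) (-(j : ℂ) * (1 / (s - ρ)) ^ (j + 1)) s := by
    intro s ρ j hsρ
    have h1 : HasDerivAt (fun w : ℂ => 1 / (w - ρ)) (-(1 / (s - ρ)) ^ 2) s := by
      have h0 : HasDerivAt (fun w : ℂ => w - ρ) 1 s := (hasDerivAt_id s).sub_const ρ
      simp only [one_div]
      exact (h0.fun_inv hsρ).congr_deriv (by field_simp)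
    refine (h1.fun_pow j).congr_deriv ?_
    rcases j with _ | j
    · simp
    · push_cast [Nat.add_sub_cancel]
      ring
  have hne : ∀ s : ℂ, ξ s ≠ 0 → ∀ᶠ w in 𝓝 s, ξ w ≠ 0 := fun s hs =>
    h.differentiable.continuous.continuousAt.eventually_ne hs
  have hmul : ∀ (j : ℕ) (s ρ : ℂ), ξ s ≠ 0 →
      deriv (fun w : ℂ => (analyticOrderNatAt ξ ρ : ℂ) * (1 / (w - ρ)) ^ j) s =
        (analyticOrderNatAt ξ ρ : ℂ) * (-(j : ℂ) * (1 / (s - ρ)) ^ (j + 1)) := by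
    intro j s ρ hs
    by_cases hρ : ξ ρ = 0
    · exact ((hdiff s ρ j (ne_of_zero hs hρ)).const_mul _).deriv
    · simp [order_eq_zero hρ]
  have hdon : ∀ (j : ℕ) (ρ : ℂ) (U : Set ℂ), (∀ w ∈ U, ξ ρ = 0 → w - ρ ≠ 0) →
      DifferentiableOn ℂ (fun w : ℂ => (analyticOrderNatAt ξ ρ : ℂ) * (1 / (w - ρ)) ^ j) U := by
    intro j ρ U hU w hw
    by_cases hρ : ξ ρ = 0
    · exact ((hdiff w ρ j (hU w hw hρ)).const_mul _).differentiableAt.differentiableWithinAt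
    · simp only [order_eq_zero hρ, Nat.cast_zero, zero_mul]
      exact differentiableWithinAt_const _
  induction k generalizing s with
  | zero =>
    obtain ⟨δ, c, hδ, hc, hdom⟩ := dom s hs
    have hnb : ∀ ρ, ∀ w ∈ Metric.ball s δ, ξ ρ = 0 → w - ρ ≠ 0 := fun ρ w hw hρ =>
      norm_pos_iff.1 (hδ.trans_le (hdom ρ hρ w hw).1)
    have hw0 : ∀ w ∈ Metric.ball s δ, ξ w ≠ 0 := fun w hw h0 => hnb w w hw h0 (sub_self w)
    have key := Complex.hasSum_deriv_of_summable_norm (U := Metric.ball s δ) (z := s)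
      (F := fun ρ w => (analyticOrderNatAt ξ ρ : ℂ) * (1 / (w - ρ) - 1 / (s - ρ)))
      (h.summable_order_div.mul_left (δ * (2 * c))) ?_ Metric.isOpen_ball ?_
      (Metric.mem_ball_self hδ)
    · have e1 : deriv (fun w => ∑' ρ, (analyticOrderNatAt ξ ρ : ℂ) * (1 / (w - ρ) - 1 / (s - ρ))) s
          = deriv (logDeriv ξ) s := by
        have : (fun w => ∑' ρ, (analyticOrderNatAt ξ ρ : ℂ) * (1 / (w - ρ) - 1 / (s - ρ)))
            =ᶠ[𝓝 s] fun w => logDeriv ξ w - logDeriv ξ s := by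
          filter_upwards [hne s hs] with w hw using (h.hasSum_kernel hw hs).tsum_eq
        rw [this.deriv_eq, deriv_sub_const]
      rw [e1] at key
      have key2 := key.neg
      have e2 : (fun ρ : ℂ => (analyticOrderNatAt ξ ρ : ℂ) * (1 / (s - ρ)) ^ (0 + 2)) = fun ρ =>
          -deriv (fun w => (analyticOrderNatAt ξ ρ : ℂ) * (1 / (w - ρ) - 1 / (s - ρ))) s := by
        funext ρ
        have e3 : (fun w => (analyticOrderNatAt ξ ρ : ℂ) * (1 / (w - ρ) - 1 / (s - ρ))) =
            fun w => (analyticOrderNatAt ξ ρ : ℂ) * (1 / (w - ρ)) ^ 1 -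
              (analyticOrderNatAt ξ ρ : ℂ) * (1 / (s - ρ)) := by funext w; ring
        rw [e3, deriv_sub_const, hmul 1 s ρ hs]
        push_cast
        ring
      rw [e2]
      have e4 : (-1) ^ (0 + 1) * iteratedDeriv (0 + 1) (logDeriv ξ) s / ((0 + 1).factorial : ℂ) =
          -deriv (logDeriv ξ) s := by simp
      rw [e4]
      exact key2
    · intro ρ
      have := (hdon 1 ρ (Metric.ball s δ) (hnb ρ)).sub_const
        ((analyticOrderNatAt ξ ρ : ℂ) * (1 / (s - ρ)))
      refine this.congr fun w _ => ?_
      ring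
    · intro ρ w hw
      by_cases hρ : ξ ρ = 0
      · obtain ⟨d1, d2, d3⟩ := hdom ρ hρ w hw
        have n1 := hnb ρ w hw hρ
        have n2 := ne_of_zero hs hρ
        have p1 := norm_pos_iff.2 n1
        have p2 := norm_pos_iff.2 n2
        rw [mem_ball_iff_norm'] at hw
        rw [norm_mul, Complex.norm_natCast, div_sub_div _ _ n1 n2, norm_div, norm_mul,
          show 1 * (s - ρ) - (w - ρ) * 1 = s - w by ring, mul_left_comm]
        gcongr
        rw [mul_one_div, div_le_div_iff₀ (by positivity) (by positivity)]
        have e0 : 0 < 1 + ρ.im ^ 2 := by positivity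
        calc ‖s - w‖ * (1 + ρ.im ^ 2) ≤ δ * (c * ‖s - ρ‖ ^ 2) := by gcongr
          _ = δ * c * (‖s - ρ‖ * ‖s - ρ‖) := by ring
          _ ≤ δ * c * ((2 * ‖w - ρ‖) * ‖s - ρ‖) := by gcongr
          _ = _ := by ring
      · simp [order_eq_zero hρ]
  | succ k ih =>
    obtain ⟨δ, c, hδ, hc, hdom⟩ := dom s hs
    have hnb : ∀ ρ, ∀ w ∈ Metric.ball s δ, ξ ρ = 0 → w - ρ ≠ 0 := fun ρ w hw hρ =>
      norm_pos_iff.1 (hδ.trans_le (hdom ρ hρ w hw).1)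
    have key := Complex.hasSum_deriv_of_summable_norm (U := Metric.ball s δ) (z := s)
      (F := fun ρ w => (analyticOrderNatAt ξ ρ : ℂ) * (1 / (w - ρ)) ^ (k + 2))
      (h.summable_order_div.mul_left ((1 / δ) ^ k * (4 * c))) (fun ρ => hdon _ ρ _ (hnb ρ))
      Metric.isOpen_ball ?_ (Metric.mem_ball_self hδ)
    · have e1 : deriv (fun w => ∑' ρ, (analyticOrderNatAt ξ ρ : ℂ) * (1 / (w - ρ)) ^ (k + 2)) s
          = (-1) ^ (k + 1) * iteratedDeriv (k + 2) (logDeriv ξ) s / ((k + 1).factorial : ℂ) := by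
        have : (fun w => ∑' ρ, (analyticOrderNatAt ξ ρ : ℂ) * (1 / (w - ρ)) ^ (k + 2))
            =ᶠ[𝓝 s] fun w => (-1) ^ (k + 1) / ((k + 1).factorial : ℂ) *
              iteratedDeriv (k + 1) (logDeriv ξ) w := by
          filter_upwards [hne s hs] with w hw
          rw [(ih hw).tsum_eq]
          ring
        rw [this.deriv_eq, deriv_const_mul_field, ← iteratedDeriv_succ]
        ring
      rw [e1] at key
      simp_rw [hmul (k + 2) s _ hs] at key
      have hk : ((k : ℂ) + 2) ≠ 0 := by exact_mod_cast Nat.succ_ne_zero (k + 1)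
      have key2 := key.mul_left (-1 / ((k : ℂ) + 2))
      have hf : (((k + 1 + 1).factorial : ℕ) : ℂ) = ((k : ℂ) + 2) * ((k + 1).factorial : ℂ) := by
        rw [Nat.factorial_succ]; push_cast; ring
      have hf0 : (((k + 1).factorial : ℕ) : ℂ) ≠ 0 := by exact_mod_cast Nat.factorial_ne_zero _
      have e2 : (fun ρ : ℂ => (analyticOrderNatAt ξ ρ : ℂ) * (1 / (s - ρ)) ^ (k + 1 + 2)) =
          fun ρ => -1 / ((k : ℂ) + 2) * ((analyticOrderNatAt ξ ρ : ℂ) *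
            (-((k + 2 : ℕ) : ℂ) * (1 / (s - ρ)) ^ (k + 2 + 1))) := by
        funext ρ
        push_cast
        field_simp
      have e3 : (-1) ^ (k + 1 + 1) * iteratedDeriv (k + 1 + 1) (logDeriv ξ) s /
          ((k + 1 + 1).factorial : ℂ) = -1 / ((k : ℂ) + 2) *
          ((-1) ^ (k + 1) * iteratedDeriv (k + 2) (logDeriv ξ) s / ((k + 1).factorial : ℂ)) := by
        rw [hf]
        field_simp
        ring
      rw [e2, e3]
      exact key2
    · intro ρ w hw
      by_cases hρ : ξ ρ = 0
      · obtain ⟨d1, d2, d3⟩ := hdom ρ hρ w hw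
        have p1 := norm_pos_iff.2 (hnb ρ w hw hρ)
        have p2 := norm_pos_iff.2 (ne_of_zero hs hρ)
        rw [norm_mul, Complex.norm_natCast, norm_pow, norm_div, norm_one, pow_add]
        have q1 : (1 / ‖w - ρ‖) ^ k ≤ (1 / δ) ^ k := by gcongr
        have q2 : (1 / ‖w - ρ‖) ^ 2 ≤ 4 * c * (1 / (1 + ρ.im ^ 2)) := ?_
        · calc (analyticOrderNatAt ξ ρ : ℝ) * ((1 / ‖w - ρ‖) ^ k * (1 / ‖w - ρ‖) ^ 2)
              ≤ (analyticOrderNatAt ξ ρ : ℝ) * ((1 / δ) ^ k * (4 * c * (1 / (1 + ρ.im ^ 2)))) := by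
                gcongr
            _ = _ := by ring
        · rw [mul_one_div, one_div, inv_pow, ← one_div,
            div_le_div_iff₀ (by positivity) (by positivity)]
          calc 1 * (1 + ρ.im ^ 2) ≤ c * ‖s - ρ‖ ^ 2 := by rw [one_mul]; exact d2
            _ ≤ c * (2 * ‖w - ρ‖) ^ 2 := by gcongr
            _ = _ := by ring
      · simp [order_eq_zero hρ]

/-- The sum of `1 - (ρ / (ρ - s)) ^ (n + 1)` over the zeros, by increasing height. Since
`ρ / (ρ - s) = 1 - s / (s - ρ)`, the binomial theorem reduces it to the power sums of `1 / (s - ρ)`;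
only the first of these converges conditionally. -/
theorem tendsto_sum_one_sub_pow (h : IsStripFunction σ B ω ξ) {a C : ℝ} (ht : HasTameLogDeriv ξ a C)
    {s : ℂ} (hs : ξ s ≠ 0) (n : ℕ) :
    Tendsto (fun T => ∑ ρ ∈ h.zerosTo T,
      (analyticOrderNatAt ξ ρ : ℂ) * (1 - (ρ / (ρ - s)) ^ (n + 1))) atTop
      (𝓝 (∑ j ∈ Finset.range (n + 1), ((n + 1).choose (j + 1) : ℂ) * s ^ (j + 1) *
        (iteratedDeriv j (logDeriv ξ) s / (j.factorial : ℂ)))) := by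
  have hp : ∀ j : ℕ, Tendsto (fun T => ∑ ρ ∈ h.zerosTo T,
      (analyticOrderNatAt ξ ρ : ℂ) * (1 / (s - ρ)) ^ (j + 1)) atTop
      (𝓝 ((-1) ^ j * iteratedDeriv j (logDeriv ξ) s / (j.factorial : ℂ))) := by
    intro j
    rcases j with _ | j
    · simpa using h.tendsto_sum_one_div ht hs
    · exact h.tendsto_sum_zerosTo (h.hasSum_pow j hs) fun ρ hρ => by simp [order_eq_zero hρ]
  have l := tendsto_finsetSum (Finset.range (n + 1)) fun j _ =>
    (hp j).const_mul (((n + 1).choose (j + 1) : ℂ) * s ^ (j + 1) * (-1) ^ j)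
  have e1 : ∀ j : ℕ, ((n + 1).choose (j + 1) : ℂ) * s ^ (j + 1) * (-1) ^ j *
      ((-1) ^ j * iteratedDeriv j (logDeriv ξ) s / (j.factorial : ℂ)) =
      ((n + 1).choose (j + 1) : ℂ) * s ^ (j + 1) *
        (iteratedDeriv j (logDeriv ξ) s / (j.factorial : ℂ)) := fun j => by
    have : ((-1 : ℂ) ^ j) * (-1) ^ j = 1 := by rw [← mul_pow]; simp
    linear_combination ((n + 1).choose (j + 1) : ℂ) * s ^ (j + 1) *
        (iteratedDeriv j (logDeriv ξ) s / (j.factorial : ℂ)) * this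
  simp_rw [e1] at l
  refine l.congr fun T => ?_
  simp_rw [Finset.mul_sum]
  rw [Finset.sum_comm]
  refine Finset.sum_congr rfl fun ρ hρ => ?_
  have h1 : s - ρ ≠ 0 := ne_of_zero hs (h.mem_zerosTo.1 hρ).1
  have h2 : ρ / (ρ - s) = -(s * (1 / (s - ρ))) + 1 := by
    rw [← neg_sub s ρ, div_neg]
    field_simp
    ring
  rw [h2, add_pow, Finset.sum_range_succ' _ (n + 1)]
  simp only [one_pow, mul_one, pow_zero, Nat.choose_zero_right, Nat.cast_one,
    sub_add_cancel_right, mul_neg, Finset.mul_sum]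
  rw [← Finset.sum_neg_distrib]
  refine Finset.sum_congr rfl fun j _ => ?_
  rw [neg_pow (s * (1 / (s - ρ))), mul_pow]
  ring

theorem tauLiPartial_eq (h : IsStripFunction σ B ω ξ) (n : ℕ) (τ T : ℝ) :
    tauLiPartial ξ n τ T = ∑ ρ ∈ h.zerosTo T,
      (analyticOrderNatAt ξ ρ : ℂ) * (1 - (ρ / (ρ - (τ : ℂ))) ^ n) := by
  rw [tauLiPartial, finsum_mem_eq_finite_toFinset_sum _ (h.finite_zerosUpTo T), zerosTo]

end IsStripFunction

/-! ### Branches of the logarithm and the change of variable `s = 1 / (1 - w)` -/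

theorem exists_isLogBranchAt {f : ℂ → ℂ} {z : ℂ} (hf : AnalyticAt ℂ f z) (hz : f z ≠ 0) :
    ∃ ℓ, IsLogBranchAt f ℓ z := by
  refine ⟨fun w => Complex.log (f w / f z) + Complex.log (f z), ?_, ?_⟩
  · refine (AnalyticAt.clog (hf.div analyticAt_const hz) ?_).add analyticAt_const
    simp [div_self hz]
  · filter_upwards [hf.continuousAt.eventually_ne hz] with w hw
    rw [Complex.exp_add, Complex.exp_log (div_ne_zero hw hz), Complex.exp_log hz,
      div_mul_cancel₀ _ hz]

theorem IsLogBranchAt.deriv_eventuallyEq {f ℓ : ℂ → ℂ} {z : ℂ} (h : IsLogBranchAt f ℓ z) :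
    deriv ℓ =ᶠ[𝓝 z] logDeriv f := by
  filter_upwards [h.1.eventually_analyticAt, h.2.eventually_nhds] with w hw hfw
  have h1 : HasDerivAt f (Complex.exp (ℓ w) * deriv ℓ w) w :=
    hw.differentiableAt.hasDerivAt.cexp.congr_of_eventuallyEq (hfw.mono fun _ hu => hu.symm)
  rw [logDeriv_apply, h1.deriv, ← hfw.self_of_nhds, mul_div_cancel_left₀ _ (Complex.exp_ne_zero _)]

theorem IsLogBranchAt.iteratedDeriv_succ {f ℓ : ℂ → ℂ} {z : ℂ} (h : IsLogBranchAt f ℓ z) (j : ℕ) :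
    iteratedDeriv (j + 1) ℓ z = iteratedDeriv j (logDeriv f) z := by
  rw [iteratedDeriv_succ']
  exact h.deriv_eventuallyEq.iteratedDeriv_eq j

/-- The Leibniz rule; the term without a derivative of `ℓ` vanishes, as `w ^ n` has degree `n`. -/
theorem IsLogBranchAt.mul_iteratedDeriv {f ℓ : ℂ → ℂ} {z : ℂ} (h : IsLogBranchAt f ℓ z) (n : ℕ) :
    z / (n.factorial : ℂ) * iteratedDeriv (n + 1) (fun w : ℂ => w ^ n * ℓ w) z =
      ∑ j ∈ Finset.range (n + 1), ((n + 1).choose (j + 1) : ℂ) * z ^ (j + 1) *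
        (iteratedDeriv j (logDeriv f) z / (j.factorial : ℂ)) := by
  rw [iteratedDeriv_fun_mul (f := fun w : ℂ => w ^ n) (contDiff_id.pow n).contDiffAt
    h.1.contDiffAt, Finset.sum_range_succ, iteratedDeriv_pow,
    Nat.descFactorial_of_lt (Nat.lt_succ_self n)]
  rw [Nat.cast_zero, zero_mul, mul_zero, zero_mul, add_zero, ← Finset.sum_range_reflect,
    Finset.mul_sum]
  refine Finset.sum_congr rfl fun j hj => ?_
  have hjn : j ≤ n := Nat.lt_succ_iff.1 (Finset.mem_range.1 hj)
  have e1 : n + 1 - 1 - j = n - j := by omega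
  have e2 : n + 1 - (n - j) = j + 1 := by omega
  have e3 : n - (n - j) = j := by omega
  have e4 : (n + 1).choose (n - j) = (n + 1).choose (j + 1) :=
    Nat.choose_symm_of_eq_add (by omega)
  have e5 : j.factorial * n.descFactorial (n - j) = n.factorial := by
    have := Nat.factorial_mul_descFactorial (Nat.sub_le n j)
    rwa [e3] at this
  have e6 : (j.factorial : ℂ) * (n.descFactorial (n - j) : ℂ) = (n.factorial : ℂ) := by
    exact_mod_cast e5
  have hj0 : (j.factorial : ℂ) ≠ 0 := by exact_mod_cast j.factorial_ne_zero
  have hn0 : (n.factorial : ℂ) ≠ 0 := by exact_mod_cast n.factorial_ne_zero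
  rw [e1, e2, e4, iteratedDeriv_pow, e3, h.iteratedDeriv_succ]
  field_simp
  rw [← e6]
  ring

theorem analyticAt_iteratedDeriv {f : ℂ → ℂ} {z : ℂ} (hf : AnalyticAt ℂ f z) (n : ℕ) :
    AnalyticAt ℂ (iteratedDeriv n f) z := by
  rw [iteratedDeriv_eq_iterate]
  exact hf.iterated_deriv n

theorem iteratedDeriv_succ_id_mul {g : ℂ → ℂ} {z : ℂ} (hg : AnalyticAt ℂ g z) (n : ℕ) :
    iteratedDeriv (n + 1) (fun w => w * g w) z =
      z * iteratedDeriv (n + 1) g z + (n + 1) * iteratedDeriv n g z := by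
  induction n generalizing z with
  | zero =>
    simp only [zero_add, iteratedDeriv_one, iteratedDeriv_zero, Nat.cast_zero, one_mul]
    have := (hasDerivAt_id z).mul hg.differentiableAt.hasDerivAt
    rw [show (fun w => w * g w) = id * g from rfl, this.deriv, id_eq]
    ring
  | succ n ih =>
    have h1 : iteratedDeriv (n + 1) (fun w => w * g w) =ᶠ[𝓝 z]
        fun w => w * iteratedDeriv (n + 1) g w + (n + 1) * iteratedDeriv n g w := by
      filter_upwards [hg.eventually_analyticAt] with w hw using ih hw
    have h2 := (analyticAt_iteratedDeriv hg (n + 1)).differentiableAt.hasDerivAt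
    have h3 := (analyticAt_iteratedDeriv hg n).differentiableAt.hasDerivAt
    rw [← iteratedDeriv_succ] at h2 h3
    have h4 := ((hasDerivAt_id z).mul h2).add (h3.const_mul ((n : ℂ) + 1))
    rw [_root_.iteratedDeriv_succ, h1.deriv_eq]
    refine h4.deriv.trans ?_
    push_cast
    simp only [id_eq]
    ring

theorem hasDerivAt_one_div_one_sub {w : ℂ} (hw : 1 - w ≠ 0) :
    HasDerivAt (fun w : ℂ => 1 / (1 - w)) ((1 / (1 - w)) ^ 2) w := by
  have h0 : HasDerivAt (fun w : ℂ => 1 - w) (-1) w := (hasDerivAt_id w).const_sub 1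
  simp only [one_div]
  exact (h0.fun_inv hw).congr_deriv (by simp)

/-- Under `s = 1 / (1 - w)` the derivative `d/dw` becomes `s ^ 2 d/ds`, and the power
`(s ^ 2 d/ds) ^ (n + 1)` is `s ^ (n + 2) (d/ds) ^ (n + 1) s ^ n`. -/
theorem iteratedDeriv_comp_one_div {g : ℂ → ℂ} (n : ℕ) {w : ℂ} (hw : 1 - w ≠ 0)
    (hg : AnalyticAt ℂ g (1 / (1 - w))) :
    iteratedDeriv (n + 1) (fun u => g (1 / (1 - u))) w =
      (1 / (1 - w)) ^ (n + 2) *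
        iteratedDeriv (n + 1) (fun s => s ^ n * g s) (1 / (1 - w)) := by
  induction n generalizing w with
  | zero =>
    simp only [zero_add, iteratedDeriv_one, pow_zero, one_mul]
    have := hg.differentiableAt.hasDerivAt.comp w (hasDerivAt_one_div_one_sub hw)
    rw [mul_comm]
    exact this.deriv
  | succ n ih =>
    set G : ℂ → ℂ := fun s => s ^ n * g s with hG
    have hGa : AnalyticAt ℂ G (1 / (1 - w)) := (analyticAt_id.pow n).mul hg
    have hc := (hasDerivAt_one_div_one_sub hw).continuousAt
    have h1 : iteratedDeriv (n + 1) (fun u => g (1 / (1 - u))) =ᶠ[𝓝 w] fun u =>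
        (fun s => s ^ (n + 2) * iteratedDeriv (n + 1) G s) (1 / (1 - u)) := by
      have hne : ∀ᶠ u in 𝓝 w, 1 - u ≠ 0 :=
        ContinuousAt.eventually_ne (g := fun u : ℂ => 1 - u) (by fun_prop) hw
      filter_upwards [hne, hc.eventually hg.eventually_analyticAt] with u hu hgu using ih hu hgu
    have h2 := (analyticAt_iteratedDeriv hGa (n + 1)).differentiableAt.hasDerivAt
    rw [← iteratedDeriv_succ] at h2
    have h3 := (((hasDerivAt_pow (n + 2) (1 / (1 - w))).mul h2).comp w
      (hasDerivAt_one_div_one_sub hw))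
    have e : (fun s : ℂ => s ^ (n + 1) * g s) = fun s => s * G s := by
      funext s; rw [hG]; ring
    rw [iteratedDeriv_succ, h1.deriv_eq, e, iteratedDeriv_succ_id_mul hGa]
    refine h3.deriv.trans ?_
    push_cast
    ring

theorem one_div_one_sub {τ : ℂ} (hτ : τ ≠ 0) :
    1 - (1 - 1 / τ) ≠ 0 ∧ 1 / (1 - (1 - 1 / τ)) = τ := by
  rw [sub_sub_cancel]
  exact ⟨one_div_ne_zero hτ, one_div_one_div τ⟩

theorem analyticAt_logDerivTransform {f : ℂ → ℂ} {τ : ℂ} (hf : AnalyticAt ℂ f τ) (hτ : τ ≠ 0)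
    (hfτ : f τ ≠ 0) : AnalyticAt ℂ (logDerivTransform f) (1 - 1 / τ) := by
  obtain ⟨h1, h2⟩ := one_div_one_sub hτ
  have h3 : AnalyticAt ℂ (fun w : ℂ => 1 / (1 - w)) (1 - 1 / τ) :=
    analyticAt_const.div (analyticAt_const.sub analyticAt_id) h1
  have h4 : AnalyticAt ℂ (fun w : ℂ => f (1 / (1 - w))) (1 - 1 / τ) :=
    AnalyticAt.comp (g := f) (f := fun w : ℂ => 1 / (1 - w)) (by rwa [h2]) h3
  exact h4.deriv.div h4 (by rwa [h2])

theorem eventually_hasSum_dCoeff {f : ℂ → ℂ} {z : ℂ} (hf : AnalyticAt ℂ (logDerivTransform f) z) :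
    ∀ᶠ w in 𝓝 z, HasSum (fun k : ℕ => dCoeff f k z * (w - z) ^ k) (logDerivTransform f w) := by
  filter_upwards [hf.hasFPowerSeriesAt.eventually_hasSum_sub] with w hw
  simpa only [FormalMultilinearSeries.ofScalars_apply_eq, smul_eq_mul, dCoeff] using hw

theorem IsLogBranchAt.dCoeff_eq {f ℓ : ℂ → ℂ} {τ : ℂ} (h : IsLogBranchAt f ℓ τ) (hτ : τ ≠ 0)
    (n : ℕ) :
    1 / τ ^ (n + 1) * dCoeff f n (1 - 1 / τ) =
      τ / (n.factorial : ℂ) * iteratedDeriv (n + 1) (fun w : ℂ => w ^ n * ℓ w) τ := by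
  obtain ⟨h1, h2⟩ := one_div_one_sub hτ
  have key := iteratedDeriv_comp_one_div (g := ℓ) n h1 (by rw [h2]; exact h.1)
  rw [h2] at key
  have hc : Tendsto (fun w : ℂ => 1 / (1 - w)) (𝓝 (1 - 1 / τ)) (𝓝 τ) := by
    have := (hasDerivAt_one_div_one_sub h1).continuousAt.tendsto
    rwa [h2] at this
  have hbr : IsLogBranchAt (fun w => f (1 / (1 - w))) (fun w => ℓ (1 / (1 - w))) (1 - 1 / τ) := by
    refine ⟨?_, hc.eventually h.2⟩
    exact AnalyticAt.comp (g := ℓ) (f := fun w : ℂ => 1 / (1 - w)) (by rw [h2]; exact h.1)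
      (analyticAt_const.div (analyticAt_const.sub analyticAt_id) h1)
  rw [hbr.iteratedDeriv_succ] at key
  rw [dCoeff, logDerivTransform, key]
  field_simp
  ring

/-! ### Bounds for the gamma function -/

theorem norm_Gamma_le {z : ℂ} (hz : 0 < z.re) : ‖Complex.Gamma z‖ ≤ Real.Gamma z.re := by
  rw [Complex.Gamma_eq_integral hz, Real.Gamma_eq_integral hz, Complex.GammaIntegral]
  refine MeasureTheory.norm_integral_le_of_norm_le (Real.GammaIntegral_convergent hz) ?_
  filter_upwards [MeasureTheory.ae_restrict_mem measurableSet_Ioi] with x hx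
  rw [norm_mul, Complex.norm_real, Real.norm_eq_abs, abs_of_pos (Real.exp_pos _),
    Complex.norm_cpow_eq_rpow_re_of_pos hx, Complex.sub_re, Complex.one_re]

theorem mul_le_add_sq {p L r : ℝ} (hp : 0 < p) : L * r ≤ p * r ^ 2 + L ^ 2 / (4 * p) := by
  have : p * r ^ 2 + L ^ 2 / (4 * p) - L * r = p * (r - L / (2 * p)) ^ 2 := by
    field_simp; ring
  nlinarith [mul_nonneg hp.le (sq_nonneg (r - L / (2 * p)))]

/-- The real gamma function grows slower than every Gaussian. -/
theorem exists_Gamma_le {A : ℝ} (hA : 0 < A) :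
    ∃ C : ℝ, 0 ≤ C ∧ ∀ x : ℝ, 2 ≤ x → Real.Gamma x ≤ C * Real.exp (A * x ^ 2) := by
  set p := A / 8 with hp
  have hp0 : 0 < p := by positivity
  set L := |Real.log p| with hL
  refine ⟨Real.exp (L ^ 2 / (4 * p)), (Real.exp_pos _).le, fun x hx => ?_⟩
  set N := ⌈x⌉₊ with hN
  have h1 : x ≤ N := Nat.le_ceil x
  have h2 : (N : ℝ) ≤ 2 * x := by linarith [Nat.ceil_lt_add_one (show 0 ≤ x by linarith)]
  have hN0 : 0 < (N : ℝ) := by linarith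
  have h3 : Real.Gamma x ≤ N.factorial := by
    rw [← Real.Gamma_nat_eq_factorial]
    exact Real.Gamma_strictMonoOn_Ici.monotoneOn hx (Set.mem_Ici.2 (by linarith)) (by linarith)
  have h4 : (N.factorial : ℝ) ≤ (N : ℝ) ^ N := by exact_mod_cast Nat.factorial_le_pow N
  have h5 : Real.log N ≤ p * N + L := by
    have := Real.log_le_sub_one_of_pos (show 0 < p * N by positivity)
    rw [Real.log_mul hp0.ne' hN0.ne'] at this
    linarith [neg_abs_le (Real.log p)]
  have h6 : (N : ℝ) ^ N = Real.exp (N * Real.log N) := by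
    rw [Real.exp_nat_mul, Real.exp_log hN0]
  refine h3.trans (h4.trans ?_)
  rw [h6, ← Real.exp_add]
  gcongr
  have h7 : (N : ℝ) ^ 2 ≤ (2 * x) ^ 2 := by gcongr
  calc N * Real.log N ≤ N * (p * N + L) := by gcongr
    _ = p * N ^ 2 + L * N := by ring
    _ ≤ p * N ^ 2 + (p * N ^ 2 + L ^ 2 / (4 * p)) := by
        gcongr
        exact mul_le_add_sq hp0
    _ ≤ p * (2 * x) ^ 2 + (p * (2 * x) ^ 2 + L ^ 2 / (4 * p)) := by gcongr
    _ = L ^ 2 / (4 * p) + A * x ^ 2 := by rw [hp]; ring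

/-- In a vertical strip, the gamma function is bounded away from the real axis. -/
theorem exists_norm_Gamma_le (N : ℕ) (b : ℝ) :
    ∃ C : ℝ, ∀ w : ℂ, 1 - (N : ℝ) ≤ w.re → w.re ≤ b → 1 ≤ |w.im| → ‖Complex.Gamma w‖ ≤ C := by
  induction N generalizing b with
  | zero =>
    have hc : ContinuousOn Real.Gamma (Set.Icc 1 b) := fun x hx =>
      (Real.differentiableAt_Gamma fun m => by
        have : (0 : ℝ) ≤ m := m.cast_nonneg
        linarith [hx.1]).continuousAt.continuousWithinAt
    obtain ⟨C, hC⟩ := isCompact_Icc.exists_bound_of_continuousOn hc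
    refine ⟨C, fun w h1 h2 _ => ?_⟩
    have h1' : 1 ≤ w.re := by simpa using h1
    exact (norm_Gamma_le (by linarith)).trans ((le_abs_self _).trans (hC _ ⟨h1', h2⟩))
  | succ N ih =>
    obtain ⟨C, hC⟩ := ih (b + 1)
    refine ⟨C, fun w h1 h2 h3 => ?_⟩
    have hw : 1 ≤ ‖w‖ := h3.trans (Complex.abs_im_le_norm w)
    have hw0 : w ≠ 0 := norm_pos_iff.1 (by linarith)
    push_cast at h1
    have h4 := hC (w + 1) (by simp; linarith) (by simp; linarith) (by simpa using h3)
    rw [Complex.Gamma_add_one w hw0, norm_mul] at h4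
    nlinarith [norm_nonneg (Complex.Gamma w)]

/-! ### Growth of order at most two and the Phragmén–Lindelöf principle -/

/-- `g` grows slower than every Gaussian on `S`. -/
def SubGaussianOn (S : Set ℂ) (g : ℂ → ℂ) : Prop :=
  ∀ A > 0, ∃ C : ℝ, 0 ≤ C ∧ ∀ z ∈ S, ‖g z‖ ≤ C * Real.exp (A * ‖z‖ ^ 2)

namespace SubGaussianOn

variable {S : Set ℂ} {g g' : ℂ → ℂ}

theorem mul (h : SubGaussianOn S g) (h' : SubGaussianOn S g') :
    SubGaussianOn S fun z => g z * g' z := by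
  intro A hA
  obtain ⟨C, hC0, hC⟩ := h (A / 2) (by positivity)
  obtain ⟨C', hC0', hC'⟩ := h' (A / 2) (by positivity)
  refine ⟨C * C', by positivity, fun z hz => ?_⟩
  rw [norm_mul]
  calc ‖g z‖ * ‖g' z‖ ≤ (C * Real.exp (A / 2 * ‖z‖ ^ 2)) * (C' * Real.exp (A / 2 * ‖z‖ ^ 2)) := by
        gcongr
        · exact hC z hz
        · exact hC' z hz
    _ = C * C' * (Real.exp (A / 2 * ‖z‖ ^ 2) * Real.exp (A / 2 * ‖z‖ ^ 2)) := by ring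
    _ = _ := by rw [← Real.exp_add]; congr 2; ring

theorem of_norm_le {K k : ℝ} (hg : ∀ z ∈ S, ‖g z‖ ≤ K * Real.exp (k * ‖z‖)) :
    SubGaussianOn S g := by
  intro A hA
  refine ⟨|K| * Real.exp (k ^ 2 / (4 * A)), by positivity, fun z hz => ?_⟩
  rw [mul_assoc, ← Real.exp_add]
  refine (hg z hz).trans ?_
  gcongr
  · exact le_abs_self K
  · rw [add_comm]
    exact mul_le_add_sq hA

theorem prod {ι : Type*} (I : Finset ι) {f : ι → ℂ → ℂ} (h : ∀ i ∈ I, SubGaussianOn S (f i)) :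
    SubGaussianOn S fun z => ∏ i ∈ I, f i z := by
  classical
  induction I using Finset.induction_on with
  | empty => exact of_norm_le (K := 1) (k := 0) fun z _ => by simp
  | insert i I hi ih =>
    simp_rw [Finset.prod_insert hi]
    exact (h i (Finset.mem_insert_self _ _)).mul
      (ih fun j hj => h j (Finset.mem_insert_of_mem hj))

theorem pow (h : SubGaussianOn S g) (n : ℕ) : SubGaussianOn S fun z => g z ^ n := by
  simpa using prod (Finset.range n) (f := fun _ => g) fun _ _ => h

theorem Gamma {l : ℝ} {m : ℂ} (hl : 0 < l) (hS : ∀ z ∈ S, 2 ≤ ((l : ℂ) * z + m).re) :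
    SubGaussianOn S fun z => Complex.Gamma (l * z + m) := by
  intro A hA
  have hA' : 0 < A / (2 * l ^ 2) := by positivity
  obtain ⟨C, hC0, hC⟩ := exists_Gamma_le hA'
  refine ⟨C * Real.exp (A / (2 * l ^ 2) * (2 * ‖m‖ ^ 2)), by positivity, fun z hz => ?_⟩
  have h1 := hS z hz
  refine (norm_Gamma_le (by linarith)).trans ((hC _ h1).trans ?_)
  rw [mul_assoc, ← Real.exp_add]
  gcongr
  have h2 : ((l : ℂ) * z + m).re ≤ l * ‖z‖ + ‖m‖ := by
    refine (Complex.re_le_norm _).trans ((norm_add_le _ _).trans ?_)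
    rw [norm_mul, Complex.norm_real, Real.norm_eq_abs, abs_of_pos hl]
  have h3 : ((l : ℂ) * z + m).re ^ 2 ≤ 2 * ‖m‖ ^ 2 + 2 * l ^ 2 * ‖z‖ ^ 2 := by
    calc ((l : ℂ) * z + m).re ^ 2 ≤ (l * ‖z‖ + ‖m‖) ^ 2 := by gcongr
      _ ≤ _ := by nlinarith [sq_nonneg (l * ‖z‖ - ‖m‖)]
  calc A / (2 * l ^ 2) * ((l : ℂ) * z + m).re ^ 2
      ≤ A / (2 * l ^ 2) * (2 * ‖m‖ ^ 2 + 2 * l ^ 2 * ‖z‖ ^ 2) := by gcongr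
    _ = _ := by field_simp

end SubGaussianOn

theorem norm_sub_le_mul_exp (z s : ℂ) : ‖z - s‖ ≤ (1 + ‖s‖) * Real.exp (1 * ‖z‖) := by
  have h1 := Real.add_one_le_exp ‖z‖
  have h2 := norm_sub_le z s
  have h3 : ‖s‖ ≤ ‖s‖ * Real.exp ‖z‖ :=
    le_mul_of_one_le_right (norm_nonneg _) (by linarith [norm_nonneg z])
  rw [one_mul]
  linarith

theorem norm_ofReal_cpow_le {Q : ℝ} (hQ : 0 < Q) (z : ℂ) :
    ‖(Q : ℂ) ^ z‖ ≤ 1 * Real.exp (|Real.log Q| * ‖z‖) := by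
  rw [Complex.norm_cpow_eq_rpow_re_of_pos hQ, Real.rpow_def_of_pos hQ, one_mul]
  refine Real.exp_le_exp.2 ?_
  refine (le_abs_self _).trans ?_
  rw [abs_mul]
  gcongr
  exact Complex.abs_re_le_norm z

/-- The filter of points of the open vertical strip `a < Re z < b` with `|Im z| → ∞`. -/
def stripEnd (a b : ℝ) : Filter ℂ :=
  comap (abs ∘ Complex.im) atTop ⊓ 𝓟 (Complex.re ⁻¹' Set.Ioo a b)

theorem eventually_stripEnd {a b : ℝ} (H : ℝ) :
    ∀ᶠ z in stripEnd a b, z.re ∈ Set.Ioo a b ∧ H ≤ |z.im| := by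
  refine Filter.Eventually.and ?_ ?_
  · exact (eventually_principal.2 fun z hz => hz).filter_mono inf_le_right
  · exact ((eventually_ge_atTop H).comap (abs ∘ Complex.im)).filter_mono inf_le_left

/-- The growth allowed by the Phragmén–Lindelöf principle in a vertical strip. -/
def DoubleExp (c a b : ℝ) (g : ℂ → ℂ) : Prop :=
  ∃ K : ℝ, g =O[stripEnd a b] fun z => Real.exp (K * Real.exp (c * |z.im|))

namespace DoubleExp

variable {a b c : ℝ} {g g' : ℂ → ℂ}

theorem mul (h : DoubleExp c a b g) (h' : DoubleExp c a b g') :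
    DoubleExp c a b fun z => g z * g' z := by
  obtain ⟨K, hK⟩ := h
  obtain ⟨K', hK'⟩ := h'
  refine ⟨K + K', (hK.mul hK').congr_right fun z => ?_⟩
  rw [← Real.exp_add, add_mul]

theorem of_norm_le (hc : 0 < c) {K k κ : ℝ} (hκ : 0 ≤ κ)
    (hg : ∀ᶠ z in stripEnd a b, ‖g z‖ ≤ K * Real.exp (k * ‖z‖ ^ κ)) : DoubleExp c a b g := by
  have h1 : ∀ᶠ y : ℝ in atTop, y ^ κ ≤ Real.exp (c * y) := by
    filter_upwards [(isLittleO_rpow_exp_pos_mul_atTop κ hc).bound one_pos, eventually_ge_atTop 0]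
      with y hy hy0
    rwa [one_mul, Real.norm_eq_abs, Real.norm_eq_abs, Real.abs_exp,
      abs_of_nonneg (Real.rpow_nonneg hy0 _)] at hy
  obtain ⟨H, hH⟩ := eventually_atTop.1 h1
  refine ⟨|k| * 2 ^ κ, Asymptotics.IsBigO.of_bound K ?_⟩
  filter_upwards [hg, eventually_stripEnd (max H (max |a| |b|))] with z hz hz'
  obtain ⟨⟨h2, h3⟩, h4⟩ := hz'
  have h5 : H ≤ |z.im| := (le_max_left _ _).trans h4
  have h6 : max |a| |b| ≤ |z.im| := (le_max_right _ _).trans h4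
  have h7 : |z.re| ≤ |z.im| := (abs_le_max_abs_abs h2.le h3.le).trans h6
  have h8 : ‖z‖ ≤ 2 * |z.im| := by linarith [Complex.norm_le_abs_re_add_abs_im z]
  have hK : 0 ≤ K := nonneg_of_mul_nonneg_left ((norm_nonneg _).trans hz) (Real.exp_pos _)
  rw [Real.norm_eq_abs, Real.abs_exp]
  refine hz.trans (mul_le_mul_of_nonneg_left (Real.exp_le_exp.2 ?_) hK)
  calc k * ‖z‖ ^ κ ≤ |k| * (2 * |z.im|) ^ κ := by
        gcongr
        exact le_abs_self k
    _ = |k| * 2 ^ κ * |z.im| ^ κ := by rw [Real.mul_rpow (by norm_num) (abs_nonneg _)]; ring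
    _ ≤ _ := by
        gcongr
        exact hH _ h5

theorem of_norm_le_exp (hc : 0 < c) {K k : ℝ}
    (hg : ∀ᶠ z in stripEnd a b, ‖g z‖ ≤ K * Real.exp (k * ‖z‖)) : DoubleExp c a b g :=
  of_norm_le hc (κ := 1) zero_le_one (by simpa using hg)

theorem prod (hc : 0 < c) {ι : Type*} (I : Finset ι) {f : ι → ℂ → ℂ}
    (h : ∀ i ∈ I, DoubleExp c a b (f i)) : DoubleExp c a b fun z => ∏ i ∈ I, f i z := by
  classical
  induction I using Finset.induction_on with
  | empty => exact of_norm_le_exp hc (K := 1) (k := 0) (by simp)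
  | insert i I hi ih =>
    simp_rw [Finset.prod_insert hi]
    exact (h i (Finset.mem_insert_self _ _)).mul
      (ih fun j hj => h j (Finset.mem_insert_of_mem hj))

theorem pow (hc : 0 < c) (h : DoubleExp c a b g) (n : ℕ) : DoubleExp c a b fun z => g z ^ n := by
  simpa using prod hc (Finset.range n) (f := fun _ => g) fun _ _ => h

theorem Gamma (hc : 0 < c) {l : ℝ} (m : ℂ) (hl : 0 < l) :
    DoubleExp c a b fun z => Complex.Gamma (l * z + m) := by
  obtain ⟨N, hN⟩ := exists_nat_ge (1 - (l * a + m.re))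
  obtain ⟨C, hC⟩ := exists_norm_Gamma_le N (l * b + m.re)
  refine of_norm_le_exp hc (K := C) (k := 0) ?_
  filter_upwards [eventually_stripEnd ((1 + |m.im|) / l)] with z hz
  obtain ⟨⟨h1, h2⟩, h3⟩ := hz
  rw [div_le_iff₀ hl] at h3
  have e1 : ((l : ℂ) * z + m).re = l * z.re + m.re := by simp
  have e2 : ((l : ℂ) * z + m).im = l * z.im + m.im := by simp
  have h4 : l * a ≤ l * z.re := by gcongr
  have h5 : l * z.re ≤ l * b := by gcongr
  have h6 : |l * z.im| ≤ |l * z.im + m.im| + |m.im| := by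
    have := abs_sub (l * z.im + m.im) m.im
    rwa [add_sub_cancel_right] at this
  rw [abs_mul, abs_of_pos hl] at h6
  rw [zero_mul, Real.exp_zero, mul_one]
  exact hC _ (by rw [e1]; linarith) (by rw [e1]; linarith) (by rw [e2]; linarith)

end DoubleExp

/-- Growth slower than every Gaussian extends from two half-planes to the strip in between. -/
theorem growth_of_strip {ξ : ℂ → ℂ} (hξ : Differentiable ℂ ξ) {a b c : ℝ}
    (hc : 0 < c) (hcb : c < Real.pi / (b - a)) (hL : SubGaussianOn {z | z.re ≤ a} ξ)
    (hR : SubGaussianOn {z | b ≤ z.re} ξ) (hD : DoubleExp c a b ξ) {A : ℝ} (hA : 0 < A) :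
    ∃ C : ℝ, ∀ z, ‖ξ z‖ ≤ C * Real.exp (A * ‖z‖ ^ 2) := by
  obtain ⟨C₁, hC₁0, hC₁⟩ := hL A hA
  obtain ⟨C₂, hC₂0, hC₂⟩ := hR A hA
  -- the factor `exp (A z ^ 2)` makes the function bounded on both edges
  set g : ℂ → ℂ := fun z => ξ z * Complex.exp (A * z ^ 2) with hg
  have hre : ∀ z : ℂ, ((A : ℂ) * z ^ 2).re = A * (z.re ^ 2 - z.im ^ 2) := fun z => by
    rw [Complex.re_ofReal_mul, sq, Complex.mul_re]; ring
  have hnorm : ∀ z : ℂ, ‖z‖ ^ 2 = z.re ^ 2 + z.im ^ 2 := fun z => by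
    rw [← Complex.normSq_eq_norm_sq, Complex.normSq_apply]; ring
  have hgn : ∀ z, ‖g z‖ = ‖ξ z‖ * Real.exp (A * (z.re ^ 2 - z.im ^ 2)) := fun z => by
    rw [hg, norm_mul, Complex.norm_exp, hre]
  have hedge : ∀ C z, ‖ξ z‖ ≤ C * Real.exp (A * ‖z‖ ^ 2) →
      ‖g z‖ ≤ C * Real.exp (2 * A * z.re ^ 2) := fun C z hz => by
    rw [hgn]
    calc _ ≤ C * Real.exp (A * ‖z‖ ^ 2) * Real.exp (A * (z.re ^ 2 - z.im ^ 2)) := by gcongr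
      _ = C * Real.exp (2 * A * z.re ^ 2) := by
          rw [mul_assoc, ← Real.exp_add, hnorm]; congr 2; ring
  set M := C₁ * Real.exp (2 * A * a ^ 2) + C₂ * Real.exp (2 * A * b ^ 2) with hM
  have hM1 : 0 ≤ C₁ * Real.exp (2 * A * a ^ 2) := by positivity
  have hM2 : 0 ≤ C₂ * Real.exp (2 * A * b ^ 2) := by positivity
  have hgd : Differentiable ℂ g := hξ.mul (by fun_prop)
  have hexp : DoubleExp c a b fun z => Complex.exp (A * z ^ 2) := by
    refine DoubleExp.of_norm_le hc (K := 1) (k := A) (κ := 2) zero_le_two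
      (Eventually.of_forall fun z => ?_)
    rw [Complex.norm_exp, hre, one_mul, Real.rpow_two, hnorm]
    gcongr
    nlinarith [sq_nonneg z.im]
  have hgD : DoubleExp c a b g := hD.mul hexp
  have hstrip : ∀ z : ℂ, a ≤ z.re → z.re ≤ b → ‖g z‖ ≤ M := fun z hza hzb => by
    refine PhragmenLindelof.vertical_strip hgd.diffContOnCl ⟨c, hcb, hgD⟩ ?_ ?_ hza hzb
    · intro w hw
      have := hedge _ w (hC₁ w hw.le)
      rw [hw] at this
      linarith
    · intro w hw
      have := hedge _ w (hC₂ w hw.ge)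
      rw [hw] at this
      linarith
  have hM0 : 0 ≤ M := by positivity
  refine ⟨C₁ + C₂ + M, fun z => ?_⟩
  have hE := Real.exp_pos (A * ‖z‖ ^ 2)
  rcases le_total z.re a with h1 | h1
  · refine (hC₁ z h1).trans ?_
    gcongr
    linarith
  rcases le_total b z.re with h2 | h2
  · refine (hC₂ z h2).trans ?_
    gcongr
    linarith
  · have h3 := hstrip z h1 h2
    rw [hgn] at h3
    have h4 : ‖ξ z‖ = ‖ξ z‖ * Real.exp (A * (z.re ^ 2 - z.im ^ 2)) *
        Real.exp (-(A * (z.re ^ 2 - z.im ^ 2))) := by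
      rw [mul_assoc, ← Real.exp_add, add_neg_cancel, Real.exp_zero, mul_one]
    rw [h4]
    calc _ ≤ M * Real.exp (A * ‖z‖ ^ 2) := by
          gcongr
          rw [hnorm]
          nlinarith [mul_nonneg hA.le (sq_nonneg z.re)]
      _ ≤ _ := by
          gcongr
          linarith

/-! ### Logarithmic derivatives far to the right -/

/-- The filter of points whose real part tends to `+∞`. -/
def reAtTop : Filter ℂ := comap Complex.re atTop

theorem eventually_reAtTop {p : ℂ → Prop} :
    (∀ᶠ s in reAtTop, p s) ↔ ∃ a : ℝ, ∀ s : ℂ, a ≤ s.re → p s := by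
  simp [reAtTop, (atTop_basis.comap Complex.re).eventually_iff]

theorem eventually_le_re (a : ℝ) : ∀ᶠ s in reAtTop, a ≤ s.re :=
  eventually_reAtTop.2 ⟨a, fun _ h => h⟩

theorem eventually_conj {p : ℂ → Prop} (h : ∀ᶠ s in reAtTop, p s) :
    ∀ᶠ s in reAtTop, p ((starRingEnd ℂ) s) := by
  obtain ⟨a, ha⟩ := eventually_reAtTop.1 h
  exact eventually_reAtTop.2 ⟨a, fun s hs => ha _ (by simpa using hs)⟩

/-- The bounds of `HasTameLogDeriv`, for an arbitrary function in place of the logarithmic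
derivative. -/
def IsTame (g : ℂ → ℂ) : Prop :=
  ∃ C : ℝ, ∀ᶠ s in reAtTop, ‖g s‖ ≤ C * ‖s‖ ^ (1 / 8 : ℝ) ∧
    ‖g s - (starRingEnd ℂ) (g ((starRingEnd ℂ) s))‖ ≤ C / s.re

theorem one_le_norm_rpow {s : ℂ} (hs : 1 ≤ s.re) : 1 ≤ ‖s‖ ^ (1 / 8 : ℝ) :=
  Real.one_le_rpow (hs.trans (Complex.re_le_norm s)) (by norm_num)

namespace IsTame

variable {g g' : ℂ → ℂ}

theorem congr (h : IsTame g) (hg : g =ᶠ[reAtTop] g') : IsTame g' := by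
  obtain ⟨C, hC⟩ := h
  refine ⟨C, ?_⟩
  filter_upwards [hC, hg, eventually_conj hg] with s h1 h2 h3
  rwa [← h2, ← h3]

theorem add (h : IsTame g) (h' : IsTame g') : IsTame fun s => g s + g' s := by
  obtain ⟨C, hC⟩ := h
  obtain ⟨C', hC'⟩ := h'
  refine ⟨C + C', ?_⟩
  filter_upwards [hC, hC'] with s h1 h2
  refine ⟨(norm_add_le _ _).trans ?_, ?_⟩
  · rw [add_mul]
    exact add_le_add h1.1 h2.1
  · rw [map_add, add_sub_add_comm, add_div]
    exact (norm_add_le _ _).trans (add_le_add h1.2 h2.2)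

theorem const (r : ℝ) : IsTame fun _ => (r : ℂ) := by
  refine ⟨|r|, ?_⟩
  filter_upwards [eventually_le_re 1] with s hs
  rw [Complex.conj_ofReal, sub_self, norm_zero, Complex.norm_real, Real.norm_eq_abs]
  exact ⟨le_mul_of_one_le_right (abs_nonneg r) (one_le_norm_rpow hs), by positivity⟩

theorem sum {ι : Type*} (I : Finset ι) {f : ι → ℂ → ℂ} (h : ∀ i ∈ I, IsTame (f i)) :
    IsTame fun s => ∑ i ∈ I, f i s := by
  classical
  induction I using Finset.induction_on with
  | empty => simpa using const 0
  | insert i I hi ih =>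
    simp_rw [Finset.sum_insert hi]
    exact (h i (Finset.mem_insert_self _ _)).add
      (ih fun j hj => h j (Finset.mem_insert_of_mem hj))

theorem of_norm_le {K : ℝ} (hg : ∀ᶠ s in reAtTop, ‖g s‖ ≤ K / s.re) : IsTame g := by
  refine ⟨2 * K, ?_⟩
  filter_upwards [hg, eventually_conj hg, eventually_le_re 1] with s h1 h2 hs
  rw [Complex.conj_re] at h2
  have hs0 : 0 < s.re := by linarith
  have hK : 0 ≤ K := by
    have h3 := (norm_nonneg _).trans h1
    rwa [le_div_iff₀ hs0, zero_mul] at h3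
  constructor
  · calc ‖g s‖ ≤ K / s.re := h1
      _ ≤ K := div_le_self hK hs
      _ ≤ 2 * K := by linarith
      _ ≤ _ := le_mul_of_one_le_right (by positivity) (one_le_norm_rpow hs)
  · refine (norm_sub_le _ _).trans ?_
    rw [Complex.norm_conj, mul_div_assoc, two_mul]
    exact add_le_add h1 h2

theorem exists_hasTameLogDeriv {ξ : ℂ → ℂ} (h : IsTame (logDeriv ξ)) :
    ∃ a C, HasTameLogDeriv ξ a C := by
  obtain ⟨C, hC⟩ := h
  obtain ⟨a, ha⟩ := eventually_reAtTop.1 hC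
  exact ⟨a, C, fun s hs => (ha s hs).1, fun s hs => (ha s hs).2⟩

theorem digamma {l : ℝ} (hl : 0 < l) (m : ℂ) :
    IsTame fun s => Complex.digamma (l * s + m) * l := by
  obtain ⟨C, hC0, hC⟩ := exists_norm_digamma_le
  set C₁ := C * (l + ‖m‖) ^ (1 / 8 : ℝ) * l with hC₁
  have hC₁0 : 0 ≤ C₁ := by positivity
  refine ⟨C₁ + 4 * ‖m‖, ?_⟩
  filter_upwards [eventually_le_re 1, eventually_le_re (2 * (1 + |m.re|) / l)] with s hs hs'
  rw [div_le_iff₀ hl] at hs'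
  have hs0 : 0 < s.re := by linarith
  have hm := neg_abs_le m.re
  have hp : 1 ≤ ‖s‖ := hs.trans (Complex.re_le_norm s)
  have e1 : ((l : ℂ) * s + m).re = l * s.re + m.re := by simp
  have e2 : (starRingEnd ℂ) ((l : ℂ) * (starRingEnd ℂ) s + m) = l * s + (starRingEnd ℂ) m := by
    simp
  have hx1 : l * s.re / 2 + 1 ≤ ((l : ℂ) * s + m).re := by rw [e1]; linarith
  have hx2 : l * s.re / 2 + 1 ≤ ((l : ℂ) * s + (starRingEnd ℂ) m).re := by
    rw [Complex.add_re, Complex.conj_re, ← Complex.add_re]; exact hx1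
  have hls : 0 < l * s.re := by positivity
  constructor
  · have h1 : ‖(l : ℂ) * s + m‖ ≤ (l + ‖m‖) * ‖s‖ := by
      refine (norm_add_le _ _).trans ?_
      rw [norm_mul, Complex.norm_real, Real.norm_eq_abs, abs_of_pos hl, add_mul]
      gcongr
      exact le_mul_of_one_le_right (norm_nonneg m) hp
    rw [norm_mul, Complex.norm_real, Real.norm_eq_abs, abs_of_pos hl]
    calc ‖Complex.digamma (l * s + m)‖ * l ≤ C * ‖(l : ℂ) * s + m‖ ^ (1 / 8 : ℝ) * l := by
          gcongr
          exact hC _ (by linarith)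
      _ ≤ C * ((l + ‖m‖) * ‖s‖) ^ (1 / 8 : ℝ) * l := by gcongr
      _ = C₁ * ‖s‖ ^ (1 / 8 : ℝ) := by
          rw [Real.mul_rpow (by positivity) (norm_nonneg s)]; ring
      _ ≤ _ := by
          gcongr
          linarith [norm_nonneg m]
  · have h1 : (starRingEnd ℂ) (Complex.digamma (l * (starRingEnd ℂ) s + m) * l) =
        Complex.digamma (l * s + (starRingEnd ℂ) m) * l := by
      rw [map_mul, Complex.conj_ofReal, ← conj_digamma, e2]
      simp only [Complex.add_re, Complex.mul_re, Complex.ofReal_re, Complex.ofReal_im,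
        Complex.conj_re, zero_mul, sub_zero]
      linarith
    have h2 := norm_digamma_sub_le (show 1 < l * s.re / 2 + 1 by linarith) hx1 hx2
    rw [add_sub_add_left_eq_sub, add_sub_cancel_right] at h2
    have h3 : ‖m - (starRingEnd ℂ) m‖ ≤ 2 * ‖m‖ := by
      refine (norm_sub_le _ _).trans ?_
      rw [Complex.norm_conj]; linarith
    rw [h1, ← sub_mul, norm_mul, Complex.norm_real, Real.norm_eq_abs, abs_of_pos hl]
    calc _ ≤ ‖m - (starRingEnd ℂ) m‖ / (l * s.re / 2) * l := by gcongr
      _ ≤ (2 * ‖m‖) / (l * s.re / 2) * l := by gcongr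
      _ = (4 * ‖m‖) / s.re := by field_simp; ring
      _ ≤ _ := by gcongr; linarith

end IsTame

/-! ### Dirichlet series -/

theorem norm_LSeries_le {a : ℕ → ℂ} {x : ℝ} (ha : LSeriesSummable a x) {z : ℂ} (hz : x ≤ z.re) :
    ‖LSeries a z‖ ≤ ∑' n, ‖LSeries.term a x n‖ :=
  tsum_of_norm_bounded ha.norm.hasSum fun n =>
    LSeries.norm_term_le_of_re_le_re a (by simpa using hz) n

/-- A Dirichlet series without constant term is `O(1 / Re s)`. -/
theorem exists_norm_LSeries_le {c : ℕ → ℂ} {x : ℝ} (hc1 : c 1 = 0) (hc : LSeriesSummable c x) :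
    ∃ K : ℝ, ∀ᶠ s in reAtTop, ‖LSeries c s‖ ≤ K / s.re := by
  set S := ∑' n, ‖LSeries.term c x n‖ with hS
  have hS0 : 0 ≤ S := tsum_nonneg fun n => norm_nonneg _
  refine ⟨2 * S * 2, ?_⟩
  filter_upwards [eventually_le_re 1, eventually_le_re (2 * x)] with s hs1 hs
  have hs0 : 0 < s.re := by linarith
  set t := s.re - x with ht
  have ht0 : s.re / 2 ≤ t := by linarith
  have ht0' : 0 < t := by linarith
  have h2t : (2 : ℝ) ^ (-t) ≤ 2 / t := by
    have h1 : t / 2 ≤ (2 : ℝ) ^ t := by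
      have h2 := Real.add_one_le_exp (Real.log 2 * t)
      rw [Real.rpow_def_of_pos two_pos]
      nlinarith [Real.log_two_gt_d9]
    rw [Real.rpow_neg two_pos.le, inv_eq_one_div, div_le_div_iff₀ (by positivity) ht0']
    linarith
  have hterm : ∀ n, ‖LSeries.term c s n‖ ≤ (2 : ℝ) ^ (-t) * ‖LSeries.term c x n‖ := by
    intro n
    rw [LSeries.norm_term_eq, LSeries.norm_term_eq]
    rcases eq_or_ne n 0 with h0 | h0
    · simp [h0]
    rcases eq_or_ne n 1 with h1 | h1
    · simp [h1, hc1]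
    rw [if_neg h0, if_neg h0, Complex.ofReal_re]
    have hn2 : (2 : ℝ) ≤ n := by exact_mod_cast (show 2 ≤ n by omega)
    have hn0 : (0 : ℝ) < n := by linarith
    have e1 : (n : ℝ) ^ s.re = (n : ℝ) ^ x * (n : ℝ) ^ t := by
      rw [← Real.rpow_add hn0]; congr 1; ring
    have e2 : (n : ℝ) ^ (-t) ≤ (2 : ℝ) ^ (-t) :=
      Real.rpow_le_rpow_of_nonpos two_pos hn2 (by linarith)
    rw [Real.rpow_neg hn0.le] at e2
    calc ‖c n‖ / (n : ℝ) ^ s.re = ((n : ℝ) ^ t)⁻¹ * (‖c n‖ / (n : ℝ) ^ x) := by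
          rw [e1]; field_simp
      _ ≤ _ := by gcongr
  have hle : ‖LSeries c s‖ ≤ (2 : ℝ) ^ (-t) * S :=
    tsum_of_norm_bounded (hc.norm.hasSum.mul_left _) hterm
  refine hle.trans ?_
  calc (2 : ℝ) ^ (-t) * S ≤ 2 / t * S := by gcongr
    _ ≤ 2 / (s.re / 2) * S := by gcongr
    _ = 2 * S * 2 / s.re := by field_simp

theorem analyticAt_LSeries {a : ℕ → ℂ} {x : ℝ}
    (ha : ∀ z : ℂ, x < z.re → LSeriesSummable a z) {z : ℂ} (hz : x < z.re) :
    AnalyticAt ℂ (LSeries a) z := by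
  refine LSeries_analyticOnNhd a z ?_
  have h1 : LSeries.abscissaOfAbsConv a ≤ x :=
    LSeries.abscissaOfAbsConv_le_of_forall_lt_LSeriesSummable fun y hy =>
      ha y (by simpa using hy)
  exact h1.trans_lt (by exact_mod_cast hz)

/-- A function whose logarithmic derivative has no poles has no zeros. -/
theorem ne_zero_of_deriv_eq_mul {f C : ℂ → ℂ} {U : Set ℂ} (hU : IsPreconnected U)
    (hf : AnalyticOnNhd ℂ f U) (hC : AnalyticOnNhd ℂ C U)
    (hfC : ∀ z ∈ U, f z ≠ 0 → deriv f z = C z * f z) (hne : ∃ z ∈ U, f z ≠ 0) (hUo : IsOpen U)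
    {z : ℂ} (hz : z ∈ U) : f z ≠ 0 := by
  intro h0
  have hnot : ¬ ∀ᶠ w in 𝓝 z, f w = 0 := fun hev => by
    obtain ⟨w, hw, hfw⟩ := hne
    exact hfw (hf.eqOn_zero_of_preconnected_of_eventuallyEq_zero hU hz hev hw)
  have hne' := (hf z hz).eventually_eq_zero_or_eventually_ne_zero.resolve_left hnot
  have h1 : ∀ᶠ w in 𝓝[≠] z, deriv f w = (C * f) w := by
    have hU' : ∀ᶠ w in 𝓝 z, w ∈ U := hUo.mem_nhds hz
    filter_upwards [hne', hU'.filter_mono nhdsWithin_le_nhds] with w hw hwU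
      using hfC w hwU hw
  have h2 : deriv f =ᶠ[𝓝 z] C * f :=
    ((hf z hz).deriv.frequently_eq_iff_eventually_eq ((hC z hz).mul (hf z hz))).1 h1.frequently
  have h3 := (hf z hz).analyticOrderAt_deriv_add_one
  simp only [h0, sub_zero] at h3
  rw [analyticOrderAt_congr h2, analyticOrderAt_mul (hC z hz) (hf z hz)] at h3
  have h4 : analyticOrderAt f z ≠ ⊤ := fun h => hnot (analyticOrderAt_eq_top.1 h)
  have h5 : analyticOrderAt f z < analyticOrderAt f z + 1 :=
    (ENat.lt_add_one_iff h4).2 le_rfl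
  have h6 : analyticOrderAt f z + 1 ≤ analyticOrderAt C z + analyticOrderAt f z + 1 := by
    gcongr
    exact le_add_self
  rw [h3] at h6
  exact absurd h5 (not_lt.2 h6)

/-! ### The completed function of a member of the class -/

theorem eventually_ne_nhdsNE {α : Type*} [TopologicalSpace α] [T1Space α] (z s : α) :
    ∀ᶠ w in 𝓝[≠] z, w ≠ s := by
  by_cases h : z = s
  · subst h
    exact eventually_mem_nhdsWithin
  · exact (eventually_ne_nhds h).filter_mono nhdsWithin_le_nhds

/-- The points to the right of all the singularities of the factors of `ξ`, on which the factors
are under control. -/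
def IsFarRight (σ₀ σ₁ : ℝ) (D : CompletionData) (z : ℂ) : Prop :=
  σ₀ + 1 ≤ z.re ∧ (∀ j, 2 ≤ ((D.lam j : ℂ) * z + D.mu j).re) ∧
    ∀ i ∈ Finset.Icc 1 D.N, 2 * (‖D.s i‖ + σ₁) ≤ z.re

namespace InClass

variable {σ₀ σ₁ : ℝ} {F : ℂ → ℂ} {D : CompletionData}

/-- `F` agrees with a quotient of entire functions off the finite set of the `s i`; its values at
these points are arbitrary and do not affect meromorphy. -/
theorem meromorphicAt (hF : InClass σ₀ σ₁ F D) (z : ℂ) : MeromorphicAt F z := by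
  obtain ⟨G, ⟨hG, -⟩, hGF⟩ := hF.continuation
  have h1 : MeromorphicAt (fun w => G w / ∏ i ∈ Finset.Icc 1 D.N, (w - D.s i) ^ D.m i) z := by
    refine (hG.analyticAt z).meromorphicAt.div ?_
    have : Differentiable ℂ fun w : ℂ => ∏ i ∈ Finset.Icc 1 D.N, (w - D.s i) ^ D.m i := by fun_prop
    exact (this.analyticAt z).meromorphicAt
  refine h1.congr ?_
  filter_upwards [(Finset.eventually_all (Finset.Icc 1 D.N)).2
    fun i _ => eventually_ne_nhdsNE z (D.s i)] with w hw
  rw [hGF w hw, mul_div_cancel_left₀]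
  exact Finset.prod_ne_zero_iff.2 fun i hi => pow_ne_zero _ (sub_ne_zero.2 (hw i hi))

theorem Q_ne (hF : InClass σ₀ σ₁ F D) : (D.Q : ℂ) ≠ 0 := by
  exact_mod_cast hF.Q_pos.ne'

theorem meromorphicOn_rawXi (hF : InClass σ₀ σ₁ F D) :
    MeromorphicOn (rawXi σ₁ F D) Set.univ := by
  intro z _
  have h1 : Differentiable ℂ fun z : ℂ => (D.Q : ℂ) ^ z := fun z =>
    DifferentiableAt.const_cpow differentiableAt_id (Or.inl hF.Q_ne)
  have h2 : ∀ j, MeromorphicAt (fun z => Complex.Gamma ((D.lam j : ℂ) * z + D.mu j)) z :=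
    fun j => by
    have h3 : Differentiable ℂ fun z : ℂ => (D.lam j : ℂ) * z + D.mu j := by fun_prop
    exact (Meromorphic.Gamma _).comp_analyticAt (h3.analyticAt z)
  have h4 : Differentiable ℂ fun z : ℂ =>
      ∏ i ∈ Finset.Icc 1 (2 * D.M + poleAtCentre F σ₁), (z - D.s i) ^ D.m i := by fun_prop
  have h5 : Differentiable ℂ fun z : ℂ =>
      ∏ i ∈ Finset.Icc (2 * D.M + poleAtCentre F σ₁ + 1) D.N,
      ((z - D.s i) ^ D.m i * ((σ₁ : ℂ) - z - (starRingEnd ℂ) (D.s i)) ^ D.m i) := by fun_prop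
  exact ((((hF.meromorphicAt z).mul (h1.analyticAt z).meromorphicAt).mul
    (MeromorphicAt.fun_prod fun j _ => h2 j)).mul (h4.analyticAt z).meromorphicAt).mul
    (h5.analyticAt z).meromorphicAt

theorem differentiableAt_rawXi (hF : InClass σ₀ σ₁ F D) {z : ℂ} (hFz : DifferentiableAt ℂ F z)
    (hΓ : ∀ j, ∀ m : ℕ, (D.lam j : ℂ) * z + D.mu j ≠ -m) :
    DifferentiableAt ℂ (rawXi σ₁ F D) z := by
  have h1 : DifferentiableAt ℂ (fun z : ℂ => (D.Q : ℂ) ^ z) z :=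
    DifferentiableAt.const_cpow differentiableAt_id (Or.inl hF.Q_ne)
  have h2 : ∀ j, DifferentiableAt ℂ (fun z => Complex.Gamma ((D.lam j : ℂ) * z + D.mu j)) z :=
    fun j => DifferentiableAt.comp z (g := Complex.Gamma)
      (Complex.differentiableAt_Gamma _ (hΓ j)) (by fun_prop)
  have h3 : DifferentiableAt ℂ (fun z : ℂ =>
      ∏ i ∈ Finset.Icc 1 (2 * D.M + poleAtCentre F σ₁), (z - D.s i) ^ D.m i) z := by fun_prop
  have h4 : DifferentiableAt ℂ (fun z : ℂ =>
      ∏ i ∈ Finset.Icc (2 * D.M + poleAtCentre F σ₁ + 1) D.N,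
      ((z - D.s i) ^ D.m i * ((σ₁ : ℂ) - z - (starRingEnd ℂ) (D.s i)) ^ D.m i)) z := by fun_prop
  exact (((hFz.mul h1).mul (DifferentiableAt.fun_finsetProd fun j _ => h2 j)).mul h3).mul h4

/-- Where the pointwise product is continuous it has the values of the completed function: `rawXi`
and `xi` agree on a punctured neighbourhood and both are continuous at its centre. -/
theorem xi_eventuallyEq_rawXi (hF : InClass σ₀ σ₁ F D) {z : ℂ}
    (hz : ContinuousAt (rawXi σ₁ F D) z) : xi σ₁ F D =ᶠ[𝓝 z] rawXi σ₁ F D := by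
  have h1 : xi σ₁ F D =ᶠ[𝓝[≠] z] rawXi σ₁ F D :=
    hF.meromorphicOn_rawXi.toMeromorphicNFOn_eq_self_on_nhdsNE (Set.mem_univ z)
  refine eventuallyEq_nhds_of_eventuallyEq_nhdsNE h1 ?_
  exact tendsto_nhds_unique
    (hF.xi_entire.continuous.continuousAt.tendsto.mono_left nhdsWithin_le_nhds)
    ((hz.tendsto.mono_left nhdsWithin_le_nhds).congr' h1.symm)

theorem analyticOnNhd (hF : InClass σ₀ σ₁ F D) : AnalyticOnNhd ℂ F {z | σ₀ < z.re} := by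
  obtain ⟨a, ha⟩ := hF.dirichlet
  intro z hz
  refine (analyticAt_LSeries (fun w hw => (ha w hw).1) hz).congr ?_
  have : ∀ᶠ w in 𝓝 z, σ₀ < w.re := (isOpen_lt continuous_const Complex.continuous_re).mem_nhds hz
  filter_upwards [this] with w hw using (ha w hw).2.symm

/-- The Dirichlet series of `F'/F` has no poles to the right of `σ₀`, so `F` has no zeros there. -/
theorem ne_zero_right (hF : InClass σ₀ σ₁ F D) {z : ℂ} (hz : σ₀ < z.re) : F z ≠ 0 := by
  obtain ⟨c, -, hc⟩ := hF.euler_sum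
  refine ne_zero_of_deriv_eq_mul (f := F) (C := fun z => -LSeries c z) (U := {z | σ₀ < z.re})
    (convex_halfSpace_re_gt σ₀).isPreconnected hF.analyticOnNhd
    (fun w hw => (analyticAt_LSeries (fun u hu => (hc u hu).1) hw).neg) ?_ hF.ne_zero
    (isOpen_lt continuous_const Complex.continuous_re) hz
  intro w hw hw0
  rw [← (hc w hw).2 hw0, div_mul_cancel₀ _ hw0]

theorem eventually_isFarRight (hF : InClass σ₀ σ₁ F D) :
    ∀ᶠ z in reAtTop, IsFarRight σ₀ σ₁ D z := by
  refine (eventually_le_re _).and (Filter.Eventually.and ?_ ?_)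
  · refine Filter.eventually_all.2 fun j => ?_
    have hj := hF.lam_pos j
    filter_upwards [eventually_le_re ((2 - (D.mu j).re) / D.lam j)] with z hz
    rw [div_le_iff₀ hj] at hz
    simp only [Complex.add_re, Complex.mul_re, Complex.ofReal_re, Complex.ofReal_im, zero_mul,
      sub_zero]
    linarith
  · exact (Finset.eventually_all _).2 fun i _ => eventually_le_re _

theorem pos_of_isFarRight (hF : InClass σ₀ σ₁ F D) {z : ℂ} (hz : IsFarRight σ₀ σ₁ D z) :
    0 < z.re := by
  linarith [hF.sigma_pos, hF.sigma_le, hz.1]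

theorem half_le_norm_sub (hF : InClass σ₀ σ₁ F D) {z : ℂ} (hz : IsFarRight σ₀ σ₁ D z) {i : ℕ}
    (hi : i ∈ Finset.Icc 1 D.N) :
    z.re / 2 ≤ ‖z - D.s i‖ ∧ z.re / 2 ≤ ‖(σ₁ : ℂ) - z - (starRingEnd ℂ) (D.s i)‖ := by
  have h1 := hz.2.2 i hi
  have h2 := Complex.re_le_norm (D.s i)
  have h3 := (abs_le.1 (Complex.abs_re_le_norm (D.s i))).1
  have hσ := hF.sigma_pos
  constructor
  · refine le_trans ?_ (Complex.re_le_norm _)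
    rw [Complex.sub_re]
    linarith
  · refine le_trans ?_ ((neg_le_abs _).trans (Complex.abs_re_le_norm _))
    rw [Complex.sub_re, Complex.sub_re, Complex.ofReal_re, Complex.conj_re]
    linarith

theorem sub_ne_zero (hF : InClass σ₀ σ₁ F D) {z : ℂ} (hz : IsFarRight σ₀ σ₁ D z) {i : ℕ}
    (hi : i ∈ Finset.Icc 1 D.N) :
    z - D.s i ≠ 0 ∧ (σ₁ : ℂ) - z - (starRingEnd ℂ) (D.s i) ≠ 0 := by
  have h0 := half_pos (hF.pos_of_isFarRight hz)
  obtain ⟨h1, h2⟩ := hF.half_le_norm_sub hz hi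
  exact ⟨norm_pos_iff.1 (h0.trans_le h1), norm_pos_iff.1 (h0.trans_le h2)⟩

theorem mem_of_mem_left (hF : InClass σ₀ σ₁ F D) {i : ℕ}
    (hi : i ∈ Finset.Icc 1 (2 * D.M + poleAtCentre F σ₁)) : i ∈ Finset.Icc 1 D.N := by
  rw [Finset.mem_Icc] at hi ⊢
  exact ⟨hi.1, hi.2.trans hF.count_le⟩

theorem mem_of_mem_right {i n : ℕ} (hi : i ∈ Finset.Icc (n + 1) D.N) : i ∈ Finset.Icc 1 D.N := by
  rw [Finset.mem_Icc] at hi ⊢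
  omega

theorem Gamma_arg_ne {z : ℂ} (hz : IsFarRight σ₀ σ₁ D z) (j : Fin D.r) (m : ℕ) :
    (D.lam j : ℂ) * z + D.mu j ≠ -m :=
  ne_neg_natCast (by linarith [hz.2.1 j]) m

theorem differentiableAt_right (hF : InClass σ₀ σ₁ F D) {z : ℂ} (hz : IsFarRight σ₀ σ₁ D z) :
    DifferentiableAt ℂ F z :=
  (hF.analyticOnNhd z (show σ₀ < z.re by linarith [hz.1])).differentiableAt

theorem xi_eventuallyEq_right (hF : InClass σ₀ σ₁ F D) {z : ℂ} (hz : IsFarRight σ₀ σ₁ D z) :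
    xi σ₁ F D =ᶠ[𝓝 z] rawXi σ₁ F D :=
  hF.xi_eventuallyEq_rawXi
    (hF.differentiableAt_rawXi (hF.differentiableAt_right hz) (Gamma_arg_ne hz)).continuousAt

theorem xi_ne_zero_right (hF : InClass σ₀ σ₁ F D) {z : ℂ} (hz : IsFarRight σ₀ σ₁ D z) :
    xi σ₁ F D z ≠ 0 := by
  rw [(hF.xi_eventuallyEq_right hz).eq_of_nhds, rawXi]
  refine mul_ne_zero (mul_ne_zero (mul_ne_zero (mul_ne_zero ?_ ?_) ?_) ?_) ?_
  · exact hF.ne_zero_right (by linarith [hz.1])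
  · rw [Complex.cpow_def_of_ne_zero hF.Q_ne]
    exact Complex.exp_ne_zero _
  · exact Finset.prod_ne_zero_iff.2 fun j _ => Complex.Gamma_ne_zero (Gamma_arg_ne hz j)
  · exact Finset.prod_ne_zero_iff.2 fun i hi =>
      pow_ne_zero _ (hF.sub_ne_zero hz (hF.mem_of_mem_left hi)).1
  · refine Finset.prod_ne_zero_iff.2 fun i hi => ?_
    obtain ⟨h1, h2⟩ := hF.sub_ne_zero hz (mem_of_mem_right hi)
    exact mul_ne_zero (pow_ne_zero _ h1) (pow_ne_zero _ h2)

theorem logDeriv_xi (hF : InClass σ₀ σ₁ F D) {z : ℂ} (hz : IsFarRight σ₀ σ₁ D z) :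
    logDeriv (xi σ₁ F D) z = logDeriv F z + (Real.log D.Q : ℂ) +
      (∑ j, Complex.digamma ((D.lam j : ℂ) * z + D.mu j) * D.lam j) +
      (∑ i ∈ Finset.Icc 1 (2 * D.M + poleAtCentre F σ₁), (D.m i : ℂ) / (z - D.s i)) +
      ∑ i ∈ Finset.Icc (2 * D.M + poleAtCentre F σ₁ + 1) D.N, ((D.m i : ℂ) / (z - D.s i) +
        -(D.m i : ℂ) / ((σ₁ : ℂ) - z - (starRingEnd ℂ) (D.s i))) := by
  have hd : logDeriv (xi σ₁ F D) z = logDeriv (rawXi σ₁ F D) z := by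
    have h := hF.xi_eventuallyEq_right hz
    rw [logDeriv_apply, logDeriv_apply, h.deriv_eq, h.eq_of_nhds]
  have nF := hF.ne_zero_right (show σ₀ < z.re by linarith [hz.1])
  have dF := hF.differentiableAt_right hz
  have hQ : HasDerivAt (fun z : ℂ => (D.Q : ℂ) ^ z) ((D.Q : ℂ) ^ z * Complex.log D.Q) z := by
    simpa using (hasDerivAt_id z).const_cpow (Or.inl hF.Q_ne)
  have nQ : (D.Q : ℂ) ^ z ≠ 0 := by
    rw [Complex.cpow_def_of_ne_zero hF.Q_ne]; exact Complex.exp_ne_zero _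
  have dΓ : ∀ j, DifferentiableAt ℂ (fun z => Complex.Gamma ((D.lam j : ℂ) * z + D.mu j)) z :=
    fun j => DifferentiableAt.comp z (g := Complex.Gamma)
      (Complex.differentiableAt_Gamma _ (Gamma_arg_ne hz j)) (by fun_prop)
  have nΓ : ∀ j, Complex.Gamma ((D.lam j : ℂ) * z + D.mu j) ≠ 0 := fun j =>
    Complex.Gamma_ne_zero (Gamma_arg_ne hz j)
  have n1 : ∀ i ∈ Finset.Icc 1 (2 * D.M + poleAtCentre F σ₁), (z - D.s i) ^ D.m i ≠ 0 :=
    fun i hi => pow_ne_zero _ (hF.sub_ne_zero hz (hF.mem_of_mem_left hi)).1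
  have n2 : ∀ i ∈ Finset.Icc (2 * D.M + poleAtCentre F σ₁ + 1) D.N, (z - D.s i) ^ D.m i ≠ 0 :=
    fun i hi => pow_ne_zero _ (hF.sub_ne_zero hz (mem_of_mem_right hi)).1
  have n3 : ∀ i ∈ Finset.Icc (2 * D.M + poleAtCentre F σ₁ + 1) D.N,
      ((σ₁ : ℂ) - z - (starRingEnd ℂ) (D.s i)) ^ D.m i ≠ 0 :=
    fun i hi => pow_ne_zero _ (hF.sub_ne_zero hz (mem_of_mem_right hi)).2
  have m1 : (∏ j, Complex.Gamma ((D.lam j : ℂ) * z + D.mu j)) ≠ 0 :=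
    Finset.prod_ne_zero_iff.2 fun j _ => nΓ j
  have m2 := Finset.prod_ne_zero_iff.2 n1
  have m3 := Finset.prod_ne_zero_iff.2 fun i hi => mul_ne_zero (n2 i hi) (n3 i hi)
  have d1 : DifferentiableAt ℂ (fun z => ∏ j, Complex.Gamma ((D.lam j : ℂ) * z + D.mu j)) z :=
    DifferentiableAt.fun_finsetProd fun j _ => dΓ j
  have l0 : logDeriv (fun z : ℂ => (D.Q : ℂ) ^ z) z = (Real.log D.Q : ℂ) := by
    rw [logDeriv_apply, hQ.deriv, mul_div_cancel_left₀ _ nQ, Complex.ofReal_log hF.Q_pos.le]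
  have l1 : ∀ j, logDeriv (fun z => Complex.Gamma ((D.lam j : ℂ) * z + D.mu j)) z =
      Complex.digamma ((D.lam j : ℂ) * z + D.mu j) * D.lam j := fun j => by
    have h1 : HasDerivAt (fun z : ℂ => (D.lam j : ℂ) * z + D.mu j) (D.lam j) z := by
      simpa using ((hasDerivAt_id z).const_mul (D.lam j : ℂ)).add_const (D.mu j)
    have := logDeriv_comp (f := Complex.Gamma) (g := fun z : ℂ => (D.lam j : ℂ) * z + D.mu j)
      (x := z) (Complex.differentiableAt_Gamma _ (Gamma_arg_ne hz j)) h1.differentiableAt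
    rw [h1.deriv] at this
    exact this
  have l2 : ∀ i, logDeriv (fun z : ℂ => (z - D.s i) ^ D.m i) z = (D.m i : ℂ) / (z - D.s i) :=
    fun i => by
    rw [logDeriv_fun_pow (by fun_prop), logDeriv_apply, deriv_sub_const, deriv_id'', mul_one_div]
  have l3 : ∀ i, logDeriv (fun z : ℂ => ((σ₁ : ℂ) - z - (starRingEnd ℂ) (D.s i)) ^ D.m i) z =
      -(D.m i : ℂ) / ((σ₁ : ℂ) - z - (starRingEnd ℂ) (D.s i)) := fun i => by
    rw [logDeriv_fun_pow (by fun_prop), logDeriv_apply, deriv_sub_const, deriv_const_sub,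
      deriv_id'']
    ring
  set q : ℂ → ℂ := fun z => (D.Q : ℂ) ^ z
  set g : ℂ → ℂ := fun z => ∏ j, Complex.Gamma ((D.lam j : ℂ) * z + D.mu j)
  set p₁ : ℂ → ℂ := fun z =>
    ∏ i ∈ Finset.Icc 1 (2 * D.M + poleAtCentre F σ₁), (z - D.s i) ^ D.m i
  set p₂ : ℂ → ℂ := fun z => ∏ i ∈ Finset.Icc (2 * D.M + poleAtCentre F σ₁ + 1) D.N,
    ((z - D.s i) ^ D.m i * ((σ₁ : ℂ) - z - (starRingEnd ℂ) (D.s i)) ^ D.m i)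
  have d2 : DifferentiableAt ℂ p₁ z := by fun_prop
  have d3 : DifferentiableAt ℂ p₂ z := by fun_prop
  have k1 := dF.fun_mul hQ.differentiableAt
  have l4 : logDeriv p₂ z = ∑ i ∈ Finset.Icc (2 * D.M + poleAtCentre F σ₁ + 1) D.N,
      ((D.m i : ℂ) / (z - D.s i) +
        -(D.m i : ℂ) / ((σ₁ : ℂ) - z - (starRingEnd ℂ) (D.s i))) := by
    refine (logDeriv_prod (f := fun i z => (z - D.s i) ^ D.m i *
      ((σ₁ : ℂ) - z - (starRingEnd ℂ) (D.s i)) ^ D.m i)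
      (fun i hi => mul_ne_zero (n2 i hi) (n3 i hi)) (fun i _ => by fun_prop)).trans
      (Finset.sum_congr rfl fun i hi => ?_)
    rw [logDeriv_mul (f := fun z => (z - D.s i) ^ D.m i)
      (g := fun z => ((σ₁ : ℂ) - z - (starRingEnd ℂ) (D.s i)) ^ D.m i) z (n2 i hi) (n3 i hi)
      (by fun_prop) (by fun_prop), l2, l3]
  rw [hd, show rawXi σ₁ F D = fun z => F z * q z * g z * p₁ z * p₂ z from rfl,
    logDeriv_mul (f := fun z => F z * q z * g z * p₁ z) (g := p₂) z
      (mul_ne_zero (mul_ne_zero (mul_ne_zero nF nQ) m1) m2) m3 ((k1.fun_mul d1).fun_mul d2) d3,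
    logDeriv_mul (f := fun z => F z * q z * g z) (g := p₁) z
      (mul_ne_zero (mul_ne_zero nF nQ) m1) m2 (k1.fun_mul d1) d2,
    logDeriv_mul (f := fun z => F z * q z) (g := g) z (mul_ne_zero nF nQ) m1 k1 d1,
    logDeriv_mul (f := F) (g := q) z nF nQ dF hQ.differentiableAt, l0,
    logDeriv_prod (fun j _ => nΓ j) (fun j _ => dΓ j), logDeriv_prod n1 (fun i _ => by fun_prop),
    l4]
  simp_rw [l1, l2]

/-- Far to the right `ξ'/ξ` is the sum of the real constant `log Q`, of digamma terms, which vary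
slowly, and of terms that are `O(1 / Re s)`: simple fractions and `F'/F`. -/
theorem isTame_logDeriv (hF : InClass σ₀ σ₁ F D) : IsTame (logDeriv (xi σ₁ F D)) := by
  have hfar := hF.eventually_isFarRight
  have t1 : IsTame (logDeriv F) := by
    obtain ⟨c, hc1, hc⟩ := hF.euler_sum
    obtain ⟨K, hK⟩ := exists_norm_LSeries_le (x := σ₀ + 1) hc1 (hc _ (by simp)).1
    refine IsTame.of_norm_le (K := K) ?_
    filter_upwards [hK, hfar] with z hz hz'
    have h1 : σ₀ < z.re := by linarith [hz'.1]
    rwa [logDeriv_apply, (hc z h1).2 (hF.ne_zero_right h1), norm_neg]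
  have t2 : ∀ i ∈ Finset.Icc 1 D.N, IsTame fun z => (D.m i : ℂ) / (z - D.s i) := fun i hi => by
    refine IsTame.of_norm_le (K := D.m i * 2) ?_
    filter_upwards [hfar] with z hz
    have h0 := hF.pos_of_isFarRight hz
    rw [norm_div, Complex.norm_natCast]
    calc (D.m i : ℝ) / ‖z - D.s i‖ ≤ (D.m i : ℝ) / (z.re / 2) := by
          gcongr
          exact (hF.half_le_norm_sub hz hi).1
      _ = _ := by field_simp
  have t3 : ∀ i ∈ Finset.Icc 1 D.N, IsTame fun z =>
      -(D.m i : ℂ) / ((σ₁ : ℂ) - z - (starRingEnd ℂ) (D.s i)) := fun i hi => by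
    refine IsTame.of_norm_le (K := D.m i * 2) ?_
    filter_upwards [hfar] with z hz
    have h0 := hF.pos_of_isFarRight hz
    rw [norm_div, norm_neg, Complex.norm_natCast]
    calc (D.m i : ℝ) / ‖(σ₁ : ℂ) - z - (starRingEnd ℂ) (D.s i)‖ ≤ (D.m i : ℝ) / (z.re / 2) := by
          gcongr
          exact (hF.half_le_norm_sub hz hi).2
      _ = _ := by field_simp
  have t := (((t1.add (IsTame.const (Real.log D.Q))).add
    (IsTame.sum Finset.univ fun j _ => IsTame.digamma (hF.lam_pos j) (D.mu j))).add
    (IsTame.sum (Finset.Icc 1 (2 * D.M + poleAtCentre F σ₁)) fun i hi =>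
      t2 i (hF.mem_of_mem_left hi))).add
    (IsTame.sum (Finset.Icc (2 * D.M + poleAtCentre F σ₁ + 1) D.N) fun i hi =>
      (t2 i (mem_of_mem_right hi)).add (t3 i (mem_of_mem_right hi)))
  refine t.congr ?_
  filter_upwards [hfar] with z hz using (hF.logDeriv_xi hz).symm

theorem subGaussianOn_poly {S : Set ℂ} (s : ℂ) (n : ℕ) :
    SubGaussianOn S fun z => (z - s) ^ n :=
  (SubGaussianOn.of_norm_le fun z _ => norm_sub_le_mul_exp z s).pow n

theorem norm_reflect_sub_le (σ : ℝ) (z s : ℂ) : ‖(σ : ℂ) - z - (starRingEnd ℂ) s‖ ≤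
    (1 + ‖(σ : ℂ) - (starRingEnd ℂ) s‖) * Real.exp (1 * ‖z‖) := by
  rw [← norm_neg, show -((σ : ℂ) - z - (starRingEnd ℂ) s) = z - (σ - (starRingEnd ℂ) s) by ring]
  exact norm_sub_le_mul_exp z _

theorem subGaussianOn_right (hF : InClass σ₀ σ₁ F D) {b : ℝ}
    (hb : ∀ z : ℂ, b ≤ z.re → IsFarRight σ₀ σ₁ D z) :
    SubGaussianOn {z | b ≤ z.re} (xi σ₁ F D) := by
  have key : SubGaussianOn {z | b ≤ z.re} (rawXi σ₁ F D) := by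
    refine (((SubGaussianOn.mul ?_ ?_).mul ?_).mul ?_).mul ?_
    · obtain ⟨a, ha⟩ := hF.dirichlet
      refine SubGaussianOn.of_norm_le (K := ∑' n, ‖LSeries.term a (σ₀ + 1 : ℝ) n‖) (k := 0)
        fun z hz => ?_
      have h1 := (hb z hz).1
      rw [(ha z (by linarith)).2, zero_mul, Real.exp_zero, mul_one]
      exact norm_LSeries_le (ha _ (by simp)).1 h1
    · exact SubGaussianOn.of_norm_le fun z _ => norm_ofReal_cpow_le hF.Q_pos z
    · exact SubGaussianOn.prod _ fun j _ =>
        SubGaussianOn.Gamma (hF.lam_pos j) fun z hz => (hb z hz).2.1 j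
    · exact SubGaussianOn.prod _ fun i _ => subGaussianOn_poly _ _
    · refine SubGaussianOn.prod _ fun i _ => (subGaussianOn_poly _ _).mul
        (SubGaussianOn.pow (SubGaussianOn.of_norm_le fun z _ => norm_reflect_sub_le σ₁ z _) _)
  intro A hA
  obtain ⟨C, hC0, hC⟩ := key A hA
  refine ⟨C, hC0, fun z hz => ?_⟩
  rw [(hF.xi_eventuallyEq_right (hb z hz)).eq_of_nhds]
  exact hC z hz

/-- The functional equation carries growth bounds from the right to the left half-plane. -/
theorem subGaussianOn_left (hF : InClass σ₀ σ₁ F D) {b : ℝ}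
    (h : SubGaussianOn {z | b ≤ z.re} (xi σ₁ F D)) :
    SubGaussianOn {z | z.re ≤ σ₁ - b} (xi σ₁ F D) := by
  intro A hA
  obtain ⟨C, hC0, hC⟩ := h (A / 2) (by positivity)
  refine ⟨C * Real.exp (A * σ₁ ^ 2), by positivity, fun z hz => ?_⟩
  have h1 : b ≤ ((σ₁ : ℂ) - (starRingEnd ℂ) z).re := by
    rw [Complex.sub_re, Complex.ofReal_re, Complex.conj_re]
    linarith [show z.re ≤ σ₁ - b from hz]
  rw [hF.functional_equation z, norm_mul, hF.norm_omega, one_mul, Complex.norm_conj, mul_assoc,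
    ← Real.exp_add]
  refine (hC _ h1).trans ?_
  gcongr
  have h2 : ‖(σ₁ : ℂ) - (starRingEnd ℂ) z‖ ≤ σ₁ + ‖z‖ := by
    refine (norm_sub_le _ _).trans ?_
    rw [Complex.norm_conj, Complex.norm_real, Real.norm_eq_abs, abs_of_pos hF.sigma_pos]
  calc A / 2 * ‖(σ₁ : ℂ) - (starRingEnd ℂ) z‖ ^ 2 ≤ A / 2 * (σ₁ + ‖z‖) ^ 2 := by gcongr
    _ ≤ A / 2 * (2 * σ₁ ^ 2 + 2 * ‖z‖ ^ 2) := by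
        gcongr
        nlinarith [sq_nonneg (σ₁ - ‖z‖)]
    _ = _ := by ring

/-- In vertical strips, the growth of `ξ` is that of an entire function of finite order divided by
a polynomial, times bounded gamma factors. -/
theorem doubleExp_xi (hF : InClass σ₀ σ₁ F D) {a b c : ℝ} (hc : 0 < c) :
    DoubleExp c a b (xi σ₁ F D) := by
  obtain ⟨G, ⟨hG, C, κ, hκ, hGC⟩, hGF⟩ := hF.continuation
  have hfar : ∀ᶠ z in stripEnd a b, ∀ i ∈ Finset.Icc 1 D.N, 1 ≤ ‖z - D.s i‖ := by
    refine (Finset.eventually_all _).2 fun i _ => ?_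
    filter_upwards [eventually_stripEnd (1 + |(D.s i).im|)] with z hz
    refine le_trans ?_ (Complex.abs_im_le_norm _)
    rw [Complex.sub_im]
    linarith [abs_sub_abs_le_abs_sub z.im (D.s i).im, hz.2]
  have hΓ : ∀ᶠ z in stripEnd a b, ∀ j, ∀ m : ℕ, (D.lam j : ℂ) * z + D.mu j ≠ -m := by
    refine Filter.eventually_all.2 fun j => ?_
    have hj := hF.lam_pos j
    filter_upwards [eventually_stripEnd ((1 + |(D.mu j).im|) / D.lam j)] with z hz m hm
    have h1 := hz.2
    rw [div_le_iff₀ hj] at h1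
    have h2 := congrArg Complex.im hm
    simp only [Complex.add_im, Complex.mul_im, Complex.ofReal_re, Complex.ofReal_im, zero_mul,
      add_zero, Complex.neg_im, Complex.natCast_im, neg_zero] at h2
    have h3 : |D.lam j * z.im| = |(D.mu j).im| := by
      rw [eq_neg_of_add_eq_zero_left h2, abs_neg]
    rw [abs_mul, abs_of_pos hj] at h3
    linarith
  have key : DoubleExp c a b fun z =>
      (G z * ∏ i ∈ Finset.Icc 1 D.N, ((z - D.s i) ^ D.m i)⁻¹) * (D.Q : ℂ) ^ z *
      (∏ j, Complex.Gamma ((D.lam j : ℂ) * z + D.mu j)) *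
      (∏ i ∈ Finset.Icc 1 (2 * D.M + poleAtCentre F σ₁), (z - D.s i) ^ D.m i) *
      ∏ i ∈ Finset.Icc (2 * D.M + poleAtCentre F σ₁ + 1) D.N,
      ((z - D.s i) ^ D.m i * ((σ₁ : ℂ) - z - (starRingEnd ℂ) (D.s i)) ^ D.m i) := by
    have poly : ∀ i, DoubleExp c a b fun z => (z - D.s i) ^ D.m i := fun i =>
      DoubleExp.pow hc (DoubleExp.of_norm_le_exp hc
        (Eventually.of_forall fun z => norm_sub_le_mul_exp z _)) _
    refine ((((DoubleExp.mul ?_ ?_).mul ?_).mul ?_).mul ?_).mul ?_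
    · refine DoubleExp.of_norm_le hc (K := C) (k := 1) hκ (Eventually.of_forall fun z => ?_)
      rw [one_mul]
      exact hGC z
    · refine DoubleExp.prod hc _ fun i hi => DoubleExp.of_norm_le_exp hc (K := 1) (k := 0) ?_
      filter_upwards [hfar] with z hz
      rw [zero_mul, Real.exp_zero, mul_one, norm_inv, norm_pow]
      exact inv_le_one_of_one_le₀ (one_le_pow₀ (hz i hi))
    · exact DoubleExp.of_norm_le_exp hc
        (Eventually.of_forall fun z => norm_ofReal_cpow_le hF.Q_pos z)
    · exact DoubleExp.prod hc _ fun j _ => DoubleExp.Gamma hc _ (hF.lam_pos j)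
    · exact DoubleExp.prod hc _ fun i _ => poly i
    · refine DoubleExp.prod hc _ fun i _ => (poly i).mul
        (DoubleExp.pow hc (DoubleExp.of_norm_le_exp hc
          (Eventually.of_forall fun z => norm_reflect_sub_le σ₁ z _)) _)
  obtain ⟨K, hK⟩ := key
  refine ⟨K, hK.congr' ?_ EventuallyEq.rfl⟩
  filter_upwards [hfar, hΓ] with z hz hz'
  have hprod : ∀ w : ℂ, (∀ i ∈ Finset.Icc 1 D.N, w ≠ D.s i) →
      F w = G w * ∏ i ∈ Finset.Icc 1 D.N, ((w - D.s i) ^ D.m i)⁻¹ := fun w hw => by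
    rw [hGF w hw, Finset.prod_inv_distrib, mul_comm, ← mul_assoc, inv_mul_cancel₀, one_mul]
    exact Finset.prod_ne_zero_iff.2 fun i hi => pow_ne_zero _ (_root_.sub_ne_zero.2 (hw i hi))
  have hne : ∀ i ∈ Finset.Icc 1 D.N, z ≠ D.s i := fun i hi => by
    intro h
    have := hz i hi
    rw [h, sub_self, norm_zero] at this
    linarith
  have hFz : DifferentiableAt ℂ F z := by
    have h1 : F =ᶠ[𝓝 z] fun w => G w * ∏ i ∈ Finset.Icc 1 D.N, ((w - D.s i) ^ D.m i)⁻¹ := by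
      filter_upwards [(Finset.eventually_all _).2 fun i hi => eventually_ne_nhds (hne i hi)]
        with w hw using hprod w hw
    refine DifferentiableAt.congr_of_eventuallyEq ?_ h1
    refine (hG z).mul (DifferentiableAt.fun_finsetProd fun i hi => ?_)
    exact DifferentiableAt.inv (by fun_prop) (pow_ne_zero _ (_root_.sub_ne_zero.2 (hne i hi)))
  rw [(hF.xi_eventuallyEq_rawXi (hF.differentiableAt_rawXi hFz hz').continuousAt).eq_of_nhds,
    rawXi, hprod z hne]

/-- The completed function has no zeros far to the right, hence by the functional equation none far
to the left, and the Phragmén–Lindelöf principle bounds its growth in between. -/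
theorem exists_isStripFunction (hF : InClass σ₀ σ₁ F D) (h0 : xi σ₁ F D 0 ≠ 0) :
    ∃ B, IsStripFunction σ₁ B D.ω (xi σ₁ F D) := by
  obtain ⟨b', hb'⟩ := eventually_reAtTop.1 hF.eventually_isFarRight
  set b := max b' σ₁ with hbdef
  have hb : ∀ z : ℂ, b ≤ z.re → IsFarRight σ₀ σ₁ D z := fun z hz =>
    hb' z ((le_max_left _ _).trans hz)
  have hbσ : σ₁ ≤ b := le_max_right _ _
  have hσ := hF.sigma_pos
  have hR := hF.subGaussianOn_right hb
  have hw : 0 < b - (σ₁ - b) := by linarith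
  have hzr : ∀ z, xi σ₁ F D z = 0 → z.re ≤ b := fun z hz =>
    le_of_not_ge fun h => hF.xi_ne_zero_right (hb z h) hz
  refine ⟨b, hF.xi_entire, h0, fun A hA => ?_, ?_, hF.functional_equation, fun ρ hρ => ?_, hσ, hbσ⟩
  · exact growth_of_strip hF.xi_entire (half_pos (div_pos Real.pi_pos hw))
      (half_lt_self (div_pos Real.pi_pos hw)) (hF.subGaussianOn_left hR) hR
      (hF.doubleExp_xi (half_pos (div_pos Real.pi_pos hw))) hA
  · intro h
    have := hF.norm_omega
    rw [h, norm_zero] at this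
    exact zero_ne_one this
  · have h1 := hzr ρ hρ
    have h2 : xi σ₁ F D ((σ₁ : ℂ) - (starRingEnd ℂ) ρ) = 0 := by
      rw [hF.functional_equation]
      simp [hρ]
    have h3 := hzr _ h2
    rw [Complex.sub_re, Complex.ofReal_re, Complex.conj_re] at h3
    rw [abs_le]
    constructor <;> linarith

end InClass

end TauLi

theorem mainTheorem6 (σ₀ σ₁ : ℝ) (F : ℂ → ℂ) (D : TauLi.CompletionData)
    (hF : TauLi.InClass σ₀ σ₁ F D)
    (τ : ℝ) (hτ : τ ∈ Set.Icc σ₁ (2 * σ₀))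
    (h0 : TauLi.xi σ₁ F D 0 ≠ 0) (hξτ : TauLi.xi σ₁ F D (τ : ℂ) ≠ 0)
    (n : ℕ) (hn : 1 ≤ n) :
    (∀ T : ℝ, (TauLi.zerosUpTo (TauLi.xi σ₁ F D) T).Finite) ∧
    Filter.Tendsto (TauLi.tauLiPartial (TauLi.xi σ₁ F D) n τ) Filter.atTop
      (nhds (TauLi.tauLi (TauLi.xi σ₁ F D) n τ)) ∧
    (∃ ℓ : ℂ → ℂ, TauLi.IsLogBranchAt (TauLi.xi σ₁ F D) ℓ (τ : ℂ)) ∧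
    (∀ ℓ : ℂ → ℂ, TauLi.IsLogBranchAt (TauLi.xi σ₁ F D) ℓ (τ : ℂ) →
      TauLi.tauLi (TauLi.xi σ₁ F D) n τ =
        (τ : ℂ) / ((n - 1).factorial : ℂ) *
          iteratedDeriv n (fun w : ℂ => w ^ (n - 1) * ℓ w) (τ : ℂ)) ∧
    (∀ᶠ w in nhds (1 - 1 / (τ : ℂ)),
      HasSum (fun k : ℕ => TauLi.dCoeff (TauLi.xi σ₁ F D) k (1 - 1 / (τ : ℂ)) *
          (w - (1 - 1 / (τ : ℂ))) ^ k)
        (TauLi.logDerivTransform (TauLi.xi σ₁ F D) w)) ∧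
    TauLi.tauLi (TauLi.xi σ₁ F D) n τ =
      1 / (τ : ℂ) ^ n * TauLi.dCoeff (TauLi.xi σ₁ F D) (n - 1) (1 - 1 / (τ : ℂ)) := by
  obtain ⟨B, h⟩ := hF.exists_isStripFunction h0
  obtain ⟨a, C, ht⟩ := hF.isTame_logDeriv.exists_hasTameLogDeriv
  obtain ⟨k, rfl⟩ : ∃ k, n = k + 1 := ⟨n - 1, by omega⟩
  have hτ0 : (τ : ℂ) ≠ 0 := by exact_mod_cast (hF.sigma_pos.trans_le hτ.1).ne'
  have han : AnalyticAt ℂ (TauLi.xi σ₁ F D) τ := hF.xi_entire.analyticAt _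
  have hlim := h.tendsto_sum_one_sub_pow ht hξτ k
  simp_rw [← h.tauLiPartial_eq] at hlim
  have hval : TauLi.tauLi (TauLi.xi σ₁ F D) (k + 1) τ = _ := hlim.limUnder_eq
  obtain ⟨ℓ₀, hℓ₀⟩ := TauLi.exists_isLogBranchAt han hξτ
  have hbranch : ∀ ℓ : ℂ → ℂ, TauLi.IsLogBranchAt (TauLi.xi σ₁ F D) ℓ (τ : ℂ) →
      TauLi.tauLi (TauLi.xi σ₁ F D) (k + 1) τ = (τ : ℂ) / (k.factorial : ℂ) *
        iteratedDeriv (k + 1) (fun w : ℂ => w ^ k * ℓ w) (τ : ℂ) := fun ℓ hℓ => by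
    rw [hval, hℓ.mul_iteratedDeriv]
  refine ⟨h.finite_zerosUpTo, ?_, ⟨ℓ₀, hℓ₀⟩, hbranch, ?_, ?_⟩
  · rw [hval]
    exact hlim
  · exact TauLi.eventually_hasSum_dCoeff (TauLi.analyticAt_logDerivTransform han hτ0 hξτ)
  · rw [Nat.add_sub_cancel, hℓ₀.dCoeff_eq hτ0, hbranch ℓ₀ hℓ₀]
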